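/- Let $G=SL(2,\mathbb R)$, $k_\theta=\begin{pmatrix}\cos\theta&-\sin\theta\\ \sin\theta&\cos\theta\end{pmatrix}$, $n_t=\begin{pmatrix}1&t\\0&1\end{pmatrix}$, let $a>0$ also denote $\mathrm{diag}(a,a^{-1})\in G$, and let $P_0=\{a\,n_t: a>0,\ t\in\mathbb R\}$. For an integer $n$ with $|n|\ge 2$ let $D_n$ be the discrete series representation of $G$: for $n\ge 2$ it is the Hilbert space of holomorphic functions $F$ on the upper half-plane with $\|F\|^2=\int |F(x+iy)|^2y^{n}\,\frac{dx\,dy}{y^2}<\infty$, on which $g=\begin{pmatrix}a&b\\c&d\end{pmatrix}$ acts by $(D_n(g)F)(z)=(a-cz)^{-n}F\!\left(\frac{dz-b}{a-cz}\right)$; and $D_{-n}$ is its complex conjugate, which is its dual. Let $D_{-n}^{\infty}\subseteq D_{-n}$ be the space of smooth vectors with its usual Fréchet topology, let $D_n^{-\infty}$ be the continuous dual of $D_{-n}^{\infty}$, and put $\langle D_n(g)\tau,v\rangle=\tau(D_{-n}(g^{-1})v)$ for $\tau\in D_n^{-\infty}$, $v\in D_{-n}^{\infty}$, $g\in G$.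 **Corollary (discrete series case).** Let $n\in\mathbb Z$ with $|n|\ge 2$ and let $\mathfrak p$ be a positive integer. Let $\tau\in D_n^{-\infty}$ be periodic with period $\mathfrak p$, i.e. $D_n(n_{\mathfrak p})\tau=\tau$, and without constant term, i.e. $\int_0^{\mathfrak p}\langle D_n(n_t)\tau,v\rangle\,dt=0$ for all $v\in D_{-n}^\infty$. Suppose that for some nonzero $\phi\in D_{-n}^{\infty}$ the function $\langle D_n(an_t)\tau,\phi\rangle$ is bounded on $P_0$. Then for every $\epsilon>0$ there is a constant $C_{\epsilon,\tau}>0$ such that for all $a_1>0$ and all $v\in D_{-n}^{\infty}$ $$\int_0^{a_1}\int_0^{\mathfrak p}|\langle D_n(an_t)\tau,v\rangle|^2\,dt\,a^{\epsilon}\frac{da}{a}\le C_{\epsilon,\tau}\,a_1^{\epsilon}\,\|v\|^2_{D_{-n}},$$ $$\int_0^{2\pi}\int_0^{a_1}\int_0^{\mathfrak p}|\langle D_n(k_\theta an_t)\tau,v\rangle|^2\,dt\,a^{\epsilon}\frac{da}{a}\,d\theta\le C_{\epsilon,\tau}\,a_1^{\epsilon}\,\|v\|^2_{D_{-n}}.$$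 Consequently the same holds for all $v\in D_{-n}$: for every $a_1>0$, the maps $v\mapsto\langle D_n(an_t)\tau,v\rangle$ and $v\mapsto\langle D_n(k_\theta an_t)\tau,v\rangle$ extend from $D_{-n}^{\infty}$ to bounded linear operators from $D_{-n}$ to $L^2\big((0,a_1]\times(0,\mathfrak p],\,a^\epsilon\frac{da}{a}dt\big)$ and to $L^2\big([0,2\pi)\times(0,a_1]\times(0,\mathfrak p],\,d\theta\,a^\epsilon\frac{da}{a}dt\big)$ respectively, both with squared operator norm at most $C_{\epsilon,\tau}\,a_1^\epsilon$. -/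

import Mathlib

open MeasureTheory UpperHalfPlane
open scoped MatrixGroups Manifold ContDiff ComplexConjugate

/-! ### The subgroups `K`, `A`, `N` of `SL(2, ℝ)` -/

/-- The rotation `k_θ`. -/
noncomputable def rotK (θ : ℝ) : SL(2, ℝ) :=
  ⟨!![Real.cos θ, -Real.sin θ; Real.sin θ, Real.cos θ], by
    rw [Matrix.det_fin_two_of]; nlinarith [Real.sin_sq_add_cos_sq θ]⟩

/-- The diagonal matrix `diag(a, a⁻¹)`; it is only used for `a > 0` (and is `1` for `a = 0`). -/
noncomputable def diagA (a : ℝ) : SL(2, ℝ) :=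
  if h : a ≠ 0 then ⟨!![a, 0; 0, a⁻¹], by rw [Matrix.det_fin_two_of]; field_simp; simp⟩ else 1

/-- The unipotent matrix `n_t`. -/
noncomputable def unipN (t : ℝ) : SL(2, ℝ) :=
  ⟨!![1, t; 0, 1], by simp [Matrix.det_fin_two_of]⟩

/-- The coordinates `(θ, s, t) ↦ k_θ a n_t`, `a = exp s`, of the Iwasawa decomposition
(a smooth surjective local diffeomorphism onto `SL(2, ℝ)`). -/
noncomputable def iwasawa (x : ℝ × ℝ × ℝ) : SL(2, ℝ) :=
  rotK x.1 * diagA (Real.exp x.2.1) * unipN x.2.2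

/-- The one-parameter subgroups of `K`, `A`, `N`; their tangent vectors at `1` form a basis
of the Lie algebra `sl(2, ℝ)`. -/
noncomputable def oneParam (i : Fin 3) (s : ℝ) : SL(2, ℝ) :=
  ![rotK s, diagA (Real.exp s), unipN s] i

/-! ### The discrete series `D_k`

For `k ≥ 2`, `D_k` is the Hilbert space of holomorphic functions `F` on the upper half-plane
with `∫ |F(x + iy)|² y^k dx dy / y² < ∞`, with the action
`(g F)(z) = (-c z + a)^{-k} F(g⁻¹ z)` of `g = (a, b; c, d)`.
For `k ≤ -2`, `D_k` is the complex conjugate (equivalently, the dual) of `D_{-k}`: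
anti-holomorphic functions, with the conjugate factor. -/

/-- The measure `y^{|k|} dx dy / y²` on the upper half-plane. -/
noncomputable def bergmanMeasure (k : ℤ) : Measure ℍ :=
  (volume : Measure ℍ).withDensity fun z => ENNReal.ofReal (z.im ^ k.natAbs)

/-- Holomorphic for `k > 0`, anti-holomorphic otherwise. -/
def IsHol (k : ℤ) (F : ℍ → ℂ) : Prop :=
  if 0 < k then MDifferentiable 𝓘(ℂ) 𝓘(ℂ) F
  else MDifferentiable 𝓘(ℂ) 𝓘(ℂ) fun z => conj (F z)

/-- The factor of automorphy: `(c z + d)^k` for `k > 0`, its conjugate analogue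
`(c z̄ + d)^{|k|}` otherwise. -/
noncomputable def autFactor (k : ℤ) (g : SL(2, ℝ)) (z : ℍ) : ℂ :=
  if 0 < k then denom g z ^ k.natAbs else conj (denom g z) ^ k.natAbs

/-- `(g F)(z) = j_k(g⁻¹, z)⁻¹ F(g⁻¹ z)`. -/
noncomputable def slashAct (k : ℤ) (g : SL(2, ℝ)) (F : ℍ → ℂ) (z : ℍ) : ℂ :=
  (autFactor k g⁻¹ z)⁻¹ * F (g⁻¹ • z)

theorem IsHol.continuous {k : ℤ} {F : ℍ → ℂ} (h : IsHol k F) : Continuous F := by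
  unfold IsHol at h
  split_ifs at h
  · exact h.continuous
  · simpa [Function.comp_def] using Complex.continuous_conj.comp h.continuous

theorem coe_sl_smul (g : SL(2, ℝ)) (z : ℍ) :
    ((g • z : ℍ) : ℂ) = num g z / denom g z := by
  have : (g • z : ℍ) = (g : GL (Fin 2) ℝ) • z := rfl
  rw [this, coe_smul_of_det_pos (by simp)]

theorem autFactor_mul (k : ℤ) (g h : SL(2, ℝ)) (z : ℍ) :
    autFactor k (g * h) z = autFactor k g (h • z) * autFactor k h z := by
  have h2 : denom ((g * h : SL(2, ℝ)) : GL (Fin 2) ℝ) z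
      = denom (g : GL (Fin 2) ℝ) ((h • z : ℍ) : ℂ) * denom (h : GL (Fin 2) ℝ) z := by
    rw [map_mul, denom_cocycle _ _ z.im_ne_zero, coe_sl_smul]
  unfold autFactor
  rw [h2]
  split_ifs
  · rw [mul_pow]
  · rw [map_mul, mul_pow]

theorem autFactor_ne_zero (k : ℤ) (g : SL(2, ℝ)) (z : ℍ) : autFactor k g z ≠ 0 := by
  have := denom_ne_zero (g : GL (Fin 2) ℝ) z
  unfold autFactor
  split_ifs
  · exact pow_ne_zero _ this
  · exact pow_ne_zero _ ((map_ne_zero _).mpr this)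

theorem norm_autFactor (k : ℤ) (g : SL(2, ℝ)) (z : ℍ) :
    ‖autFactor k g z‖ = ‖denom g z‖ ^ k.natAbs := by
  unfold autFactor
  split_ifs <;> simp

theorem slashAct_one (k : ℤ) (F : ℍ → ℂ) : slashAct k 1 F = F := by
  funext z
  have : denom ((1 : SL(2, ℝ)) : GL (Fin 2) ℝ) z = 1 := by rw [map_one]; simp
  simp [slashAct, autFactor, denom]

theorem slashAct_mul (k : ℤ) (g h : SL(2, ℝ)) (F : ℍ → ℂ) :
    slashAct k (g * h) F = slashAct k g (slashAct k h F) := by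
  funext z
  simp only [slashAct, mul_inv_rev, autFactor_mul, mul_smul]
  ring

theorem IsHol.slashAct {k : ℤ} {F : ℍ → ℂ} (h : IsHol k F) (g : SL(2, ℝ)) :
    IsHol k (slashAct k g F) := by
  have hg : 0 < ((g⁻¹ : SL(2, ℝ)) : GL (Fin 2) ℝ).det.val := by simp
  have hd : MDifferentiable 𝓘(ℂ) 𝓘(ℂ)
      fun z : ℍ => (denom ((g⁻¹ : SL(2, ℝ)) : GL (Fin 2) ℝ) z ^ k.natAbs)⁻¹ := by
    have := mdifferentiable_denom_zpow ((g⁻¹ : SL(2, ℝ)) : GL (Fin 2) ℝ) (-(k.natAbs : ℤ))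
    simpa only [zpow_neg, zpow_natCast] using this
  unfold IsHol at h ⊢
  unfold _root_.slashAct autFactor
  split_ifs at h ⊢ with hk
  · exact hd.mul (h.comp (mdifferentiable_smul hg))
  · simp only [map_mul, map_inv₀, map_pow, Complex.conj_conj]
    exact hd.mul (h.comp (mdifferentiable_smul hg))

theorem lintegral_slashAct (k : ℤ) {F : ℍ → ℂ} (hF : Continuous F) (g : SL(2, ℝ)) :
    ∫⁻ z, ‖slashAct k g F z‖ₑ ^ (2 : ℝ) ∂bergmanMeasure k
      = ∫⁻ z, ‖F z‖ₑ ^ (2 : ℝ) ∂bergmanMeasure k := by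
  have hw : Measurable fun z : ℍ => ENNReal.ofReal (z.im ^ k.natAbs) :=
    ENNReal.measurable_ofReal.comp (continuous_im.pow _).measurable
  have hm : MeasurePreserving (fun z : ℍ => (g⁻¹ : SL(2, ℝ)) • z) volume volume :=
    measurePreserving_smul ((g⁻¹ : SL(2, ℝ)) : GL (Fin 2) ℝ) volume
  have key : ∀ z : ℍ, ENNReal.ofReal (z.im ^ k.natAbs) * ‖slashAct k g F z‖ₑ ^ (2 : ℝ)
      = ENNReal.ofReal ((g⁻¹ • z).im ^ k.natAbs) * ‖F (g⁻¹ • z)‖ₑ ^ (2 : ℝ) := by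
    intro z
    have hd : ‖denom ((g⁻¹ : SL(2, ℝ)) : GL (Fin 2) ℝ) z‖ ≠ 0 :=
      norm_ne_zero_iff.mpr (denom_ne_zero _ z)
    have him : (g⁻¹ • z).im = z.im / ‖denom ((g⁻¹ : SL(2, ℝ)) : GL (Fin 2) ℝ) z‖ ^ 2 := by
      have := im_smul_eq_div_normSq ((g⁻¹ : SL(2, ℝ)) : GL (Fin 2) ℝ) z
      rw [Complex.normSq_eq_norm_sq] at this
      have h1 : ((g⁻¹ : SL(2, ℝ)) : GL (Fin 2) ℝ).det.val = 1 := by simp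
      rw [h1, abs_one, one_mul] at this
      exact this
    simp only [← ofReal_norm, ENNReal.rpow_two]
    rw [← ENNReal.ofReal_pow (norm_nonneg _), ← ENNReal.ofReal_pow (norm_nonneg _),
      ← ENNReal.ofReal_mul (pow_nonneg z.im_pos.le _),
      ← ENNReal.ofReal_mul (pow_nonneg (im_pos _).le _), him]
    congr 1
    rw [slashAct, norm_mul, norm_inv, norm_autFactor, div_pow, ← pow_mul, mul_pow, inv_pow,
      ← pow_mul, mul_comm 2 k.natAbs]
    field_simp
  have hmeas : ∀ G : ℍ → ℂ, Continuous G → Measurable fun z => ‖G z‖ₑ ^ (2 : ℝ) :=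
    fun G hG => hG.measurable.enorm.pow_const _
  rw [bergmanMeasure, lintegral_withDensity_eq_lintegral_mul_non_measurable _ hw
      (Filter.Eventually.of_forall fun _ => ENNReal.ofReal_lt_top),
    lintegral_withDensity_eq_lintegral_mul_non_measurable _ hw
      (Filter.Eventually.of_forall fun _ => ENNReal.ofReal_lt_top)]
  simp only [Pi.mul_apply, key]
  exact hm.lintegral_comp (hw.mul (hmeas F hF))

/-- The underlying space of functions of `D_k`. -/
def bergmanSpace (k : ℤ) : Submodule ℂ (ℍ → ℂ) where
  carrier := {F | IsHol k F ∧ MemLp F 2 (bergmanMeasure k)}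
  zero_mem' := by
    refine ⟨?_, MemLp.zero⟩
    unfold IsHol
    split_ifs
    · exact mdifferentiable_const
    · simpa using mdifferentiable_const
  add_mem' := by
    rintro F G ⟨hF, hF'⟩ ⟨hG, hG'⟩
    refine ⟨?_, hF'.add hG'⟩
    unfold IsHol at *
    split_ifs at *
    · exact hF.add hG
    · simpa using! hF.add hG
  smul_mem' := by
    rintro c F ⟨hF, hF'⟩
    refine ⟨?_, hF'.const_smul c⟩
    unfold IsHol at *
    split_ifs at *
    · exact mdifferentiable_const.mul hF
    · simpa using! (mdifferentiable_const (c := conj c)).mul hF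

theorem slashAct_mem {k : ℤ} {F : ℍ → ℂ} (hF : F ∈ bergmanSpace k) (g : SL(2, ℝ)) :
    slashAct k g F ∈ bergmanSpace k := by
  refine ⟨hF.1.slashAct g, (hF.1.slashAct g).continuous.aestronglyMeasurable, ?_⟩
  have h := hF.2.2
  rw [eLpNorm_lt_top_iff_lintegral_rpow_enorm_lt_top (by simp) (by simp)] at h ⊢
  simpa only [ENNReal.toReal_ofNat, lintegral_slashAct k hF.1.continuous g] using h

/-- The space of the (discrete series, for `2 ≤ |k|`) representation `D_k`. -/
def DiscSeries (k : ℤ) : Type := bergmanSpace k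

namespace DiscSeries

variable {k : ℤ}

noncomputable instance : AddCommGroup (DiscSeries k) :=
  inferInstanceAs (AddCommGroup (bergmanSpace k))

noncomputable instance : Module ℂ (DiscSeries k) :=
  inferInstanceAs (Module ℂ (bergmanSpace k))

/-- The function on the upper half-plane underlying a vector of `D_k`. -/
def fn (v : DiscSeries k) : ℍ → ℂ := v.1

/-- The embedding of `D_k` in `L²`. -/
noncomputable def toL2 : DiscSeries k →ₗ[ℂ] Lp ℂ 2 (bergmanMeasure k) where
  toFun v := v.2.2.toLp v.1
  map_add' _ _ := rfl
  map_smul' _ _ := rfl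

theorem toL2_injective : Function.Injective (toL2 (k := k)) := by
  intro v w h
  have h1 : v.1 =ᵐ[bergmanMeasure k] w.1 := (MemLp.toLp_eq_toLp_iff v.2.2 w.2.2).mp h
  have hw : Measurable fun z : ℍ => ENNReal.ofReal (z.im ^ k.natAbs) :=
    ENNReal.measurable_ofReal.comp (continuous_im.pow _).measurable
  have h2 : v.1 =ᵐ[(volume : Measure ℍ)] w.1 := by
    have := (ae_withDensity_iff hw).mp h1
    filter_upwards [this] with z hz
    exact hz (by simpa using pow_pos z.im_pos _)
  have ho : (volume.comap UpperHalfPlane.coe : Measure ℍ).IsOpenPosMeasure :=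
    Measure.IsOpenPosMeasure.comap _ isOpenEmbedding_coe
  have hac : (volume.comap UpperHalfPlane.coe : Measure ℍ) ≪ volume := by
    rw [volume_def]
    refine withDensity_absolutelyContinuous' ?_ ?_
    · refine Measurable.aemeasurable (Continuous.measurable ?_)
      refine ENNReal.continuous_coe.comp (.pow (.div₀ continuous_const ?_ ?_) _)
      · exact continuous_im.subtype_mk _
      · exact fun x => NNReal.ne_iff.mp x.im_ne_zero
    · refine Filter.Eventually.of_forall fun z => ?_
      have : (NNReal.mk z.im z.im_pos.le) ≠ 0 := NNReal.ne_iff.mp z.im_ne_zero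
      have h := pow_ne_zero 2 (one_div_ne_zero this)
      exact ENNReal.coe_ne_zero.mpr h
  exact Subtype.ext (Measure.eq_of_ae_eq (hac.ae_le h2) v.2.1.continuous w.2.1.continuous)

/-- The norm is the `L²` norm `(∫ |F|² y^{|k|} dx dy / y²)^{1/2}`. -/
noncomputable instance : NormedAddCommGroup (DiscSeries k) :=
  NormedAddCommGroup.induced _ _ (toL2 (k := k)) toL2_injective

noncomputable instance : NormedSpace ℂ (DiscSeries k) :=
  NormedSpace.induced ℂ _ _ (toL2 (k := k))

end DiscSeries

/-- The representation `D_k` of `SL(2, ℝ)`. -/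
noncomputable def discRep (k : ℤ) : Representation ℂ SL(2, ℝ) (DiscSeries k) where
  toFun g :=
    { toFun := fun v => ⟨slashAct k g v.1, slashAct_mem v.2 g⟩
      map_add' := fun _ _ => Subtype.ext (funext fun _ => mul_add _ _ _)
      map_smul' := fun _ _ => Subtype.ext (funext fun _ => mul_left_comm _ _ _) }
  map_one' := LinearMap.ext fun v => Subtype.ext (slashAct_one k v.1)
  map_mul' g h := LinearMap.ext fun v => Subtype.ext (slashAct_mul k g h v.1)

/-- The smooth vectors `D_k^∞`: the orbit map `h ↦ D_k(h) v` is `C^∞` on `SL(2, ℝ)`, in the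
charts given by the right translates of the Iwasawa coordinates. -/
noncomputable def smoothVectors (k : ℤ) : Submodule ℂ (DiscSeries k) where
  carrier := {v | ∀ g : SL(2, ℝ), ContDiff ℝ ∞ fun x : ℝ × ℝ × ℝ => discRep k (iwasawa x * g) v}
  zero_mem' g := by simpa using contDiff_const
  add_mem' hv hw g := by simpa using (hv g).add (hw g)
  smul_mem' c _ hv g := by simpa using (hv g).const_smul c

/-- The action of `SL(2, ℝ)` on `D_k^∞`. -/
noncomputable def smoothRep (k : ℤ) (g : SL(2, ℝ)) : smoothVectors k →ₗ[ℂ] smoothVectors k :=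
  (discRep k g).restrict fun v hv h => by
    have := hv (h * g)
    simpa only [← mul_assoc, map_mul, Module.End.mul_apply] using this

/-- The action `X_i v = d/ds D_k(γ_i(s)) v` at `s = 0` of a basis of the Lie algebra. -/
noncomputable def lieAct (k : ℤ) (i : Fin 3) (v : DiscSeries k) : DiscSeries k :=
  deriv (fun s : ℝ => discRep k (oneParam i s) v) 0

/-- `X_{i₁} ⋯ X_{i_m} v` for the word `[i₁, …, i_m]`. -/
noncomputable def lieWord (k : ℤ) (w : List (Fin 3)) (v : DiscSeries k) : DiscSeries k :=
  w.foldr (lieAct k) v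

/-- The distribution vectors `D_k^{-∞}`: the linear functionals on `D_{-k}^∞` that are continuous
for its usual Fréchet topology, defined by the seminorms `‖X_{i₁} ⋯ X_{i_m} v‖`. -/
def DistVectors (k : ℤ) : Type :=
  {τ : smoothVectors (-k) →ₗ[ℂ] ℂ // ∃ (S : Finset (List (Fin 3))) (C : ℝ),
    ∀ v : smoothVectors (-k), ‖τ v‖ ≤ C * ∑ w ∈ S, ‖lieWord (-k) w v‖}

/-- The matrix coefficient `⟨D_k(g) τ, v⟩ = τ(D_{-k}(g⁻¹) v)`. -/
noncomputable def matCoeff {k : ℤ} (τ : DistVectors k) (v : smoothVectors (-k))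
    (g : SL(2, ℝ)) : ℂ :=
  τ.1 (smoothRep (-k) g⁻¹ v)

/-- `D_k(n_p) τ = τ`. -/
def IsPeriodic {k : ℤ} (p : ℝ) (τ : DistVectors k) : Prop :=
  ∀ v : smoothVectors (-k), matCoeff τ v (unipN p) = τ.1 v

/-- The constant term `∫_0^p D_k(n_t) τ dt` vanishes. -/
def NoConstantTerm {k : ℤ} (p : ℝ) (τ : DistVectors k) : Prop :=
  ∀ v : smoothVectors (-k), ∫ t in (0 : ℝ)..p, matCoeff τ v (unipN t) = 0

/-- The measure `a^ε (da / a) dt` on `{(a, t) | 0 < a ≤ a₁, 0 < t ≤ p}`. -/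
noncomputable def siegelMeasure (ε a₁ p : ℝ) : Measure (ℝ × ℝ) :=
  ((volume.restrict (Set.Ioc 0 a₁)).withDensity fun a => ENNReal.ofReal (a ^ ε / a)).prod
    (volume.restrict (Set.Ioc 0 p))

/-- The measure `dθ a^ε (da / a) dt` on
`{(θ, a, t) | 0 ≤ θ < 2π, 0 < a ≤ a₁, 0 < t ≤ p}`. -/
noncomputable def siegelMeasureK (ε a₁ p : ℝ) : Measure (ℝ × ℝ × ℝ) :=
  (volume.restrict (Set.Ico 0 (2 * Real.pi))).prod (siegelMeasure ε a₁ p)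

set_option linter.unusedSectionVars false

/-! ### The Bergman measure and point evaluations -/

/-! Complex conjugation exchanges `D_k` and `D_{-k}`, so the matter concerns a continuous functional
`l` on the smooth vectors of a holomorphic `D_K`, `K ≥ 2`. Periodicity splits `l` along `N` into
Fourier modes (`fourierMode`); the mode of order `m` is a Whittaker functional of frequency `ξ_m = m
/ p` (`IsWhittaker`).

Whittaker functionals are rigid. Each K-type is spanned by a polynomial in the generator of `N`
applied to the lowest weight vector `(z + i)^{-K}` (`typeVec_fn`), and a Whittaker functional turns
that generator into the scalar `-2πiξ`. Hence it equals its value at the lowest weight vector times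
`kirillov u ξ`, a function that does not depend on the functional (`IsWhittaker.apply_eq`). Along
`A`, its value at the lowest weight vector solves a first-order equation with an explicit solution
(`IsWhittaker.apply_diagA_exp_lowS`). For `ξ < 0` this solution grows too fast for a continuous
functional; the mode `m = 0` vanishes by hypothesis. With Parseval over a period, the integral of
`|l((a n_t)⁻¹ u)|²` over `0 < t ≤ p` is `p ∑ w_m H_u(ξ_m / a²)`, summed over `m > 0`, where the `w_m
≥ 0` depend on `l` only and `H_u = kirillovSq u`.

On polynomial vectors the Kirillov map is isometric up to a constant, by Gamma integrals. A limit
argument gives `∫ H_u dx/x ≤ c ‖u‖²` for every smooth `u` and shows that `H_u` vanishes almost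
everywhere only for `u = 0`.

Boundedness for the single vector `φ` says that `∑ w_m H_φ(ξ_m / a²)` is bounded in `a`. Integrating
against `a^ε da/a` and substituting `x = ξ / a²` gives `∑_{ξ_m ≤ Y} w_m ξ_m^{ε/2} ≤ C Y^{ε/2}`
(`exists_tsum_rpow_le`), a statement about `l` alone. The same substitution for arbitrary `v` then
gives the first estimate (`exists_lintegral_tsum_le`). The second follows because the norm is
invariant under rotations, and the operators arise by extension from a subspace. -/

theorem lintegral_bergmanMeasure (k : ℤ) (F : ℍ → ENNReal) (hF : Measurable F) :
    ∫⁻ z, F z ∂bergmanMeasure k =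
      ∫⁻ w in {w : ℂ | 0 < w.im},
        ENNReal.ofReal (w.im ^ k.natAbs / w.im ^ 2) * F (ofComplex w) := by
  have hw : Measurable fun z : ℍ => ENNReal.ofReal (z.im ^ k.natAbs) :=
    ENNReal.measurable_ofReal.comp (continuous_im.pow _).measurable
  have hw2 : Measurable fun z : ℍ => ((1 / NNReal.mk z.im z.im_pos.le : NNReal) ^ 2 : NNReal) := by
    refine Continuous.measurable (.pow (.div₀ continuous_const ?_ ?_) _)
    · exact continuous_im.subtype_mk _
    · exact fun x => NNReal.ne_iff.mp x.im_ne_zero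
  have hpres : MeasurePreserving UpperHalfPlane.coe (volume.comap UpperHalfPlane.coe)
      (volume.restrict (.range UpperHalfPlane.coe)) :=
    ⟨measurable_coe, by rw [measurableEmbedding_coe.map_comap]⟩
  have hr : Set.range UpperHalfPlane.coe = {w : ℂ | 0 < w.im} := by
    ext w
    exact ⟨by rintro ⟨z, rfl⟩; exact z.im_pos, fun h => ⟨⟨w, h⟩, rfl⟩⟩
  rw [bergmanMeasure, lintegral_withDensity_eq_lintegral_mul _ hw hF, volume_def,
    lintegral_withDensity_eq_lintegral_mul _ (by exact_mod_cast hw2.coe_nnreal_ennreal)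
      (hw.mul hF), ← hr,
    ← hpres.lintegral_comp_emb measurableEmbedding_coe]
  refine lintegral_congr fun z => ?_
  simp only [Pi.mul_apply, ofComplex_apply]
  rw [← mul_assoc]
  congr 1
  have h2 : ((((1 / NNReal.mk z.im z.im_pos.le : NNReal) ^ 2 : NNReal)) : ENNReal)
      = ENNReal.ofReal (1 / z.im ^ 2) := by
    rw [ENNReal.ofReal]
    congr 1
    ext
    rw [Real.coe_toNNReal _ (by positivity)]
    simp
  push_cast at h2 ⊢
  rw [h2, ← ENNReal.ofReal_mul (by positivity)]
  congr 1
  rw [UpperHalfPlane.coe_im]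
  ring

namespace DiscSeries

variable {k : ℤ}

@[simp] theorem fn_add (u v : DiscSeries k) (z : ℍ) : (u + v).fn z = u.fn z + v.fn z := rfl
@[simp] theorem fn_smul (c : ℂ) (v : DiscSeries k) (z : ℍ) : (c • v).fn z = c * v.fn z := rfl
@[simp] theorem fn_zero (z : ℍ) : (0 : DiscSeries k).fn z = 0 := rfl
@[simp] theorem fn_sub (u v : DiscSeries k) (z : ℍ) : (u - v).fn z = u.fn z - v.fn z := rfl

@[ext] theorem ext {u v : DiscSeries k} (h : ∀ z, u.fn z = v.fn z) : u = v :=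
  Subtype.ext (funext h)

theorem norm_def (v : DiscSeries k) : ‖v‖ = ‖toL2 v‖ := rfl

/-- The isometric embedding in `L²`. -/
noncomputable def toL2ᵢ : DiscSeries k →ₗᵢ[ℂ] Lp ℂ 2 (bergmanMeasure k) :=
  ⟨toL2, fun _ => rfl⟩

theorem continuous_fn (v : DiscSeries k) : Continuous v.fn := v.2.1.continuous

theorem ofReal_norm_sq (v : DiscSeries k) :
    ENNReal.ofReal (‖v‖ ^ 2) = ∫⁻ z, ‖v.fn z‖ₑ ^ 2 ∂bergmanMeasure k := by
  have h1 : ‖toL2 v‖ₑ = eLpNorm v.fn 2 (bergmanMeasure k) := by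
    rw [Lp.enorm_def]
    exact eLpNorm_congr_ae v.2.2.coeFn_toLp
  rw [norm_def, ENNReal.ofReal_pow (norm_nonneg _), ofReal_norm, h1,
    eLpNorm_eq_lintegral_rpow_enorm_toReal (by simp) (by simp)]
  simp only [ENNReal.toReal_ofNat, ENNReal.rpow_two]
  rw [← ENNReal.rpow_natCast, ← ENNReal.rpow_mul]
  simp

/-- The inner product of `L²`. -/
noncomputable instance : InnerProductSpace ℂ (DiscSeries k) where
  inner u v := inner ℂ (toL2 u) (toL2 v)
  norm_sq_eq_re_inner u := by
    rw [norm_def]; exact norm_sq_eq_re_inner (𝕜 := ℂ) _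
  conj_inner_symm u v := inner_conj_symm _ _
  add_left u v w := by rw [map_add, inner_add_left]
  smul_left u v c := by rw [map_smul, inner_smul_left]

variable [hk : Fact (2 ≤ k)]

/-- `Fact (2 ≤ k)` confines the analysis to the holomorphic series; the antiholomorphic one is
reached at the end through `conjV`. -/
theorem isHol_iff (F : ℍ → ℂ) :
    IsHol k F ↔ DifferentiableOn ℂ (F ∘ ofComplex) {w | 0 < w.im} := by
  have : 0 < k := by have := hk.out; omega
  rw [IsHol, if_pos this, mdifferentiable_iff]

theorem differentiableOn (v : DiscSeries k) :
    DifferentiableOn ℂ (v.fn ∘ ofComplex) {w | 0 < w.im} :=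
  (isHol_iff _).mp v.2.1

theorem differentiableAt (v : DiscSeries k) (z : ℍ) :
    DifferentiableAt ℂ (v.fn ∘ ofComplex) z :=
  (v.differentiableOn _ z.im_pos).differentiableAt
    (isOpen_upperHalfPlaneSet.mem_nhds z.im_pos)

end DiscSeries

/-- The sub-mean value property on circles for the square of a holomorphic function. -/
theorem enorm_sq_le_lintegral_circle {f : ℂ → ℂ} {c : ℂ} {R r : ℝ}
    (hf : DifferentiableOn ℂ f (Metric.ball c R)) (hr : 0 < r) (hrR : r < R) :
    ENNReal.ofReal (2 * Real.pi) * ‖f c‖ₑ ^ 2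
      ≤ ∫⁻ θ in Set.Ioo (-Real.pi) Real.pi, ‖f (circleMap c r θ)‖ₑ ^ 2 := by
  have hd : DiffContOnCl ℂ (fun w => f w ^ 2) (Metric.ball c |r|) := by
    rw [abs_of_pos hr]
    refine DifferentiableOn.diffContOnCl ?_
    rw [closure_ball _ hr.ne']
    exact (hf.pow 2).mono (Metric.closedBall_subset_ball hrR)
  have h1 := hd.circleAverage
  rw [Real.circleAverage_def] at h1
  -- Polar coordinates take angles in `(-π, π)`, circle averages in `(0, 2π)`; periodicity
  -- reconciles them.
  have h2 : ∫ θ in (0 : ℝ)..2 * Real.pi, f (circleMap c r θ) ^ 2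
      = ∫ θ in (-Real.pi)..Real.pi, f (circleMap c r θ) ^ 2 := by
    have hp : Function.Periodic (fun θ => f (circleMap c r θ) ^ 2) (2 * Real.pi) := fun θ => by
      simp [periodic_circleMap c r θ]
    have := hp.intervalIntegral_add_eq 0 (-Real.pi)
    rw [zero_add] at this
    rw [this]
    congr 1
    ring
  rw [h2, intervalIntegral.integral_of_le (by linarith [Real.pi_pos]),
    integral_Ioc_eq_integral_Ioo] at h1
  have h3 : ENNReal.ofReal (2 * Real.pi) * ‖f c‖ₑ ^ 2
      = ‖∫ θ in Set.Ioo (-Real.pi) Real.pi, f (circleMap c r θ) ^ 2‖ₑ := by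
    rw [← enorm_pow, ← h1, enorm_smul, ← mul_assoc, Real.enorm_of_nonneg (by positivity),
      ← ENNReal.ofReal_mul (by positivity), mul_inv_cancel₀ (by positivity)]
    simp
  rw [h3]
  refine (enorm_integral_le_lintegral_enorm _).trans (le_of_eq ?_)
  simp

/-- Integrate the circle inequality against `r dr` over `(0, R)`; the total mass is `2π · R²/2 =
πR²`. -/
theorem enorm_sq_le_lintegral_ball {f : ℂ → ℂ} {c : ℂ} {R : ℝ}
    (hf : DifferentiableOn ℂ f (Metric.ball c R)) (hR : 0 < R) :
    ENNReal.ofReal (Real.pi * R ^ 2) * ‖f c‖ₑ ^ 2 ≤ ∫⁻ w in Metric.ball c R, ‖f w‖ₑ ^ 2 := by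
  have hmeas : MeasurableSet (Metric.ball c R) := measurableSet_ball
  set F : ℂ → ENNReal := (Metric.ball c R).indicator fun w => ‖f w‖ₑ ^ 2 with hF
  rw [← lintegral_indicator hmeas]
  have h1 : ∫⁻ w, F w = ∫⁻ w, F (c + w) := (lintegral_add_left_eq_self F c).symm
  rw [h1, ← Complex.lintegral_comp_polarCoord_symm (fun w => F (c + w))]
  have hFm : Measurable F := by
    classical
    have h1 : Measurable ((Metric.ball c R).indicator f) := by
      rw [← Set.piecewise_eq_indicator]
      exact hf.continuousOn.measurable_piecewise continuousOn_const hmeas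
    convert (h1.enorm).pow_const 2 using 2 with w
    by_cases hw : w ∈ Metric.ball c R <;> simp [hF, hw]
  have hm : Measurable fun p : ℝ × ℝ =>
      ENNReal.ofReal p.1 • F (c + Complex.polarCoord.symm p) := by
    have h : Measurable fun p : ℝ × ℝ => Complex.polarCoord.symm p := by
      simp only [Complex.polarCoord_symm_apply]
      fun_prop
    have h1 : Measurable fun p : ℝ × ℝ => F (c + Complex.polarCoord.symm p) :=
      hFm.comp (measurable_const.add h)
    have h2 : Measurable fun p : ℝ × ℝ => ENNReal.ofReal p.1 := measurable_fst.ennreal_ofReal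
    exact h2.mul h1
  rw [show polarCoord.target = Set.Ioi (0 : ℝ) ×ˢ Set.Ioo (-Real.pi) Real.pi from rfl,
    Measure.volume_eq_prod, ← Measure.prod_restrict, lintegral_prod _ hm.aemeasurable]
  calc ENNReal.ofReal (Real.pi * R ^ 2) * ‖f c‖ₑ ^ 2
      = ∫⁻ r in Set.Ioo 0 R, ENNReal.ofReal r * (ENNReal.ofReal (2 * Real.pi) * ‖f c‖ₑ ^ 2) := by
        rw [lintegral_mul_const _ (by fun_prop), ← mul_assoc]
        congr 1
        rw [← ofReal_integral_eq_lintegral_ofReal, ← integral_Ioc_eq_integral_Ioo,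
          ← intervalIntegral.integral_of_le hR.le, integral_id,
          ← ENNReal.ofReal_mul' (by positivity)]
        · congr 1; ring
        · exact (continuous_id.integrableOn_Icc).mono_set Set.Ioo_subset_Icc_self
        · exact (ae_restrict_mem measurableSet_Ioo).mono fun x hx => hx.1.le
    _ ≤ ∫⁻ r in Set.Ioo 0 R, ∫⁻ θ in Set.Ioo (-Real.pi) Real.pi,
          ENNReal.ofReal r • F (c + Complex.polarCoord.symm (r, θ)) := by
        refine setLIntegral_mono' measurableSet_Ioo fun r hr => ?_
        simp only [smul_eq_mul]
        rw [lintegral_const_mul' _ _ (by simp)]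
        gcongr
        refine (enorm_sq_le_lintegral_circle hf hr.1 hr.2).trans (le_of_eq ?_)
        refine lintegral_congr fun θ => ?_
        have : c + Complex.polarCoord.symm (r, θ) = circleMap c r θ := by
          rw [Complex.polarCoord_symm_apply, circleMap, Complex.exp_mul_I]
          push_cast
          ring
        rw [this, hF, Set.indicator_of_mem]
        rw [Metric.mem_ball, dist_eq_norm, circleMap_sub_center, norm_circleMap_zero,
          abs_of_pos hr.1]
        exact hr.2
    _ ≤ _ := lintegral_mono_set Set.Ioo_subset_Ioi_self

namespace DiscSeries

variable {k : ℤ} [hk : Fact (2 ≤ k)]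

/-- On the disc of radius `y / 2` about `z` the weight `Im^{K-2}` is at least `(y / 2)^{K-2}`, so
the sub-mean value inequality bounds the value by the norm. The factor `π ≥ 1` is dropped. -/
theorem norm_fn_sq_le (v : DiscSeries k) (z : ℍ) :
    ‖v.fn z‖ ^ 2 ≤ (z.im / 2)⁻¹ ^ k.natAbs * ‖v‖ ^ 2 := by
  have hz := z.im_pos
  have hK : 2 ≤ k.natAbs := by have := hk.out; omega
  set R := z.im / 2 with hR
  have hR0 : 0 < R := by positivity
  have him : ∀ w ∈ Metric.ball (z : ℂ) R, R < w.im := by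
    intro w hw
    rw [Metric.mem_ball, dist_eq_norm] at hw
    have := (Complex.abs_im_le_norm (w - z)).trans_lt hw
    rw [Complex.sub_im, UpperHalfPlane.coe_im, abs_lt] at this
    linarith [this.1]
  have hsub : Metric.ball (z : ℂ) R ⊆ {w | 0 < w.im} := fun w hw => hR0.trans (him w hw)
  have h1 := enorm_sq_le_lintegral_ball (v.differentiableOn.mono hsub) hR0
  have h2 : ENNReal.ofReal (R ^ (k.natAbs - 2)) *
      ∫⁻ w in Metric.ball (z : ℂ) R, ‖(v.fn ∘ ofComplex) w‖ₑ ^ 2 ≤ ENNReal.ofReal (‖v‖ ^ 2) := by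
    rw [ofReal_norm_sq, lintegral_bergmanMeasure k _ (by
      exact (v.continuous_fn.measurable.enorm).pow_const 2),
      ← lintegral_const_mul' _ _ (by simp)]
    refine (setLIntegral_mono' measurableSet_ball fun w hw => ?_).trans (lintegral_mono_set hsub)
    have := him w hw
    have hw0 : 0 < w.im := hR0.trans this
    simp only [Function.comp_apply]
    gcongr
    rw [le_div_iff₀ (by positivity), ← Nat.sub_add_cancel hK, pow_add]
    simp only [Nat.add_sub_cancel]
    gcongr
  have h3 := (mul_le_mul_right h1 (ENNReal.ofReal (R ^ (k.natAbs - 2)))).trans h2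
  rw [Function.comp_apply, ofComplex_apply, ← ofReal_norm, ← ENNReal.ofReal_pow (norm_nonneg _),
    ← ENNReal.ofReal_mul (by positivity), ← ENNReal.ofReal_mul (by positivity),
    ENNReal.ofReal_le_ofReal_iff (by positivity)] at h3
  have h4 : R ^ (k.natAbs - 2) * (Real.pi * R ^ 2 * ‖v.fn z‖ ^ 2)
      = Real.pi * (R ^ k.natAbs * ‖v.fn z‖ ^ 2) := by
    rw [← Nat.sub_add_cancel hK, pow_add]
    simp only [Nat.add_sub_cancel]
    ring
  rw [h4] at h3
  have h5 : R ^ k.natAbs * ‖v.fn z‖ ^ 2 ≤ ‖v‖ ^ 2 := by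
    have : 0 ≤ R ^ k.natAbs * ‖v.fn z‖ ^ 2 := by positivity
    nlinarith [Real.pi_gt_three]
  rw [inv_pow, ← div_eq_inv_mul, le_div_iff₀' (by positivity)]
  exact h5

theorem norm_fn_le (v : DiscSeries k) (z : ℍ) :
    ‖v.fn z‖ ≤ √((z.im / 2)⁻¹ ^ k.natAbs) * ‖v‖ := by
  have h := v.norm_fn_sq_le z
  have hz := z.im_pos
  rw [← Real.sqrt_sq (norm_nonneg v), ← Real.sqrt_mul (by positivity)]
  exact Real.le_sqrt_of_sq_le h

/-- Evaluation at a point is continuous. -/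
noncomputable def evalL (z : ℍ) : DiscSeries k →L[ℂ] ℂ :=
  LinearMap.mkContinuous
    { toFun := fun v => v.fn z, map_add' := fun _ _ => rfl, map_smul' := fun _ _ => rfl }
    (√((z.im / 2)⁻¹ ^ k.natAbs)) fun v => v.norm_fn_le z

@[simp] theorem evalL_apply (z : ℍ) (v : DiscSeries k) : evalL z v = v.fn z := rfl

/-- Cauchy's estimate on the circle of radius `y / 2`, where the imaginary part is still at least `y
/ 2`; hence the `y / 4` in the bound for values. -/
theorem norm_deriv_le (v : DiscSeries k) (z : ℍ) :
    ‖deriv (v.fn ∘ ofComplex) z‖ ≤ √((z.im / 4)⁻¹ ^ k.natAbs) / (z.im / 2) * ‖v‖ := by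
  have hz := z.im_pos
  have him : ∀ w ∈ Metric.closedBall (z : ℂ) (z.im / 2), z.im / 2 ≤ w.im := by
    intro w hw
    rw [Metric.mem_closedBall, dist_eq_norm] at hw
    have := (Complex.abs_im_le_norm (w - z)).trans hw
    rw [Complex.sub_im, UpperHalfPlane.coe_im, abs_le] at this
    linarith [this.1]
  have hd : DiffContOnCl ℂ (v.fn ∘ ofComplex) (Metric.ball (z : ℂ) (z.im / 2)) := by
    refine DifferentiableOn.diffContOnCl ?_
    rw [closure_ball _ (by positivity)]
    exact v.differentiableOn.mono fun w hw => (by positivity : 0 < z.im / 2).trans_le (him w hw)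
  refine (Complex.norm_deriv_le_of_forall_mem_sphere_norm_le (by positivity) hd
    (C := √((z.im / 4)⁻¹ ^ k.natAbs) * ‖v‖) fun w hw => ?_).trans (le_of_eq (by ring))
  have h1 := him w (Metric.sphere_subset_closedBall hw)
  refine (v.norm_fn_le (ofComplex w)).trans ?_
  have h2 : (ofComplex w).im = w.im := by
    rw [ofComplex_apply_of_im_pos (by linarith)]; rfl
  rw [h2]
  have h3 : 0 < w.im := by linarith
  exact mul_le_mul_of_nonneg_right (Real.sqrt_le_sqrt (pow_le_pow_left₀ (by positivity)
    (inv_anti₀ (by positivity) (by linarith)) _)) (norm_nonneg _)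

/-- The derivative at a point is continuous. -/
noncomputable def derivL (z : ℍ) : DiscSeries k →L[ℂ] ℂ :=
  LinearMap.mkContinuous
    { toFun := fun v => deriv (v.fn ∘ ofComplex) z
      map_add' := fun u v => deriv_add (u.differentiableAt z) (v.differentiableAt z)
      map_smul' := fun c v => by
        exact deriv_const_mul c (v.differentiableAt z) } _ fun v => v.norm_deriv_le z

@[simp] theorem derivL_apply (z : ℍ) (v : DiscSeries k) :
    derivL z v = deriv (v.fn ∘ ofComplex) z := rfl

/-- Point evaluations are bounded locally uniformly, so a Cauchy sequence converges locally
uniformly to a holomorphic function, which agrees almost everywhere with the `L²` limit along a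
subsequence. Completeness is needed for integrals of vectors and for smoothness of holomorphic
vector-valued maps. -/
instance : CompleteSpace (DiscSeries k) := by
  refine Metric.complete_of_cauchySeq_tendsto fun s hs => ?_
  have hL : CauchySeq fun n => toL2ᵢ (s n) := toL2ᵢ.isometry.uniformContinuous.comp_cauchySeq hs
  obtain ⟨G, hG⟩ := cauchySeq_tendsto_of_complete hL
  have hpt : ∀ z, ∃ a, Filter.Tendsto (fun n => (s n).fn z) Filter.atTop (nhds a) := fun z =>
    cauchySeq_tendsto_of_complete ((evalL z).uniformContinuous.comp_cauchySeq hs)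
  choose F hF using hpt
  have hloc : TendstoLocallyUniformlyOn (fun n => (s n).fn ∘ ofComplex) (F ∘ ofComplex)
      Filter.atTop {w | 0 < w.im} := by
    rw [Metric.tendstoLocallyUniformlyOn_iff]
    intro ε hε w hw
    have hw' : (0 : ℝ) < w.im := hw
    refine ⟨{w' | w.im / 2 < w'.im}, mem_nhdsWithin_of_mem_nhds
      ((isOpen_lt continuous_const Complex.continuous_im).mem_nhds (by
        show w.im / 2 < w.im; linarith)), ?_⟩
    set C := √((w.im / 4)⁻¹ ^ k.natAbs) + 1 with hC
    have hC0 : 0 < C := by positivity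
    obtain ⟨N, hN⟩ := Metric.cauchySeq_iff.mp hs (ε / (2 * C)) (by positivity)
    filter_upwards [Filter.eventually_ge_atTop N] with n hn w' hw'
    have hw2 : w.im / 2 < w'.im := hw'
    have h1 : ∀ m ≥ N, dist ((s m).fn (ofComplex w')) ((s n).fn (ofComplex w')) ≤ ε / 2 := by
      intro m hm
      rw [dist_eq_norm, ← fn_sub]
      refine (norm_fn_le _ _).trans ?_
      have h2 : (ofComplex w').im = w'.im := by
        rw [ofComplex_apply_of_im_pos (by linarith)]; rfl
      have h3 := hN m hm n hn
      rw [dist_eq_norm] at h3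
      calc √(((ofComplex w').im / 2)⁻¹ ^ k.natAbs) * ‖s m - s n‖
          ≤ C * (ε / (2 * C)) := by
            refine mul_le_mul ?_ h3.le (norm_nonneg _) hC0.le
            rw [h2, hC]
            refine le_add_of_le_of_nonneg ?_ zero_le_one
            have h5 : 0 < w'.im := by linarith
            exact Real.sqrt_le_sqrt (pow_le_pow_left₀ (by positivity)
              (inv_anti₀ (by positivity) (by linarith)) _)
        _ = ε / 2 := by field_simp
    have h2 : dist (F (ofComplex w')) ((s n).fn (ofComplex w')) ≤ ε / 2 :=
      le_of_tendsto ((hF _).dist tendsto_const_nhds)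
        ((Filter.eventually_ge_atTop N).mono h1)
    simp only [Function.comp_apply]
    linarith
  have hhol : IsHol k F := by
    rw [isHol_iff]
    exact hloc.differentiableOn (Filter.Eventually.of_forall fun n => (s n).differentiableOn)
      isOpen_upperHalfPlaneSet
  have hae : G =ᵐ[bergmanMeasure k] F := by
    have h1 := tendstoInMeasure_of_tendsto_Lp hG
    obtain ⟨ns, hns, h2⟩ := h1.exists_seq_tendsto_ae
    have h3 : ∀ᵐ z ∂bergmanMeasure k, ∀ n, toL2ᵢ (s n) z = (s n).fn z :=
      ae_all_iff.mpr fun n => (s n).2.2.coeFn_toLp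
    filter_upwards [h2, h3] with z hz hz'
    simp only [hz'] at hz
    exact tendsto_nhds_unique hz ((hF z).comp hns.tendsto_atTop)
  have hmem : MemLp F 2 (bergmanMeasure k) := (memLp_congr_ae hae).mp (Lp.memLp G)
  refine ⟨⟨F, hhol, hmem⟩, ?_⟩
  have h4 : toL2ᵢ (⟨F, hhol, hmem⟩ : DiscSeries k) = G := by
    refine Lp.ext ?_
    exact hmem.coeFn_toLp.trans hae.symm
  rw [← h4] at hG
  exact (toL2ᵢ.isometry.isUniformInducing.isInducing.tendsto_nhds_iff).mpr hG

end DiscSeries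

/-! ### One-parameter subgroups -/

theorem rotK_coe (θ : ℝ) : (rotK θ).1 =
    !![Real.cos θ, -Real.sin θ; Real.sin θ, Real.cos θ] := rfl

theorem unipN_coe (t : ℝ) : (unipN t).1 = !![1, t; 0, 1] := rfl

theorem diagA_coe {a : ℝ} (ha : a ≠ 0) : (diagA a).1 = !![a, 0; 0, a⁻¹] := by
  have : diagA a = ⟨!![a, 0; 0, a⁻¹], by simp [Matrix.det_fin_two_of, ha]⟩ := dif_pos ha
  rw [this]

theorem inv_coe (g : SL(2, ℝ)) : (g⁻¹).1 = !![g.1 1 1, -g.1 0 1; -g.1 1 0, g.1 0 0] := by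
  rw [Matrix.SpecialLinearGroup.coe_inv, Matrix.adjugate_fin_two]

theorem rotK_add (s t : ℝ) : rotK (s + t) = rotK s * rotK t := by
  refine Subtype.ext ?_
  rw [Matrix.SpecialLinearGroup.coe_mul, rotK_coe, rotK_coe, rotK_coe, Matrix.mul_fin_two,
    Real.cos_add, Real.sin_add]
  congr 2 <;> [skip; congr 1] <;> ring_nf

theorem unipN_add (s t : ℝ) : unipN (s + t) = unipN s * unipN t := by
  refine Subtype.ext ?_
  rw [Matrix.SpecialLinearGroup.coe_mul, unipN_coe, unipN_coe, unipN_coe, Matrix.mul_fin_two]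
  simp [add_comm]

theorem diagA_mul {a b : ℝ} (ha : a ≠ 0) (hb : b ≠ 0) : diagA (a * b) = diagA a * diagA b := by
  refine Subtype.ext ?_
  rw [Matrix.SpecialLinearGroup.coe_mul, diagA_coe ha, diagA_coe hb, diagA_coe (mul_ne_zero ha hb)]
  ext i j
  fin_cases i <;> fin_cases j <;> simp [Matrix.mul_apply, Fin.sum_univ_two, mul_comm]

theorem oneParam_add (i : Fin 3) (s t : ℝ) :
    oneParam i (s + t) = oneParam i s * oneParam i t := by
  fin_cases i
  · exact rotK_add s t
  · simp only [oneParam, Real.exp_add]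
    exact diagA_mul (Real.exp_pos s).ne' (Real.exp_pos t).ne'
  · exact unipN_add s t

@[simp] theorem oneParam_zero (i : Fin 3) : oneParam i 0 = 1 := by
  have := oneParam_add i 0 0
  simpa using this

theorem oneParam_neg (i : Fin 3) (s : ℝ) : oneParam i (-s) = (oneParam i s)⁻¹ := by
  rw [eq_inv_iff_mul_eq_one, ← oneParam_add]
  simp

/-- The tangent vectors at `1` of the one-parameter subgroups. -/
def lieGen (i : Fin 3) : Matrix (Fin 2) (Fin 2) ℝ :=
  ![!![0, -1; 1, 0], !![1, 0; 0, -1], !![0, 1; 0, 0]] i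

theorem hasDerivAt_oneParam (i : Fin 3) (a b : Fin 2) :
    HasDerivAt (fun s => (oneParam i s : Matrix (Fin 2) (Fin 2) ℝ) a b) (lieGen i a b) 0 := by
  have h1 : HasDerivAt Real.exp 1 0 := by simpa using Real.hasDerivAt_exp 0
  have h2 : HasDerivAt (fun s => (Real.exp s)⁻¹) (-1) 0 := by
    simpa [Real.exp_neg, Function.comp_def] using (Real.hasDerivAt_exp 0).comp_of_eq (0 : ℝ) (hasDerivAt_neg (0 : ℝ)) (by simp)
  have h3 : HasDerivAt Real.sin 1 0 := by simpa using Real.hasDerivAt_sin 0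
  have h4 : HasDerivAt Real.cos 0 0 := by simpa using Real.hasDerivAt_cos 0
  have h5 : HasDerivAt (fun s => -Real.sin s) (-1) 0 := h3.neg
  have h0 : ∀ c : ℝ, HasDerivAt (fun _ : ℝ => c) 0 0 := fun c => hasDerivAt_const _ _
  have h6 : HasDerivAt (fun s : ℝ => s) 1 0 := hasDerivAt_id 0
  fin_cases i <;> fin_cases a <;> fin_cases b <;>
    simp [oneParam, lieGen, rotK_coe, unipN_coe, diagA_coe, Real.exp_ne_zero, *]

/-- The coefficients of `Ad(g⁻¹)` in the basis `lieGen`. -/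
def adCoeff (g : SL(2, ℝ)) (i j : Fin 3) : ℝ :=
  let m : Matrix (Fin 2) (Fin 2) ℝ := (g⁻¹ : SL(2, ℝ)).1 * lieGen i * g.1
  ![m 1 0, m 0 0, m 0 1 + m 1 0] j

/-- Conjugation preserves trace zero, so three entries determine the matrix. The rotation generator
has `-1` at `(0, 1)`, which explains the sum `m 0 1 + m 1 0` in the third coordinate. -/
theorem inv_mul_lieGen_mul (g : SL(2, ℝ)) (i : Fin 3) :
    (g⁻¹ : SL(2, ℝ)).1 * lieGen i * g.1 = ∑ j, adCoeff g i j • lieGen j := by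
  have htr : ((g⁻¹ : SL(2, ℝ)).1 * lieGen i * g.1).trace = 0 := by
    rw [Matrix.trace_mul_comm, ← mul_assoc, ← Matrix.SpecialLinearGroup.coe_mul, mul_inv_cancel,
      Matrix.SpecialLinearGroup.coe_one, one_mul]
    fin_cases i <;> simp [lieGen, Matrix.trace_fin_two]
  rw [Matrix.trace_fin_two] at htr
  unfold adCoeff
  generalize ((g⁻¹ : SL(2, ℝ)).1 * lieGen i * g.1 : Matrix (Fin 2) (Fin 2) ℝ) = m at htr ⊢
  ext a b
  fin_cases a <;> fin_cases b <;>
    simp [Fin.sum_univ_three, lieGen, Matrix.sum_apply]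
  linarith

theorem adCoeff_apply (g : SL(2, ℝ)) (i j : Fin 3) :
    adCoeff g i j =
      ![![g.1 0 0 ^ 2 + g.1 1 0 ^ 2, -(g.1 0 0 * g.1 0 1 + g.1 1 0 * g.1 1 1),
          -(g.1 0 1 ^ 2 + g.1 1 1 ^ 2) + (g.1 0 0 ^ 2 + g.1 1 0 ^ 2)],
        ![-2 * g.1 0 0 * g.1 1 0, g.1 0 0 * g.1 1 1 + g.1 0 1 * g.1 1 0,
          2 * g.1 0 1 * g.1 1 1 - 2 * g.1 0 0 * g.1 1 0],
        ![-g.1 1 0 ^ 2, g.1 1 0 * g.1 1 1, g.1 1 1 ^ 2 - g.1 1 0 ^ 2]] i j := by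
  simp only [adCoeff, inv_coe]
  fin_cases i <;> fin_cases j <;>
    simp [lieGen, Matrix.mul_apply, Fin.sum_univ_two] <;> ring

/-! ### The representation -/

namespace DiscSeries

variable {k : ℤ}

@[simp] theorem norm_discRep (g : SL(2, ℝ)) (v : DiscSeries k) : ‖discRep k g v‖ = ‖v‖ := by
  have h : ENNReal.ofReal (‖discRep k g v‖ ^ 2) = ENNReal.ofReal (‖v‖ ^ 2) := by
    rw [ofReal_norm_sq, ofReal_norm_sq]
    simpa only [ENNReal.rpow_two] using! lintegral_slashAct k v.continuous_fn g
  rw [ENNReal.ofReal_eq_ofReal_iff (by positivity) (by positivity)] at h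
  exact (pow_left_inj₀ (norm_nonneg _) (norm_nonneg _) two_ne_zero).mp h

/-- `discRep` as a linear isometry. -/
noncomputable def repI (g : SL(2, ℝ)) : DiscSeries k →ₗᵢ[ℂ] DiscSeries k :=
  ⟨discRep k g, norm_discRep g⟩

theorem inner_discRep (g : SL(2, ℝ)) (u v : DiscSeries k) :
    inner ℂ (discRep k g u) (discRep k g v) = inner ℂ u v :=
  (repI g).inner_map_map u v

theorem discRep_mul (g h : SL(2, ℝ)) (v : DiscSeries k) :
    discRep k (g * h) v = discRep k g (discRep k h v) := by
  rw [map_mul]; rfl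

@[simp] theorem discRep_one (v : DiscSeries k) : discRep k 1 v = v := by
  rw [map_one]; rfl

/-- Each one-parameter subgroup is a coordinate axis of the Iwasawa chart at `1`. Thus the `deriv`
in `lieAct` is a true derivative on smooth vectors, not the default value `0`. -/
theorem hasDerivAt_oneParam_zero (i : Fin 3) {v : DiscSeries k} (hv : v ∈ smoothVectors k) :
    HasDerivAt (fun s => discRep k (oneParam i s) v) (lieAct k i v) 0 := by
  have h1 : Differentiable ℝ fun x : ℝ × ℝ × ℝ => discRep k (iwasawa x * 1) v :=
    (hv 1).differentiable (by simp)
  have h0 : unipN 0 = 1 := by simpa [oneParam] using oneParam_zero 2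
  have h0' : rotK 0 = 1 := by simpa [oneParam] using oneParam_zero 0
  have h0'' : diagA 1 = 1 := by simpa [oneParam] using oneParam_zero 1
  have h2 : DifferentiableAt ℝ (fun s => discRep k (oneParam i s) v) 0 := by
    fin_cases i
    · have := h1.comp (g := fun x : ℝ × ℝ × ℝ => discRep k (iwasawa x * 1) v)
        (f := fun s : ℝ => (s, (0 : ℝ), (0 : ℝ))) (by fun_prop) 0
      simpa [Function.comp_def, iwasawa, h0, h0', h0'', oneParam] using this
    · have := h1.comp (g := fun x : ℝ × ℝ × ℝ => discRep k (iwasawa x * 1) v)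
        (f := fun s : ℝ => ((0 : ℝ), s, (0 : ℝ))) (by fun_prop) 0
      simpa [Function.comp_def, iwasawa, h0, h0', h0'', oneParam] using this
    · have := h1.comp (g := fun x : ℝ × ℝ × ℝ => discRep k (iwasawa x * 1) v)
        (f := fun s : ℝ => ((0 : ℝ), (0 : ℝ), s)) (by fun_prop) 0
      simpa [Function.comp_def, iwasawa, h0, h0', h0'', oneParam] using this
  exact h2.hasDerivAt

theorem hasDerivAt_discRep_oneParam (i : Fin 3) (g : SL(2, ℝ)) {v : DiscSeries k}
    (hv : v ∈ smoothVectors k) (s : ℝ) :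
    HasDerivAt (fun s => discRep k (g * oneParam i s) v)
      (discRep k (g * oneParam i s) (lieAct k i v)) s := by
  have h1 := (((repI (k := k) (g * oneParam i s)).toContinuousLinearMap.restrictScalars
    ℝ).hasFDerivAt.comp_hasDerivAt (0 : ℝ) (hasDerivAt_oneParam_zero i hv))
  have h2 := HasDerivAt.comp_sub_const s s (f := _) (by rw [sub_self]; exact h1)
  refine h2.congr_of_eventuallyEq (Filter.Eventually.of_forall fun r => ?_)
  have : g * oneParam i r = g * oneParam i s * oneParam i (r - s) := by
    rw [mul_assoc, ← oneParam_add, add_sub_cancel]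
  change discRep k (g * oneParam i r) v =
    discRep k (g * oneParam i s) (discRep k (oneParam i (r - s)) v)
  rw [this, discRep_mul]

variable [hk : Fact (2 ≤ k)]

theorem discRep_fn (g : SL(2, ℝ)) (v : DiscSeries k) (z : ℍ) :
    (discRep k g v).fn z = ((g.1 0 0 - g.1 1 0 * z : ℂ) ^ k.natAbs)⁻¹ *
      (v.fn ∘ ofComplex) ((g.1 1 1 * z - g.1 0 1) / (g.1 0 0 - g.1 1 0 * z)) := by
  have hk0 : 0 < k := by have := hk.out; omega
  have hd : denom ((g⁻¹ : SL(2, ℝ)) : GL (Fin 2) ℝ) z = g.1 0 0 - g.1 1 0 * z := by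
    change (((g⁻¹).1 1 0 : ℝ) : ℂ) * z + (((g⁻¹).1 1 1 : ℝ) : ℂ) = _
    rw [inv_coe]
    simp
    ring
  have hn : num ((g⁻¹ : SL(2, ℝ)) : GL (Fin 2) ℝ) z = g.1 1 1 * z - g.1 0 1 := by
    change (((g⁻¹).1 0 0 : ℝ) : ℂ) * z + (((g⁻¹).1 0 1 : ℝ) : ℂ) = _
    rw [inv_coe]
    simp
    ring
  change (autFactor k g⁻¹ z)⁻¹ * v.fn (g⁻¹ • z) = _
  rw [autFactor, if_pos hk0, hd, Function.comp_apply, ← hn, ← hd, ← coe_sl_smul, ofComplex_apply]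

/-- The first-order differential operator at `z` by which a matrix acts. -/
noncomputable def lieL (m : Matrix (Fin 2) (Fin 2) ℝ) (z : ℍ) : DiscSeries k →L[ℂ] ℂ :=
  (-(k.natAbs : ℂ) * (m 0 0 - m 1 0 * z)) • evalL z +
    (m 1 1 * z - m 0 1 - z * (m 0 0 - m 1 0 * z) : ℂ) • derivL z

/-- At a fixed point `z` the function is holomorphic, so every vector, smooth or not, can be
differentiated along any curve in the group, and the result is linear in the tangent matrix. This
makes pointwise comparison the tool for all Lie algebra identities. -/
theorem hasDerivAt_discRep_fn {M : ℝ → SL(2, ℝ)} {m : Matrix (Fin 2) (Fin 2) ℝ} (hM0 : M 0 = 1)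
    (hM : ∀ a b, HasDerivAt (fun s => (M s).1 a b) (m a b) 0) (v : DiscSeries k) (z : ℍ) :
    HasDerivAt (fun s => (discRep k (M s) v).fn z) (lieL m z v) 0 := by
  simp only [discRep_fn]
  have hc : ∀ a b, HasDerivAt (fun s => (((M s).1 a b : ℝ) : ℂ)) (m a b) 0 :=
    fun a b => (hM a b).ofReal_comp
  have hD : HasDerivAt (fun s => ((M s).1 0 0 - (M s).1 1 0 * z : ℂ)) (m 0 0 - m 1 0 * z) 0 :=
    (hc 0 0).sub ((hc 1 0).mul_const _)
  have hN : HasDerivAt (fun s => ((M s).1 1 1 * z - (M s).1 0 1 : ℂ)) (m 1 1 * z - m 0 1) 0 :=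
    ((hc 1 1).mul_const _).sub (hc 0 1)
  have hD0 : ((M 0).1 0 0 - (M 0).1 1 0 * z : ℂ) = 1 := by simp [hM0]
  have hN0 : ((M 0).1 1 1 * z - (M 0).1 0 1 : ℂ) = z := by simp [hM0]
  have hq := hN.div hD (by rw [hD0]; exact one_ne_zero)
  have hf := (v.differentiableAt z).hasDerivAt.scomp_of_eq 0 hq (by
    simp only [Pi.div_apply, hD0, hN0, div_one])
  have hp := (hD.pow k.natAbs).inv (by simp only [Pi.pow_apply, hD0]; simp)
  refine (hp.mul hf).congr_deriv ?_
  simp [hD0, hN0, lieL, Function.comp_def]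

end DiscSeries

/-! ### Iwasawa coordinates, and stability of smooth vectors under the Lie algebra -/

theorem iwasawa_coe (x : ℝ × ℝ × ℝ) : (iwasawa x).1 =
    !![Real.exp x.2.1 * Real.cos x.1,
        Real.exp x.2.1 * Real.cos x.1 * x.2.2 - (Real.exp x.2.1)⁻¹ * Real.sin x.1;
      Real.exp x.2.1 * Real.sin x.1,
        Real.exp x.2.1 * Real.sin x.1 * x.2.2 + (Real.exp x.2.1)⁻¹ * Real.cos x.1] := by
  rw [iwasawa, Matrix.SpecialLinearGroup.coe_mul, Matrix.SpecialLinearGroup.coe_mul, rotK_coe,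
    diagA_coe (Real.exp_ne_zero _), unipN_coe, Matrix.mul_fin_two, Matrix.mul_fin_two]
  ext a b
  fin_cases a <;> fin_cases b <;> simp <;> ring

theorem contDiff_iwasawa_coe (a b : Fin 2) :
    ContDiff ℝ ∞ fun x : ℝ × ℝ × ℝ => (iwasawa x).1 a b := by
  simp only [iwasawa_coe, ← Real.exp_neg]
  fin_cases a <;> fin_cases b <;> simp <;> fun_prop

theorem contDiff_adCoeff_iwasawa (i j : Fin 3) :
    ContDiff ℝ ∞ fun x : ℝ × ℝ × ℝ => adCoeff (iwasawa x) i j := by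
  have hinv : ∀ a b, ContDiff ℝ ∞ fun x : ℝ × ℝ × ℝ => ((iwasawa x)⁻¹).1 a b := by
    intro a b
    simp only [inv_coe]
    fin_cases a <;> fin_cases b
    · exact contDiff_iwasawa_coe 1 1
    · exact (contDiff_iwasawa_coe 0 1).neg
    · exact (contDiff_iwasawa_coe 1 0).neg
    · exact contDiff_iwasawa_coe 0 0
  have hm : ∀ a b, ContDiff ℝ ∞ fun x : ℝ × ℝ × ℝ =>
      (((iwasawa x)⁻¹ : SL(2, ℝ)).1 * lieGen i * (iwasawa x).1) a b := by
    intro a b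
    simp only [Matrix.mul_apply]
    exact ContDiff.sum fun c _ => (ContDiff.sum fun d _ => (hinv _ _).mul contDiff_const).mul
      (contDiff_iwasawa_coe _ _)
  fin_cases j
  · exact hm 1 0
  · exact hm 0 0
  · exact (hm 0 1).add (hm 1 0)

/-- This coefficient never vanishes, which allows the rotation generator to be solved for in
`contDiff_orbit_lieAct`. -/
theorem adCoeff_iwasawa_zero_zero (x : ℝ × ℝ × ℝ) :
    adCoeff (iwasawa x) 0 0 = Real.exp x.2.1 ^ 2 := by
  simp only [adCoeff_apply, iwasawa_coe]
  simp
  linear_combination Real.exp x.2.1 ^ 2 * Real.sin_sq_add_cos_sq x.1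

theorem iwasawa_mul_unipN (x : ℝ × ℝ × ℝ) (s : ℝ) :
    iwasawa x * oneParam 2 s = iwasawa (x.1, x.2.1, x.2.2 + s) := by
  simp only [iwasawa, unipN_add, mul_assoc]
  rfl

theorem rotK_mul_iwasawa (x : ℝ × ℝ × ℝ) (s : ℝ) :
    oneParam 0 s * iwasawa x = iwasawa (x.1 + s, x.2.1, x.2.2) := by
  simp only [iwasawa, add_comm x.1, rotK_add, mul_assoc]
  rfl

/-- `A` normalises `N`: moving `diag(e^s, e^{-s})` to the left past `n_t` rescales `t` by `e^{-2s}`.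
-/
theorem iwasawa_mul_diagA (x : ℝ × ℝ × ℝ) (s : ℝ) :
    iwasawa x * oneParam 1 s = iwasawa (x.1, x.2.1 + s, x.2.2 * Real.exp (-2 * s)) := by
  refine Subtype.ext ?_
  rw [Matrix.SpecialLinearGroup.coe_mul, iwasawa_coe, iwasawa_coe]
  have : (oneParam 1 s).1 = !![Real.exp s, 0; 0, (Real.exp s)⁻¹] := diagA_coe (Real.exp_ne_zero _)
  rw [this, Matrix.mul_fin_two]
  have h1 : Real.exp (-2 * s) = (Real.exp s)⁻¹ ^ 2 := by
    rw [← Real.exp_neg, ← Real.exp_nat_mul]; congr 1; push_cast; ring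
  have h2 := Real.exp_ne_zero s
  have h3 := Real.exp_ne_zero x.2.1
  simp only [h1, Real.exp_add, mul_inv]
  ext a b
  fin_cases a <;> fin_cases b <;> simp <;> field_simp

namespace DiscSeries

variable {k : ℤ} [hk : Fact (2 ≤ k)]

theorem lieL_sum (c : Fin 3 → ℝ) (z : ℍ) (v : DiscSeries k) :
    lieL (∑ j, c j • lieGen j) z v = ∑ j, (c j : ℂ) * lieL (lieGen j) z v := by
  simp [lieL, Fin.sum_univ_three, Matrix.add_apply]
  ring

/-- The Lie algebra acts by first-order differential operators. -/
theorem lieAct_fn (i : Fin 3) {v : DiscSeries k} (hv : v ∈ smoothVectors k) (z : ℍ) :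
    (lieAct k i v).fn z = lieL (lieGen i) z v := by
  have h1 := ((evalL (k := k) z).restrictScalars ℝ).hasFDerivAt.comp_hasDerivAt (0 : ℝ)
    (hasDerivAt_oneParam_zero i hv)
  exact h1.unique (hasDerivAt_discRep_fn (oneParam_zero i) (hasDerivAt_oneParam i) v z)

theorem discRep_mem (g : SL(2, ℝ)) {v : DiscSeries k} (hv : v ∈ smoothVectors k) :
    discRep k g v ∈ smoothVectors k := (smoothRep k g ⟨v, hv⟩).2

theorem discRep_fn' (g : SL(2, ℝ)) (v : DiscSeries k) (z : ℍ) :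
    (discRep k g v).fn z = (autFactor k g⁻¹ z)⁻¹ * v.fn (g⁻¹ • z) := rfl

/-- This is `X g = g Ad(g⁻¹)X`. Evaluated at a point, the derivative runs along the curve `g⁻¹
γ_i(s) g`, whose tangent expands linearly in the basis. -/
theorem lieAct_discRep (i : Fin 3) (g : SL(2, ℝ)) {v : DiscSeries k} (hv : v ∈ smoothVectors k) :
    lieAct k i (discRep k g v) = ∑ j, (adCoeff g i j : ℂ) • discRep k g (lieAct k j v) := by
  ext z
  have h1 := ((evalL (k := k) z).restrictScalars ℝ).hasFDerivAt.comp_hasDerivAt (0 : ℝ)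
    (hasDerivAt_oneParam_zero i (discRep_mem g hv))
  have hM0 : g⁻¹ * oneParam i 0 * g = 1 := by simp
  have hM : ∀ a b, HasDerivAt (fun s => (g⁻¹ * oneParam i s * g).1 a b)
      (((g⁻¹ : SL(2, ℝ)).1 * lieGen i * g.1) a b) 0 := by
    intro a b
    simp only [Matrix.SpecialLinearGroup.coe_mul, Matrix.mul_apply]
    refine HasDerivAt.fun_sum fun c _ => HasDerivAt.mul_const ?_ _
    exact HasDerivAt.fun_sum fun d _ => (hasDerivAt_oneParam i _ _).const_mul _
  have h2 := (hasDerivAt_discRep_fn (M := fun s => g⁻¹ * oneParam i s * g) hM0 hM v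
    (g⁻¹ • z)).const_mul (autFactor k g⁻¹ z)⁻¹
  have h3 : (fun s => (autFactor k g⁻¹ z)⁻¹ *
      (discRep k (g⁻¹ * oneParam i s * g) v).fn (g⁻¹ • z)) =
      (⇑(ContinuousLinearMap.restrictScalars ℝ (evalL (k := k) z)) ∘
        fun s => discRep k (oneParam i s) (discRep k g v)) := by
    funext s
    change _ = (discRep k (oneParam i s) (discRep k g v)).fn z
    rw [← discRep_mul, ← discRep_fn', ← discRep_mul]
    congr 2
    group
  rw [h3] at h2
  have h4 := h1.unique h2
  rw [inv_mul_lieGen_mul, lieL_sum] at h4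
  change (lieAct k i (discRep k g v)).fn z = _ at h4
  rw [h4, Finset.mul_sum]
  rw [← evalL_apply (k := k), map_sum]
  refine Finset.sum_congr rfl fun j _ => ?_
  rw [map_smul, evalL_apply, discRep_fn', lieAct_fn j hv, smul_eq_mul]
  ring

theorem contDiff_orbit {u : DiscSeries k} (hu : u ∈ smoothVectors k) :
    ContDiff ℝ ∞ fun x => discRep k (iwasawa x) u := by simpa using hu 1

theorem contDiff_fderiv_orbit {u : DiscSeries k} (hu : u ∈ smoothVectors k)
    {y : ℝ × ℝ × ℝ → ℝ × ℝ × ℝ} (hy : ContDiff ℝ ∞ y) :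
    ContDiff ℝ ∞ fun x => fderiv ℝ (fun x => discRep k (iwasawa x) u) x (y x) :=
  ((contDiff_orbit hu).fderiv_right (m := ∞) (by simp)).clm_apply hy

theorem discRep_lieAct_two {u : DiscSeries k} (hu : u ∈ smoothVectors k) (x : ℝ × ℝ × ℝ) :
    discRep k (iwasawa x) (lieAct k 2 u)
      = fderiv ℝ (fun x => discRep k (iwasawa x) u) x (0, 0, 1) := by
  have h1 := hasDerivAt_discRep_oneParam 2 (iwasawa x) hu 0
  simp only [iwasawa_mul_unipN, add_zero] at h1
  have hd : HasDerivAt (fun s : ℝ => (x.1, x.2.1, x.2.2 + s)) ((0 : ℝ), (0 : ℝ), (1 : ℝ)) 0 :=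
    (hasDerivAt_const _ _).prodMk ((hasDerivAt_const _ _).prodMk
      ((hasDerivAt_id _).const_add _))
  have h2 := (((contDiff_orbit hu).differentiable (by simp)) x).hasFDerivAt.comp_hasDerivAt_of_eq
    (0 : ℝ) hd (by simp)
  exact h1.unique h2

theorem discRep_lieAct_one {u : DiscSeries k} (hu : u ∈ smoothVectors k) (x : ℝ × ℝ × ℝ) :
    discRep k (iwasawa x) (lieAct k 1 u)
      = fderiv ℝ (fun x => discRep k (iwasawa x) u) x (0, 1, -2 * x.2.2) := by
  have h1 := hasDerivAt_discRep_oneParam 1 (iwasawa x) hu 0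
  simp only [iwasawa_mul_diagA, add_zero, mul_zero, Real.exp_zero, mul_one] at h1
  have hd : HasDerivAt (fun s : ℝ => (x.1, x.2.1 + s, x.2.2 * Real.exp (-2 * s)))
      ((0 : ℝ), (1 : ℝ), (-2 * x.2.2 : ℝ)) 0 := by
    refine (hasDerivAt_const _ _).prodMk (((hasDerivAt_id _).const_add _).prodMk ?_)
    have := ((((hasDerivAt_id (0 : ℝ)).const_mul (-2)).exp).const_mul x.2.2)
    simpa [mul_comm] using this
  have h2 := (((contDiff_orbit hu).differentiable (by simp)) x).hasFDerivAt.comp_hasDerivAt_of_eq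
    (0 : ℝ) hd (by simp)
  exact h1.unique h2

/-- Right multiplication by a rotation is complicated in these coordinates, but left multiplication
only shifts `θ`; hence the generator stands outside `discRep` here, unlike in the two preceding
identities. -/
theorem lieAct_zero_discRep {u : DiscSeries k} (hu : u ∈ smoothVectors k) (x : ℝ × ℝ × ℝ) :
    lieAct k 0 (discRep k (iwasawa x) u)
      = fderiv ℝ (fun x => discRep k (iwasawa x) u) x (1, 0, 0) := by
  have h1 := hasDerivAt_oneParam_zero 0 (discRep_mem (iwasawa x) hu)
  simp only [← discRep_mul, rotK_mul_iwasawa] at h1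
  have hd : HasDerivAt (fun s : ℝ => (x.1 + s, x.2.1, x.2.2)) ((1 : ℝ), (0 : ℝ), (0 : ℝ)) 0 :=
    ((hasDerivAt_id _).const_add _).prodMk ((hasDerivAt_const _ _).prodMk (hasDerivAt_const _ _))
  have h2 := (((contDiff_orbit hu).differentiable (by simp)) x).hasFDerivAt.comp_hasDerivAt_of_eq
    (0 : ℝ) hd (by simp)
  exact h1.unique h2

/-- Along `N` and `A` the orbit of `X u` is a directional derivative of the orbit of `u`. For `K`,
`lieAct_discRep` writes the `θ`-derivative as a combination of the three orbits; the two others are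
already smooth and the remaining coefficient `e^{2s}` is invertible. -/
theorem contDiff_orbit_lieAct (i : Fin 3) {u : DiscSeries k} (hu : u ∈ smoothVectors k) :
    ContDiff ℝ ∞ fun x => discRep k (iwasawa x) (lieAct k i u) := by
  have h2 : ContDiff ℝ ∞ fun x => discRep k (iwasawa x) (lieAct k 2 u) := by
    simp only [discRep_lieAct_two hu]
    exact contDiff_fderiv_orbit hu contDiff_const
  have h1 : ContDiff ℝ ∞ fun x => discRep k (iwasawa x) (lieAct k 1 u) := by
    simp only [discRep_lieAct_one hu]
    exact contDiff_fderiv_orbit hu (by fun_prop)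
  fin_cases i
  · have h : ∀ x, discRep k (iwasawa x) (lieAct k 0 u) = (Real.exp (-2 * x.2.1)) •
        (fderiv ℝ (fun x => discRep k (iwasawa x) u) x (1, 0, 0)
          - adCoeff (iwasawa x) 0 1 • discRep k (iwasawa x) (lieAct k 1 u)
          - adCoeff (iwasawa x) 0 2 • discRep k (iwasawa x) (lieAct k 2 u)) := by
      intro x
      rw [← lieAct_zero_discRep hu, lieAct_discRep 0 _ hu, Fin.sum_univ_three,
        adCoeff_iwasawa_zero_zero]
      simp only [Complex.coe_smul]
      rw [sub_sub, add_assoc, add_sub_cancel_right, smul_smul, ← Real.exp_nat_mul, ← Real.exp_add]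
      push_cast
      rw [show -2 * x.2.1 + 2 * x.2.1 = 0 by ring, Real.exp_zero, one_smul]
    simp only [Fin.zero_eta, Fin.isValue, h]
    have := contDiff_fderiv_orbit hu (y := fun _ => (1, 0, 0)) contDiff_const
    have c1 := contDiff_adCoeff_iwasawa 0 1
    have c2 := contDiff_adCoeff_iwasawa 0 2
    have c0 : ContDiff ℝ ∞ fun x : ℝ × ℝ × ℝ => Real.exp (-2 * x.2.1) := by fun_prop
    exact c0.smul ((this.sub (c1.smul h1)).sub (c2.smul h2))
  · exact h1
  · exact h2

/-- Pushing `g` through the Lie algebra turns the chart translated by `g` into the chart at `1`,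
applied to the smooth vector `g u`. -/
theorem lieAct_mem (i : Fin 3) {u : DiscSeries k} (hu : u ∈ smoothVectors k) :
    lieAct k i u ∈ smoothVectors k := by
  intro g
  have h : discRep k g (lieAct k i u)
      = ∑ j, (adCoeff g⁻¹ i j : ℂ) • lieAct k j (discRep k g u) := by
    have h1 := lieAct_discRep i g⁻¹ (discRep_mem g hu)
    rw [← discRep_mul, inv_mul_cancel, discRep_one] at h1
    rw [h1, map_sum]
    simp only [map_smul, ← discRep_mul, mul_inv_cancel, discRep_one]
  simp only [discRep_mul, h, map_sum, map_smul]
  exact ContDiff.sum fun j _ => (contDiff_orbit_lieAct j (discRep_mem g hu)).const_smul _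

/-! ### The Lie algebra action on smooth vectors -/

/-- The action of the basis of the Lie algebra on smooth vectors. -/
noncomputable def lieS (i : Fin 3) : smoothVectors k →ₗ[ℂ] smoothVectors k where
  toFun v := ⟨lieAct k i v, lieAct_mem i v.2⟩
  map_add' u v := Subtype.ext <| by
    have h := (hasDerivAt_oneParam_zero i u.2).add (hasDerivAt_oneParam_zero i v.2)
    have h' := hasDerivAt_oneParam_zero i (u + v).2
    refine h'.unique (h.congr_of_eventuallyEq (Filter.Eventually.of_forall fun s => ?_))
    exact map_add _ _ _
  map_smul' c v := Subtype.ext <| by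
    have h := (hasDerivAt_oneParam_zero i v.2).const_smul c
    have h' := hasDerivAt_oneParam_zero i (c • v).2
    refine h'.unique (h.congr_of_eventuallyEq (Filter.Eventually.of_forall fun s => ?_))
    exact map_smul _ _ _

@[simp] theorem coe_lieS (i : Fin 3) (v : smoothVectors k) :
    (lieS i v : DiscSeries k) = lieAct k i v := rfl

@[simp] theorem coe_smoothRep (g : SL(2, ℝ)) (v : smoothVectors k) :
    (smoothRep k g v : DiscSeries k) = discRep k g v := rfl

theorem smoothRep_mul (g h : SL(2, ℝ)) (v : smoothVectors k) :
    smoothRep k (g * h) v = smoothRep k g (smoothRep k h v) :=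
  Subtype.ext (discRep_mul _ _ _)

@[simp] theorem smoothRep_one (v : smoothVectors k) : smoothRep k 1 v = v :=
  Subtype.ext (discRep_one _)

theorem lieS_smoothRep (i : Fin 3) (g : SL(2, ℝ)) (v : smoothVectors k) :
    lieS i (smoothRep k g v) = ∑ j, (adCoeff g i j : ℂ) • smoothRep k g (lieS j v) := by
  refine Subtype.ext ?_
  rw [coe_lieS, coe_smoothRep, lieAct_discRep i g v.2]
  simp

/-- Words in the basis of the Lie algebra acting on smooth vectors. -/
noncomputable def wordS (w : List (Fin 3)) : smoothVectors k →ₗ[ℂ] smoothVectors k :=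
  w.foldr (fun i f => lieS i ∘ₗ f) LinearMap.id

@[simp] theorem wordS_nil : wordS (k := k) [] = LinearMap.id := rfl

@[simp] theorem wordS_cons (i : Fin 3) (w : List (Fin 3)) (v : smoothVectors k) :
    wordS (i :: w) v = lieS i (wordS w v) := rfl

theorem wordS_concat (i : Fin 3) (w : List (Fin 3)) (v : smoothVectors k) :
    wordS (w ++ [i]) v = wordS w (lieS i v) := by
  induction w with
  | nil => rfl
  | cons j w ih => simp [ih]

theorem coe_wordS (w : List (Fin 3)) (v : smoothVectors k) :
    (wordS w v : DiscSeries k) = lieWord k w v := by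
  induction w with
  | nil => rfl
  | cons i w ih => rw [wordS_cons, coe_lieS, ih]; rfl

/-- The innermost letter passes `g` at the price of scalars only, leaving a shorter word outside
`g`. This is why inductions on words peel letters off the right end. -/
theorem wordS_concat_smoothRep (i : Fin 3) (w : List (Fin 3)) (g : SL(2, ℝ))
    (v : smoothVectors k) :
    wordS (w ++ [i]) (smoothRep k g v)
      = ∑ j, (adCoeff g i j : ℂ) • wordS w (smoothRep k g (lieS j v)) := by
  simp [wordS_concat, lieS_smoothRep]

/-! ### Continuity of orbits -/

/-- Families in `SL(2, ℝ)` acting strongly continuously. -/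
structure StrongCont {X : Type*} [TopologicalSpace X] (k : ℤ) (g : X → SL(2, ℝ)) : Prop where
  rep : ∀ v ∈ smoothVectors k, Continuous fun x => discRep k (g x) v
  coe : ∀ a b, Continuous fun x => (g x).1 a b

section

variable {X : Type*} [TopologicalSpace X] {g h : X → SL(2, ℝ)}

/-- Since each `g x` is an isometry, `‖g_x h_x v - g_₀ h_₀ v‖ ≤ ‖h_x v - h_₀ v‖ + ‖(g_x - g_₀) h_₀
v‖`. -/
theorem StrongCont.mul (hg : StrongCont k g) (hh : StrongCont k h) :
    StrongCont k fun x => g x * h x := by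
  refine ⟨fun v hv => ?_, fun a b => ?_⟩
  · rw [continuous_iff_continuousAt]
    intro x₀
    have h1 := tendsto_iff_norm_sub_tendsto_zero.mp ((hh.rep v hv).tendsto x₀)
    have h2 := tendsto_iff_norm_sub_tendsto_zero.mp
      ((hg.rep _ (discRep_mem (h x₀) hv)).tendsto x₀)
    have h3 := h1.add h2
    rw [add_zero] at h3
    refine tendsto_iff_norm_sub_tendsto_zero.mpr
      (squeeze_zero (fun _ => norm_nonneg _) (fun x => ?_) h3)
    simp only [discRep_mul]
    rw [← norm_discRep (g x) (discRep k (h x) v - _), map_sub]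
    exact norm_sub_le_norm_sub_add_norm_sub _ _ _
  · simp only [Matrix.SpecialLinearGroup.coe_mul, Matrix.mul_apply]
    exact continuous_finsetSum _ fun c _ => (hg.coe _ _).mul (hh.coe _ _)

theorem StrongCont.comp {Y : Type*} [TopologicalSpace Y] (hg : StrongCont k g) {f : Y → X}
    (hf : Continuous f) : StrongCont k fun y => g (f y) :=
  ⟨fun v hv => (hg.rep v hv).comp hf, fun a b => (hg.coe a b).comp hf⟩

theorem strongCont_oneParam (i : Fin 3) : StrongCont k (oneParam i) := by
  refine ⟨fun v hv => ?_, fun a b => ?_⟩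
  · have : ∀ s, HasDerivAt (fun s => discRep k (oneParam i s) v) _ s := fun s => by
      simpa using hasDerivAt_discRep_oneParam i 1 hv s
    exact continuous_iff_continuousAt.mpr fun s => (this s).continuousAt
  · have h0 : Continuous fun s => (Real.exp s)⁻¹ := by
      simp only [← Real.exp_neg]; fun_prop
    fin_cases i <;> fin_cases a <;> fin_cases b <;>
      simp [oneParam, rotK_coe, unipN_coe, diagA_coe, Real.exp_ne_zero] <;>
      first | exact h0 | fun_prop

theorem StrongCont.adCoeff (hg : StrongCont k g) (i j : Fin 3) :
    Continuous fun x => adCoeff (g x) i j := by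
  have hinv : ∀ a b, Continuous fun x => ((g x)⁻¹).1 a b := by
    intro a b
    simp only [inv_coe]
    fin_cases a <;> fin_cases b
    · exact hg.coe 1 1
    · exact (hg.coe 0 1).neg
    · exact (hg.coe 1 0).neg
    · exact hg.coe 0 0
  have hm : ∀ a b, Continuous fun x =>
      (((g x)⁻¹ : SL(2, ℝ)).1 * lieGen i * (g x).1) a b := by
    intro a b
    simp only [Matrix.mul_apply]
    exact continuous_finsetSum _ fun c _ => (continuous_finsetSum _ fun d _ =>
      (hinv _ _).mul continuous_const).mul (hg.coe _ _)
  fin_cases j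
  · exact hm 1 0
  · exact hm 0 0
  · exact (hm 0 1).add (hm 1 0)

theorem StrongCont.wordS (hg : StrongCont k g) (w : List (Fin 3)) (v : smoothVectors k) :
    Continuous fun x => (wordS w (smoothRep k (g x) v) : DiscSeries k) := by
  induction w using List.reverseRecOn generalizing v with
  | nil => exact hg.rep v v.2
  | append_singleton w i ih =>
    simp only [wordS_concat_smoothRep, Submodule.coe_sum, Submodule.coe_smul]
    exact continuous_finsetSum _ fun j _ =>
      (Complex.continuous_ofReal.comp (hg.adCoeff i j)).smul (ih _)

end

/-- Each letter costs one factor of the size of `Ad(g⁻¹)`, because `g` itself is isometric. The set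
of words on the right does not depend on `g`. -/
theorem norm_wordS_smoothRep_le (w : List (Fin 3)) : ∃ S : Finset (List (Fin 3)),
    ∀ (g : SL(2, ℝ)) (v : smoothVectors k) (M : ℝ), 1 ≤ M → (∀ i j, |adCoeff g i j| ≤ M) →
      ‖(wordS w (smoothRep k g v) : DiscSeries k)‖
        ≤ M ^ w.length * ∑ w' ∈ S, ‖(wordS w' v : DiscSeries k)‖ := by
  induction w using List.reverseRecOn with
  | nil => exact ⟨{[]}, fun g v M _ _ => by simp⟩
  | append_singleton w i ih =>
    obtain ⟨S, hS⟩ := ih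
    refine ⟨(S ×ˢ Finset.univ).image fun p : List (Fin 3) × Fin 3 => p.1 ++ [p.2],
      fun g v M hM hg => ?_⟩
    rw [Finset.sum_image (by
      rintro ⟨a, i⟩ - ⟨b, j⟩ - h
      simpa using List.append_inj' h rfl), Finset.sum_product_right]
    simp only [wordS_concat_smoothRep, Submodule.coe_sum, Submodule.coe_smul,
      List.length_append, List.length_singleton]
    simp only [wordS_concat]
    rw [Finset.mul_sum]
    refine (norm_sum_le _ _).trans (Finset.sum_le_sum fun j _ => ?_)
    rw [norm_smul, Complex.norm_real, Real.norm_eq_abs, pow_succ', mul_assoc]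
    exact mul_le_mul (hg i j) (hS g _ M hM hg) (norm_nonneg _) (by linarith)

/-! ### Continuous functionals on smooth vectors -/

/-- Continuity of a functional for the Fréchet topology on smooth vectors. -/
def IsDist (l : smoothVectors k →ₗ[ℂ] ℂ) : Prop :=
  ∃ (S : Finset (List (Fin 3))) (C : ℝ),
    ∀ v : smoothVectors k, ‖l v‖ ≤ C * ∑ w ∈ S, ‖(wordS w v : DiscSeries k)‖

/-- Moderate growth: continuity on smooth vectors forces polynomial growth in the adjoint
coefficients. It rules out negative frequencies and makes Fourier modes continuous. -/
theorem IsDist.exists_growth {l : smoothVectors k →ₗ[ℂ] ℂ} (hl : IsDist l) :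
    ∃ (S : Finset (List (Fin 3))) (C : ℝ) (N : ℕ), 0 ≤ C ∧
      ∀ (g : SL(2, ℝ)) (v : smoothVectors k) (M : ℝ), 1 ≤ M → (∀ i j, |adCoeff g i j| ≤ M) →
      ‖l (smoothRep k g v)‖ ≤ C * M ^ N * ∑ w ∈ S, ‖(wordS w v : DiscSeries k)‖ := by
  obtain ⟨S, C, h⟩ := hl
  choose T hT using norm_wordS_smoothRep_le (k := k)
  refine ⟨S.biUnion T, |C| * S.card, S.sup List.length, by positivity, fun g v M hM hg => ?_⟩
  have h1 : ∀ w ∈ S, ‖(wordS w (smoothRep k g v) : DiscSeries k)‖ ≤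
      M ^ S.sup List.length * ∑ w ∈ S.biUnion T, ‖(wordS w v : DiscSeries k)‖ := fun w hw => by
    refine (hT w g v M hM hg).trans ?_
    gcongr
    · exact Finset.le_sup (f := List.length) hw
    · exact Finset.subset_biUnion_of_mem T hw
  calc ‖l (smoothRep k g v)‖ ≤ C * ∑ w ∈ S, ‖(wordS w (smoothRep k g v) : DiscSeries k)‖ := h _
    _ ≤ |C| * ∑ w ∈ S, ‖(wordS w (smoothRep k g v) : DiscSeries k)‖ := by
        gcongr; exact le_abs_self C
    _ ≤ |C| * (S.card • (M ^ S.sup List.length *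
          ∑ w ∈ S.biUnion T, ‖(wordS w v : DiscSeries k)‖)) := by
        gcongr; exact Finset.sum_le_card_nsmul _ _ _ h1
    _ = _ := by rw [nsmul_eq_mul]; ring

theorem IsDist.comp_smoothRep {l : smoothVectors k →ₗ[ℂ] ℂ} (hl : IsDist l) (g : SL(2, ℝ)) :
    IsDist (l ∘ₗ smoothRep k g) := by
  obtain ⟨S, C, N, -, h⟩ := hl.exists_growth
  refine ⟨S, C * (1 + ∑ i, ∑ j, |adCoeff g i j|) ^ N, fun v => h g v _ ?_ fun i j => ?_⟩
  · exact le_add_of_nonneg_right (Finset.sum_nonneg fun i _ => Finset.sum_nonneg fun j _ =>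
      abs_nonneg _)
  · have h1 : |adCoeff g i j| ≤ ∑ j, |adCoeff g i j| :=
      Finset.single_le_sum (f := fun j => |adCoeff g i j|) (fun _ _ => abs_nonneg _)
        (Finset.mem_univ j)
    have h2 : ∑ j, |adCoeff g i j| ≤ ∑ i, ∑ j, |adCoeff g i j| :=
      Finset.single_le_sum (f := fun i => ∑ j, |adCoeff g i j|)
        (fun _ _ => Finset.sum_nonneg fun _ _ => abs_nonneg _) (Finset.mem_univ i)
    linarith

theorem isDist_comp_subtype (l : DiscSeries k →L[ℂ] ℂ) :
    IsDist (l.toLinearMap ∘ₗ (smoothVectors k).subtype) :=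
  ⟨{[]}, ‖l‖, fun v => by simpa using l.le_opNorm v⟩

/-- A continuous functional on smooth vectors is a finite sum of continuous functionals on `D_k`
composed with elements of the enveloping algebra. -/
theorem IsDist.exists_repr {l : smoothVectors k →ₗ[ℂ] ℂ} (hl : IsDist l) :
    ∃ (S : Finset (List (Fin 3))) (L : List (Fin 3) → DiscSeries k →L[ℂ] ℂ),
      ∀ v, l v = ∑ w ∈ S, L w (wordS w v) := by
  obtain ⟨S, C, h⟩ := hl
  -- `J` records the finitely many derivatives that control `l`. So `l` descends to a bounded
  -- functional on the range of `J`, and Hahn–Banach extends it to the finite product, whose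
  -- components give the `L w`.
  let J : smoothVectors k →ₗ[ℂ] (S → DiscSeries k) :=
    LinearMap.pi fun w => (smoothVectors k).subtype ∘ₗ wordS w.1
  have hJ : ∀ v w, J v w = wordS w.1 v := fun _ _ => rfl
  have hle : ∀ v, ‖l v‖ ≤ |C| * S.card * ‖J v‖ := fun v => by
    refine (h v).trans ?_
    rw [← Finset.sum_coe_sort]
    calc C * ∑ w : S, ‖(wordS w.1 v : DiscSeries k)‖
        ≤ |C| * ∑ w : S, ‖(wordS w.1 v : DiscSeries k)‖ := by gcongr; exact le_abs_self C
      _ ≤ |C| * (Finset.card (Finset.univ : Finset S) • ‖J v‖) := by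
          gcongr
          exact Finset.sum_le_card_nsmul _ _ _ fun w _ => (hJ v w) ▸ norm_le_pi_norm (J v) w
      _ = _ := by simp [nsmul_eq_mul]; ring
  have hker : l ∈ (LinearMap.ker J).dualAnnihilator := by
    rw [Submodule.mem_dualAnnihilator]
    intro v hv
    have := hle v
    rw [LinearMap.mem_ker.mp hv, norm_zero, mul_zero] at this
    exact norm_le_zero_iff.mp this
  rw [← LinearMap.range_dualMap_eq_dualAnnihilator_ker] at hker
  obtain ⟨φ, hφ⟩ := hker
  have hφ' : ∀ v, φ (J v) = l v := fun v => by rw [← hφ]; rfl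
  let ψ : LinearMap.range J →L[ℂ] ℂ := LinearMap.mkContinuous (φ.domRestrict (LinearMap.range J))
    (|C| * S.card) (by
      rintro ⟨_, v, rfl⟩
      simpa [hφ'] using hle v)
  obtain ⟨Φ, hΦ, -⟩ := exists_extension_norm_eq (LinearMap.range J) ψ
  classical
  refine ⟨S, fun w => if hw : w ∈ S then
    Φ.comp (ContinuousLinearMap.single ℂ (fun _ : S => DiscSeries k) ⟨w, hw⟩) else 0, fun v => ?_⟩
  have h1 : l v = Φ (J v) := by
    rw [← hφ' v]
    exact (hΦ ⟨J v, v, rfl⟩).symm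
  rw [h1, ← Finset.sum_coe_sort]
  conv_lhs => rw [← Finset.univ_sum_single (J v)]
  rw [map_sum]
  refine Finset.sum_congr rfl fun w _ => ?_
  simp [hJ]

/-- The enveloping algebra commutes with integrals of continuous families of smooth vectors. -/
theorem coe_wordS_eq_integral {U : ℝ → smoothVectors k} {c : ℝ → ℂ} (hc : Continuous c)
    (hU : ∀ w, Continuous fun s => (wordS w (U s) : DiscSeries k)) {a b : ℝ}
    {v : smoothVectors k} (hv : (v : DiscSeries k) = ∫ s in a..b, c s • (U s : DiscSeries k))
    (w : List (Fin 3)) :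
    (wordS w v : DiscSeries k) = ∫ s in a..b, c s • (wordS w (U s) : DiscSeries k) := by
  induction w with
  | nil => exact hv
  | cons i w ih =>
    -- Comparing values at `z` replaces the unbounded generator by the bounded functional `lieL`,
    -- which commutes with the integral.
    ext z
    have h1 : IntervalIntegrable (fun s => c s • (wordS (i :: w) (U s) : DiscSeries k))
      volume a b := (hc.smul (hU _)).intervalIntegrable _ _
    have h2 : IntervalIntegrable (fun s => c s • (wordS w (U s) : DiscSeries k))
      volume a b := (hc.smul (hU _)).intervalIntegrable _ _
    rw [wordS_cons, coe_lieS, lieAct_fn i (wordS w v).2, ih, ← evalL_apply,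
      ← ContinuousLinearMap.intervalIntegral_comp_comm _ h1,
      ← ContinuousLinearMap.intervalIntegral_comp_comm _ h2]
    simp only [map_smul, evalL_apply, wordS_cons, coe_lieS]
    refine intervalIntegral.integral_congr fun s _ => ?_
    rw [lieAct_fn i (wordS w (U s)).2]

/-- By `IsDist.exists_repr`, `l` is a finite sum of bounded functionals after words, and both
commute with the integral. -/
theorem IsDist.apply_eq_integral {l : smoothVectors k →ₗ[ℂ] ℂ} (hl : IsDist l)
    {U : ℝ → smoothVectors k} {c : ℝ → ℂ} (hc : Continuous c)
    (hU : ∀ w, Continuous fun s => (wordS w (U s) : DiscSeries k)) {a b : ℝ}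
    {v : smoothVectors k} (hv : (v : DiscSeries k) = ∫ s in a..b, c s • (U s : DiscSeries k)) :
    l v = ∫ s in a..b, c s * l (U s) := by
  obtain ⟨S, L, hL⟩ := hl.exists_repr
  have h1 : ∀ w, IntervalIntegrable (fun s => c s • (wordS w (U s) : DiscSeries k))
      volume a b := fun w => (hc.smul (hU _)).intervalIntegrable _ _
  simp only [hL, Finset.mul_sum]
  rw [intervalIntegral.integral_finsetSum (f := fun w s => c s * L w (wordS w (U s))) fun w _ =>
    (hc.mul ((L w).continuous.comp (hU w))).intervalIntegrable _ _]
  refine Finset.sum_congr rfl fun w _ => ?_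
  rw [coe_wordS_eq_integral hc hU hv w, ← ContinuousLinearMap.intervalIntegral_comp_comm _ (h1 w)]
  simp

theorem IsDist.continuous_orbit {l : smoothVectors k →ₗ[ℂ] ℂ} (hl : IsDist l) {X : Type*}
    [TopologicalSpace X] {g : X → SL(2, ℝ)} (hg : StrongCont k g) (v : smoothVectors k) :
    Continuous fun x => l (smoothRep k (g x) v) := by
  obtain ⟨S, L, hL⟩ := hl.exists_repr
  simp only [hL]
  exact continuous_finsetSum _ fun w _ => (L w).continuous.comp (hg.wordS w v)

/-- The fundamental theorem of calculus holds for the orbit in `D_k`; applying `l` under the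
integral and differentiating the resulting continuous scalar integrand avoids difference quotients
in the Fréchet topology. -/
theorem IsDist.hasDerivAt_orbit {l : smoothVectors k →ₗ[ℂ] ℂ} (hl : IsDist l) (i : Fin 3)
    (v : smoothVectors k) (s : ℝ) :
    HasDerivAt (fun s => l (smoothRep k (oneParam i s) v))
      (l (smoothRep k (oneParam i s) (lieS i v))) s := by
  have hcont : Continuous fun s => l (smoothRep k (oneParam i s) (lieS i v)) :=
    hl.continuous_orbit (strongCont_oneParam i) _
  have h1 : ∀ s, l (smoothRep k (oneParam i s) v)
      = l v + ∫ r in (0 : ℝ)..s, l (smoothRep k (oneParam i r) (lieS i v)) := by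
    intro s
    have h2 := hl.apply_eq_integral (U := fun r => smoothRep k (oneParam i r) (lieS i v))
      (c := fun _ => 1) continuous_const (fun w => (strongCont_oneParam i).wordS w _)
      (a := 0) (b := s) (v := smoothRep k (oneParam i s) v - v) (by
        simp only [one_smul, coe_smoothRep, coe_lieS]
        rw [intervalIntegral.integral_eq_sub_of_hasDerivAt
          (f := fun r => discRep k (oneParam i r) v)]
        · simp
        · intro r _
          simpa using hasDerivAt_discRep_oneParam i 1 v.2 r
        · exact ((strongCont_oneParam i).rep _ (lieAct_mem i v.2)).intervalIntegrable _ _)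
    simp only [one_mul] at h2
    rw [← h2, map_sub]
    ring
  have h3 := (hcont.integral_hasStrictDerivAt 0 s).hasDerivAt.const_add (l v)
  exact h3.congr_of_eventuallyEq (Filter.Eventually.of_forall h1)

end DiscSeries

/-! ### The lowest weight vector: integrability and smoothness -/

theorem lintegral_inv_one_add_sq_lt_top :
    ∫⁻ x : ℝ, ENNReal.ofReal ((1 + x ^ 2)⁻¹) < ⊤ :=
  integrable_inv_one_add_sq.lintegral_lt_top

/-- The weighted square integrability of `(z + i)^{-K}`. -/
theorem lintegral_lowestWeight_lt_top {K : ℕ} (hK : 2 ≤ K) :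
    ∫⁻ w in {w : ℂ | 0 < w.im}, ENNReal.ofReal (w.im ^ K / w.im ^ 2) *
      ‖((w + Complex.I) ^ K)⁻¹‖ₑ ^ 2 < ⊤ := by
  -- The integrand is dominated by `((1 + x²)(1 + y²))⁻¹`, which is a product of integrable
  -- functions.
  have h1 : ∫⁻ w : ℂ, ENNReal.ofReal ((1 + w.re ^ 2)⁻¹) * ENNReal.ofReal ((1 + w.im ^ 2)⁻¹) < ⊤ := by
    have h := Complex.volume_preserving_equiv_real_prod.lintegral_comp_emb
      Complex.measurableEquivRealProd.measurableEmbedding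
      (fun p : ℝ × ℝ => ENNReal.ofReal ((1 + p.1 ^ 2)⁻¹) * ENNReal.ofReal ((1 + p.2 ^ 2)⁻¹))
    simp only [Complex.measurableEquivRealProd_apply] at h
    rw [h, Measure.volume_eq_prod, lintegral_prod_mul (f := fun x => ENNReal.ofReal ((1 + x ^ 2)⁻¹))
      (g := fun x => ENNReal.ofReal ((1 + x ^ 2)⁻¹)) (by fun_prop) (by fun_prop)]
    exact ENNReal.mul_lt_top lintegral_inv_one_add_sq_lt_top lintegral_inv_one_add_sq_lt_top
  refine lt_of_le_of_lt ?_ h1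
  refine (setLIntegral_mono' ?_ fun w hw => ?_).trans (setLIntegral_le_lintegral _ _)
  · exact measurableSet_lt measurable_const Complex.measurable_im
  have hw0 : 0 < w.im := hw
  rw [← ofReal_norm, ← ENNReal.ofReal_pow (norm_nonneg _), ← ENNReal.ofReal_mul (by positivity),
    ← ENNReal.ofReal_mul (by positivity)]
  refine ENNReal.ofReal_le_ofReal ?_
  have h2 : ‖w + Complex.I‖ ^ 2 = w.re ^ 2 + (w.im + 1) ^ 2 := by
    rw [← Complex.normSq_eq_norm_sq, Complex.normSq_apply]
    simp
    ring
  rw [norm_inv, norm_pow, inv_pow, ← pow_mul, mul_comm K 2, pow_mul, h2]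
  obtain ⟨m, rfl⟩ := Nat.exists_eq_add_of_le' hK
  have h3 : w.im ^ (m + 2) / w.im ^ 2 = w.im ^ m := by
    rw [pow_add]; field_simp
  rw [h3, ← div_eq_mul_inv, ← mul_inv, div_le_iff₀ (by positivity), inv_mul_eq_div,
    le_div_iff₀ (by positivity)]
  have h4 : w.im ^ m ≤ ((w.im + 1) ^ 2) ^ m := by
    rw [← pow_mul]
    calc w.im ^ m ≤ (w.im + 1) ^ m := by gcongr; linarith
      _ ≤ (w.im + 1) ^ (2 * m) := pow_le_pow_right₀ (by linarith) (by omega)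
  have h5 : ((w.im + 1) ^ 2) ^ m ≤ (w.re ^ 2 + (w.im + 1) ^ 2) ^ m := by
    gcongr; nlinarith [sq_nonneg w.re]
  have h6 : (1 + w.re ^ 2) * (1 + w.im ^ 2) ≤ (w.re ^ 2 + (w.im + 1) ^ 2) ^ 2 := by
    have a1 : 1 + w.re ^ 2 ≤ w.re ^ 2 + (w.im + 1) ^ 2 := by nlinarith
    have a2 : 1 + w.im ^ 2 ≤ w.re ^ 2 + (w.im + 1) ^ 2 := by nlinarith [sq_nonneg w.re]
    exact (mul_le_mul a1 a2 (by positivity) (by positivity)).trans_eq (sq _).symm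
  rw [pow_add]
  exact mul_le_mul (h4.trans h5) h6 (by positivity) (by positivity)

/-- A second-order Taylor remainder with a uniform constant, used to differentiate `(z + s)^{-K}` in
`s` simultaneously for all `z`. -/
theorem norm_inv_one_add_pow_sub_le (K : ℕ) : ∃ C : ℝ, 0 ≤ C ∧ ∀ η : ℂ, ‖η‖ ≤ 1 / 2 →
    ‖((1 + η) ^ K)⁻¹ - 1 + K * η‖ ≤ C * ‖η‖ ^ 2 := by
  induction K with
  | zero => exact ⟨0, le_rfl, fun η _ => by simp⟩
  | succ K ih =>
    obtain ⟨C, hC, h⟩ := ih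
    refine ⟨(C + (K + 1)) * 2, by positivity, fun η hη => ?_⟩
    have h1 : 1 / 2 ≤ ‖1 + η‖ := by
      have := norm_sub_le (1 + η) η
      rw [add_sub_cancel_right, norm_one] at this
      linarith
    have h0 : (1 + η) ≠ 0 := norm_pos_iff.mp (by linarith)
    have h2 : ((1 + η) ^ (K + 1))⁻¹ - 1 + (K + 1 : ℕ) * η
        = ((((1 + η) ^ K)⁻¹ - 1 + K * η) + (K + 1) * η ^ 2) * (1 + η)⁻¹ := by
      push_cast
      field_simp
      ring
    rw [h2, norm_mul, norm_inv]
    have h3 : ‖1 + η‖⁻¹ ≤ 2 := by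
      rw [inv_le_comm₀ (by linarith) (by norm_num)]; linarith
    have h4 : ‖((K : ℂ) + 1) * η ^ 2‖ = (K + 1) * ‖η‖ ^ 2 := by
      rw [norm_mul, norm_pow]
      congr 1
      exact_mod_cast Complex.norm_natCast (K + 1)
    calc _ ≤ (C * ‖η‖ ^ 2 + (K + 1) * ‖η‖ ^ 2) * 2 := by
          refine mul_le_mul ((norm_add_le _ _).trans ?_) h3 (by positivity) (by positivity)
          rw [h4]
          gcongr
          exact h η hη
      _ = _ := by ring

namespace DiscSeries

variable {k : ℤ} [hk : Fact (2 ≤ k)]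

theorem natAbs_ge : 2 ≤ k.natAbs := by have := hk.out; omega

theorem norm_le_of_forall {u v : DiscSeries k} {c : ℝ} (hc : 0 ≤ c)
    (h : ∀ z, ‖u.fn z‖ ≤ c * ‖v.fn z‖) : ‖u‖ ≤ c * ‖v‖ := by
  have h1 : ENNReal.ofReal (‖u‖ ^ 2) ≤ ENNReal.ofReal ((c * ‖v‖) ^ 2) := by
    rw [mul_pow, ENNReal.ofReal_mul (by positivity), ofReal_norm_sq, ofReal_norm_sq,
      ← lintegral_const_mul' _ _ (by simp)]
    refine lintegral_mono fun z => ?_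
    rw [← ofReal_norm, ← ofReal_norm, ← ENNReal.ofReal_pow (norm_nonneg _),
      ← ENNReal.ofReal_pow (norm_nonneg _), ← ENNReal.ofReal_mul (by positivity), ← mul_pow]
    exact ENNReal.ofReal_le_ofReal (pow_le_pow_left₀ (norm_nonneg _) (h z) 2)
  rw [ENNReal.ofReal_le_ofReal_iff (by positivity)] at h1
  exact (pow_le_pow_iff_left₀ (norm_nonneg _) (by positivity) two_ne_zero).mp h1

theorem mem_bergmanSpace_of_le {F : ℍ → ℂ} (hF : IsHol k F) (v : DiscSeries k) {c : ℝ}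
    (h : ∀ z, ‖F z‖ ≤ c * ‖v.fn z‖) : F ∈ bergmanSpace k :=
  ⟨hF, v.2.2.of_le_mul hF.continuous.aestronglyMeasurable (Filter.Eventually.of_forall h)⟩

theorem add_ne_zero_of_im_pos {s : ℂ} (hs : 0 < s.im) (z : ℍ) : (z + s : ℂ) ≠ 0 := by
  intro h
  have := congrArg Complex.im h
  have hz := z.im_pos
  simp at this
  linarith

theorem im_le_norm_add {s : ℂ} (hs : 0 < s.im) (z : ℍ) : s.im ≤ ‖(z + s : ℂ)‖ := by
  refine le_trans ?_ (Complex.abs_im_le_norm _)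
  have hz := z.im_pos
  rw [Complex.add_im, UpperHalfPlane.coe_im, abs_of_pos (by linarith)]
  linarith

theorem isHol_inv_pow {s : ℂ} (hs : 0 < s.im) (M : ℕ) :
    IsHol k fun z : ℍ => ((z + s : ℂ) ^ M)⁻¹ := by
  rw [isHol_iff]
  have : DifferentiableOn ℂ (fun w : ℂ => ((w + s) ^ M)⁻¹) {w | 0 < w.im} := by
    refine DifferentiableOn.inv (by fun_prop) fun w hw => pow_ne_zero _ ?_
    exact add_ne_zero_of_im_pos hs ⟨w, hw⟩
  refine this.congr fun w hw => ?_
  rw [Function.comp_apply, ofComplex_apply_of_im_pos hw]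

/-- The lowest weight vector `(z + i)^{-K}`. -/
noncomputable def lowest : DiscSeries k :=
  ⟨fun z => ((z + Complex.I : ℂ) ^ k.natAbs)⁻¹, isHol_inv_pow (by simp) _, by
    have hc : Continuous fun z : ℍ => ((z + Complex.I : ℂ) ^ k.natAbs)⁻¹ :=
      (isHol_inv_pow (k := k) (by simp) _).continuous
    refine ⟨hc.aestronglyMeasurable, ?_⟩
    rw [eLpNorm_lt_top_iff_lintegral_rpow_enorm_lt_top (by simp) (by simp)]
    simp only [ENNReal.toReal_ofNat, ENNReal.rpow_two]
    rw [lintegral_bergmanMeasure _ _ ((hc.measurable.enorm).pow_const 2)]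
    refine lt_of_eq_of_lt ?_ (lintegral_lowestWeight_lt_top (natAbs_ge (k := k)))
    refine setLIntegral_congr_fun (measurableSet_lt measurable_const Complex.measurable_im)
      fun w hw => ?_
    simp only [ofComplex_apply_of_im_pos hw]⟩

@[simp] theorem lowest_fn (z : ℍ) :
    (lowest (k := k)).fn z = ((z + Complex.I : ℂ) ^ k.natAbs)⁻¹ := rfl

/-- Domination by the lowest weight vector: `|z + i| ≤ (1 + |i - s| / Im s) |z + s|` handles `K`
factors, and `|z + s| ≥ Im s` the remaining `M - K`. -/
theorem inv_pow_mem {s : ℂ} (hs : 0 < s.im) {M : ℕ} (hM : k.natAbs ≤ M) :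
    (fun z : ℍ => ((z + s : ℂ) ^ M)⁻¹) ∈ bergmanSpace k := by
  refine mem_bergmanSpace_of_le (isHol_inv_pow hs M) lowest
    (c := (s.im ^ (M - k.natAbs))⁻¹ * (1 + ‖Complex.I - s‖ / s.im) ^ k.natAbs) fun z => ?_
  have h1 := im_le_norm_add hs z
  have h0 := norm_pos_iff.mpr (add_ne_zero_of_im_pos hs z)
  have h0' := norm_pos_iff.mpr (add_ne_zero_of_im_pos (s := Complex.I) (by simp) z)
  have h2 : ‖(z + Complex.I : ℂ)‖ ≤ (1 + ‖Complex.I - s‖ / s.im) * ‖(z + s : ℂ)‖ := by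
    have h3 : (z + Complex.I : ℂ) = (z + s) + (Complex.I - s) := by ring
    rw [h3, add_mul, one_mul]
    refine (norm_add_le _ _).trans (add_le_add_right ?_ _)
    rw [div_mul_eq_mul_div, le_div_iff₀ hs]
    gcongr
  rw [lowest_fn, norm_inv, norm_inv, norm_pow, norm_pow, ← Nat.sub_add_cancel hM, pow_add, mul_inv,
    mul_assoc]
  simp only [Nat.add_sub_cancel]
  refine mul_le_mul (inv_anti₀ (by positivity) (pow_le_pow_left₀ hs.le h1 _)) ?_ (by positivity)
    (by positivity)
  rw [← div_eq_mul_inv, le_div_iff₀ (by positivity), inv_mul_le_iff₀ (by positivity), ← mul_pow]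
  rw [mul_comm] at h2
  exact pow_le_pow_left₀ h0'.le h2 _

open Classical in
/-- The kernel functions `(z + s)^{-M}`, `M ≥ K`. -/
noncomputable def kernelVec (M : ℕ) (s : ℂ) : DiscSeries k :=
  if h : 0 < s.im ∧ k.natAbs ≤ M then ⟨_, inv_pow_mem h.1 h.2⟩ else 0

theorem kernelVec_fn {M : ℕ} {s : ℂ} (hs : 0 < s.im) (hM : k.natAbs ≤ M) (z : ℍ) :
    (kernelVec (k := k) M s).fn z = ((z + s : ℂ) ^ M)⁻¹ := by
  have : kernelVec (k := k) M s = ⟨_, inv_pow_mem hs hM⟩ := dif_pos ⟨hs, hM⟩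
  rw [this]; rfl

/-- With `η / (z + s)` as the small quantity, the remainder is pointwise at most `C |η|² / (Im s)²`
times the kernel function itself, so differentiability holds in norm. -/
theorem hasDerivAt_kernelVec {s : ℂ} (hs : 0 < s.im) :
    HasDerivAt (kernelVec (k := k) k.natAbs)
      (-(k.natAbs : ℂ) • kernelVec (k := k) (k.natAbs + 1) s) s := by
  rw [hasDerivAt_iff_isLittleO_nhds_zero]
  obtain ⟨C, hC, h⟩ := norm_inv_one_add_pow_sub_le k.natAbs
  refine Asymptotics.IsBigO.trans_isLittleO (g := fun h : ℂ => h ^ 2) ?_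
    (Asymptotics.isLittleO_pow_id one_lt_two)
  refine Asymptotics.IsBigO.of_bound (C / s.im ^ 2 * ‖kernelVec (k := k) k.natAbs s‖) ?_
  filter_upwards [Metric.ball_mem_nhds (0 : ℂ) (half_pos hs)] with η hη
  rw [mem_ball_zero_iff] at hη
  have hs' : 0 < (s + η).im := by
    have := (Complex.abs_im_le_norm η).trans_lt hη
    rw [abs_lt] at this
    rw [Complex.add_im]
    linarith [this.1]
  have key : ‖kernelVec (k := k) k.natAbs (s + η) - kernelVec k.natAbs s -
      η • -(k.natAbs : ℂ) • kernelVec (k := k) (k.natAbs + 1) s‖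
      ≤ C / s.im ^ 2 * ‖η‖ ^ 2 * ‖kernelVec (k := k) k.natAbs s‖ := by
    refine norm_le_of_forall (by positivity) fun z => ?_
    simp only [fn_sub, fn_smul, kernelVec_fn hs' le_rfl, kernelVec_fn hs le_rfl,
      kernelVec_fn hs (Nat.le_succ _)]
    have hz := add_ne_zero_of_im_pos hs z
    have hz1 := im_le_norm_add hs z
    have hz' := add_ne_zero_of_im_pos hs' z
    have h1 : ‖η / (z + s)‖ ≤ 1 / 2 := by
      rw [norm_div, div_le_iff₀ (hs.trans_le hz1)]
      linarith
    have h2 := h _ h1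
    have h3 : (1 + η / (z + s) : ℂ) = (z + (s + η)) / (z + s) := by field_simp; ring
    have h4 : ((z + (s + η) : ℂ) ^ k.natAbs)⁻¹ - ((z + s : ℂ) ^ k.natAbs)⁻¹ -
        η * (-(k.natAbs : ℂ) * ((z + s : ℂ) ^ (k.natAbs + 1))⁻¹)
        = (((1 + η / (z + s) : ℂ) ^ k.natAbs)⁻¹ - 1 + k.natAbs * (η / (z + s)))
          * ((z + s : ℂ) ^ k.natAbs)⁻¹ := by
      rw [h3, div_pow]
      field_simp
      ring
    rw [h4, norm_mul]
    gcongr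
    refine h2.trans ?_
    rw [norm_div, div_pow, div_mul_eq_mul_div, mul_div_assoc]
    gcongr
  rw [norm_pow]
  linarith

theorem contDiffAt_kernelVec {s : ℂ} (hs : 0 < s.im) :
    ContDiffAt ℝ ∞ (kernelVec (k := k) k.natAbs) s := by
  have h1 : DifferentiableOn ℂ (kernelVec (k := k) k.natAbs) {w | 0 < w.im} :=
    fun w hw => (hasDerivAt_kernelVec hw).differentiableAt.differentiableWithinAt
  have h2 : ContDiffOn ℂ ∞ (kernelVec (k := k) k.natAbs) {w | 0 < w.im} :=
    h1.contDiffOn isOpen_upperHalfPlaneSet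
  exact (h2.contDiffAt (isOpen_upperHalfPlaneSet.mem_nhds hs)).restrict_scalars ℝ

theorem det_eq (g : SL(2, ℝ)) : g.1 0 0 * g.1 1 1 - g.1 0 1 * g.1 1 0 = 1 := by
  rw [← Matrix.det_fin_two]; exact g.2

theorem sub_I_mul_ne_zero (g : SL(2, ℝ)) : (g.1 1 1 - Complex.I * g.1 1 0 : ℂ) ≠ 0 := by
  intro h
  have h1 := congrArg Complex.re h
  have h2 := congrArg Complex.im h
  simp at h1 h2
  have := det_eq g
  rw [h1, h2] at this
  simp at this

theorem im_kernel_pos (g : SL(2, ℝ)) :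
    0 < ((Complex.I * g.1 0 0 - g.1 0 1) / (g.1 1 1 - Complex.I * g.1 1 0) : ℂ).im := by
  have h0 := Complex.normSq_pos.mpr (sub_I_mul_ne_zero g)
  rw [Complex.div_im, ← sub_div]
  refine div_pos ?_ h0
  have := det_eq g
  simp
  linarith

/-- The new parameter is `-conj (g • i)`: the orbit stays among the kernel functions up to scalars,
so its smoothness reduces to that of `kernelVec` in `s`. -/
theorem discRep_lowest (g : SL(2, ℝ)) :
    discRep k g lowest = ((g.1 1 1 - Complex.I * g.1 1 0 : ℂ) ^ k.natAbs)⁻¹ •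
      kernelVec k.natAbs ((Complex.I * g.1 0 0 - g.1 0 1) / (g.1 1 1 - Complex.I * g.1 1 0)) := by
  ext z
  rw [fn_smul, kernelVec_fn (im_kernel_pos g) le_rfl, discRep_fn', lowest_fn, ← mul_inv,
    ← mul_inv]
  have hk0 : 0 < k := by have := hk.out; omega
  have hd : denom ((g⁻¹ : SL(2, ℝ)) : GL (Fin 2) ℝ) z = g.1 0 0 - g.1 1 0 * z := by
    change (((g⁻¹).1 1 0 : ℝ) : ℂ) * z + (((g⁻¹).1 1 1 : ℝ) : ℂ) = _
    rw [inv_coe]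
    simp
    ring
  have hn : num ((g⁻¹ : SL(2, ℝ)) : GL (Fin 2) ℝ) z = g.1 1 1 * z - g.1 0 1 := by
    change (((g⁻¹).1 0 0 : ℝ) : ℂ) * z + (((g⁻¹).1 0 1 : ℝ) : ℂ) = _
    rw [inv_coe]
    simp
    ring
  have h0 : (g.1 0 0 - g.1 1 0 * z : ℂ) ≠ 0 := hd ▸ denom_ne_zero _ z
  rw [autFactor, if_pos hk0, coe_sl_smul, hn, hd, ← mul_pow, ← mul_pow]
  have h1 := sub_I_mul_ne_zero g
  congr 2
  rw [mul_add (g.1 1 1 - Complex.I * g.1 1 0 : ℂ), mul_div_cancel₀ _ h1, mul_add,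
    mul_div_cancel₀ _ h0]
  ring

theorem lowest_mem : lowest ∈ smoothVectors k := by
  intro g
  simp only [discRep_lowest]
  have hc : ∀ a b, ContDiff ℝ ∞ fun x : ℝ × ℝ × ℝ => (((iwasawa x * g).1 a b : ℝ) : ℂ) := by
    intro a b
    simp only [Matrix.SpecialLinearGroup.coe_mul, Matrix.mul_apply]
    have h : ContDiff ℝ ∞ fun x : ℝ × ℝ × ℝ => ∑ c, (iwasawa x).1 a c * g.1 c b :=
      ContDiff.sum fun c _ => (contDiff_iwasawa_coe _ _).mul contDiff_const
    exact Complex.ofRealCLM.contDiff.comp h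
  have hd : ContDiff ℝ ∞ fun x : ℝ × ℝ × ℝ =>
      ((iwasawa x * g).1 1 1 - Complex.I * (iwasawa x * g).1 1 0 : ℂ) :=
    (hc 1 1).sub (contDiff_const.mul (hc 1 0))
  have hn : ContDiff ℝ ∞ fun x : ℝ × ℝ × ℝ =>
      (Complex.I * (iwasawa x * g).1 0 0 - (iwasawa x * g).1 0 1 : ℂ) :=
    (contDiff_const.mul (hc 0 0)).sub (hc 0 1)
  refine ContDiff.smul ((hd.pow _).inv fun x => pow_ne_zero _ (sub_I_mul_ne_zero _)) ?_
  rw [contDiff_iff_contDiffAt]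
  intro x
  have hq : ContDiff ℝ ∞ fun x : ℝ × ℝ × ℝ =>
      ((Complex.I * (iwasawa x * g).1 0 0 - (iwasawa x * g).1 0 1) /
        ((iwasawa x * g).1 1 1 - Complex.I * (iwasawa x * g).1 1 0) : ℂ) :=
    hn.mul (hd.inv fun x => sub_I_mul_ne_zero _)
  exact ContDiffAt.comp (g := kernelVec (k := k) k.natAbs) x
    (contDiffAt_kernelVec (im_kernel_pos _)) hq.contDiffAt

/-! ### Lie algebra on the lowest weight vector -/

/-- The lowest weight vector as a smooth vector. -/
noncomputable def lowS : smoothVectors k := ⟨lowest, lowest_mem⟩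

theorem lieAct_two_fn (v : smoothVectors k) (z : ℍ) :
    (lieS 2 v : DiscSeries k).fn z = -deriv ((v : DiscSeries k).fn ∘ ofComplex) z := by
  rw [coe_lieS, lieAct_fn 2 v.2]
  simp [lieL, lieGen]

theorem hasDerivAt_inv_pow (z : ℍ) (M : ℕ) :
    HasDerivAt (fun w : ℂ => ((w + Complex.I) ^ M)⁻¹)
      (-(M : ℂ) * ((z + Complex.I : ℂ) ^ (M + 1))⁻¹) z := by
  have h0 := add_ne_zero_of_im_pos (s := Complex.I) (by simp) z
  have h1 := ((hasDerivAt_id (z : ℂ)).add_const Complex.I).pow M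
  refine (h1.inv (pow_ne_zero _ h0)).congr_deriv ?_
  rcases M with _ | M
  · simp
  · simp only [id, Pi.pow_apply]
    simp only [Nat.add_sub_cancel, mul_one]
    field_simp
    ring

theorem deriv_of_fn_eq {v : DiscSeries k} {c : ℂ} {M : ℕ}
    (hv : ∀ z, v.fn z = c * ((z + Complex.I : ℂ) ^ M)⁻¹) (z : ℍ) :
    deriv (v.fn ∘ ofComplex) z = c * (-(M : ℂ) * ((z + Complex.I : ℂ) ^ (M + 1))⁻¹) := by
  refine HasDerivAt.deriv (((hasDerivAt_inv_pow z M).const_mul c).congr_of_eventuallyEq ?_)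
  filter_upwards [isOpen_upperHalfPlaneSet.mem_nhds z.im_pos] with w hw
  rw [Function.comp_apply, ofComplex_apply_of_im_pos hw, hv]

/-- The generator of `N` acts as `-d/dz`, so each application raises the exponent and contributes
one factor of `K (K + 1) ⋯`. -/
theorem lieS_two_pow_lowS_fn (l : ℕ) (z : ℍ) :
    (((lieS 2 ^ l) lowS : smoothVectors k) : DiscSeries k).fn z
      = (k.natAbs.ascFactorial l : ℂ) * ((z + Complex.I : ℂ) ^ (k.natAbs + l))⁻¹ := by
  induction l generalizing z with
  | zero => simp [lowS]
  | succ l ih =>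
    rw [pow_succ', Module.End.mul_apply, lieAct_two_fn, deriv_of_fn_eq ih,
      Nat.ascFactorial_succ]
    push_cast
    ring

/-- A polynomial in the generator of `N` applied to the lowest weight vector. -/
noncomputable def polyVec (q : Polynomial ℂ) : smoothVectors k :=
  (Polynomial.aeval (lieS (k := k) 2) q) lowS

theorem polyVec_add (p q : Polynomial ℂ) :
    polyVec (k := k) (p + q) = polyVec p + polyVec q := by simp [polyVec]

theorem polyVec_sub (p q : Polynomial ℂ) :
    polyVec (k := k) (p - q) = polyVec p - polyVec q := by simp [polyVec]

theorem polyVec_sum {ι : Type*} (s : Finset ι) (p : ι → Polynomial ℂ) :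
    polyVec (k := k) (∑ i ∈ s, p i) = ∑ i ∈ s, polyVec (p i) := by
  simp [polyVec, map_sum]

theorem polyVec_C_mul (c : ℂ) (p : Polynomial ℂ) :
    polyVec (k := k) (Polynomial.C c * p) = c • polyVec p := by
  simp [polyVec, Module.algebraMap_end_apply]

theorem polyVec_X_pow (l : ℕ) : polyVec (k := k) (Polynomial.X ^ l) = (lieS 2 ^ l) lowS := by
  simp [polyVec]

/-- The polynomials giving the `K`-types. -/
noncomputable def typePoly (k : ℤ) (j : ℕ) : Polynomial ℂ :=
  ∑ l ∈ Finset.range (j + 1),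
    Polynomial.C ((-2 * Complex.I) ^ l * (j.choose l) / (k.natAbs.ascFactorial l)) *
      Polynomial.X ^ l

/-- The `K`-finite vectors `(z - i)^j / (z + i)^{K + j}`. -/
noncomputable def typeVec (j : ℕ) : smoothVectors k := polyVec (typePoly k j)

/-- Expand `(z - i)^j = ((z + i) - 2i)^j`; the ascending factorials in the denominators of
`typePoly` cancel those produced by differentiation. -/
theorem typeVec_fn (j : ℕ) (z : ℍ) :
    (typeVec (k := k) j : DiscSeries k).fn z
      = (z - Complex.I) ^ j * ((z + Complex.I : ℂ) ^ (k.natAbs + j))⁻¹ := by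
  have h0 := add_ne_zero_of_im_pos (s := Complex.I) (by simp) z
  have h1 : (typeVec (k := k) j) = ∑ l ∈ Finset.range (j + 1),
      ((-2 * Complex.I) ^ l * (j.choose l) / (k.natAbs.ascFactorial l)) •
        (lieS 2 ^ l) lowS := by
    simp only [typeVec, typePoly, polyVec_sum, polyVec_C_mul, polyVec_X_pow]
  rw [h1, Submodule.coe_sum, ← evalL_apply, map_sum]
  simp only [Submodule.coe_smul, map_smul, evalL_apply, lieS_two_pow_lowS_fn, smul_eq_mul]
  have h2 : (z - Complex.I : ℂ) = -2 * Complex.I + (z + Complex.I) := by ring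
  rw [h2, add_pow, Finset.sum_mul]
  refine Finset.sum_congr rfl fun l hl => ?_
  have h3 : (k.natAbs.ascFactorial l : ℂ) ≠ 0 := by
    have := Nat.ascFactorial_pos (k.natAbs - 1) l
    rw [Nat.sub_add_cancel (by have := natAbs_ge (k := k); omega)] at this
    exact_mod_cast this.ne'
  have h4 : l ≤ j := by simpa [Nat.lt_succ_iff] using hl
  obtain ⟨m, rfl⟩ := Nat.exists_eq_add_of_le h4
  simp only [Nat.add_sub_cancel_left]
  field_simp
  ring

/-- The Cayley coordinate `(z - i) / (z + i)` is merely rotated by `K`. Numerator and denominator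
are kept apart because the automorphy factor involves the same `D`. -/
theorem rotK_inv_smul (θ : ℝ) (z : ℍ) : ∃ D : ℂ, D ≠ 0 ∧
    autFactor k (rotK θ)⁻¹ z = D ^ k.natAbs ∧
    (((rotK θ)⁻¹ • z : ℍ) : ℂ) - Complex.I = Complex.exp (θ * Complex.I) * (z - Complex.I) / D ∧
    (((rotK θ)⁻¹ • z : ℍ) : ℂ) + Complex.I
      = Complex.exp (-(θ * Complex.I)) * (z + Complex.I) / D := by
  have hk0 : 0 < k := by have := hk.out; omega
  have hd : denom (((rotK θ)⁻¹ : SL(2, ℝ)) : GL (Fin 2) ℝ) z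
      = Complex.cos θ - Complex.sin θ * z := by
    change ((((rotK θ)⁻¹).1 1 0 : ℝ) : ℂ) * z + ((((rotK θ)⁻¹).1 1 1 : ℝ) : ℂ) = _
    rw [inv_coe, rotK_coe]
    simp
    ring
  have hn : num (((rotK θ)⁻¹ : SL(2, ℝ)) : GL (Fin 2) ℝ) z
      = Complex.cos θ * z + Complex.sin θ := by
    change ((((rotK θ)⁻¹).1 0 0 : ℝ) : ℂ) * z + ((((rotK θ)⁻¹).1 0 1 : ℝ) : ℂ) = _
    rw [inv_coe, rotK_coe]
    simp
  have h0 : (Complex.cos θ - Complex.sin θ * z : ℂ) ≠ 0 := hd ▸ denom_ne_zero _ z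
  refine ⟨_, h0, by rw [autFactor, if_pos hk0, hd], ?_, ?_⟩
  · rw [coe_sl_smul, hd, hn, div_sub' h0, Complex.exp_mul_I]
    congr 1
    linear_combination (Complex.sin θ) * Complex.I_sq
  · rw [coe_sl_smul, hd, hn, div_add' _ _ _ h0, ← neg_mul, Complex.exp_mul_I, Complex.cos_neg,
      Complex.sin_neg]
    congr 1
    linear_combination (Complex.sin θ) * Complex.I_sq

theorem discRep_rotK_typeVec (θ : ℝ) (j : ℕ) :
    discRep k (rotK θ) (typeVec j : smoothVectors k)
      = Complex.exp ((k.natAbs + 2 * j : ℕ) * (θ * Complex.I)) •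
        (typeVec (k := k) j : DiscSeries k) := by
  ext z
  obtain ⟨D, hD, h1, h2, h3⟩ := rotK_inv_smul (k := k) θ z
  rw [discRep_fn', fn_smul, typeVec_fn, typeVec_fn, h1, h2, h3, div_pow, div_pow, mul_pow, mul_pow,
    ← Complex.exp_nat_mul, ← Complex.exp_nat_mul]
  have h0 := add_ne_zero_of_im_pos (s := Complex.I) (by simp) z
  have he : Complex.exp ((k.natAbs + 2 * j : ℕ) * (θ * Complex.I)) =
      Complex.exp (j * (θ * Complex.I)) *
        (Complex.exp ((k.natAbs + j : ℕ) * -(θ * Complex.I)))⁻¹ := by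
    rw [← Complex.exp_neg, ← Complex.exp_add]
    congr 1
    push_cast
    ring
  rw [he]
  have := Complex.exp_ne_zero ((k.natAbs + j : ℕ) * -(θ * Complex.I))
  field_simp
  ring

theorem typeVec_ne_zero (j : ℕ) : (typeVec (k := k) j : DiscSeries k) ≠ 0 := by
  intro h
  have h1 := typeVec_fn (k := k) j ⟨2 * Complex.I, by simp⟩
  rw [h, fn_zero] at h1
  have h2 : (2 * Complex.I - Complex.I : ℂ) = Complex.I := by ring
  have h3 : (2 * Complex.I + Complex.I : ℂ) = 3 * Complex.I := by ring
  simp [h2, h3] at h1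

/-- This is annihilation by the lowering operator, with the rotation generator replaced by its
eigenvalue `iK`. It is what produces the differential equation along `A`. -/
theorem lieS_one_lowS :
    lieS 1 lowS = (k.natAbs : ℂ) • lowS - (2 * Complex.I) • lieS (k := k) 2 lowS := by
  refine Subtype.ext (DiscSeries.ext fun z => ?_)
  have h0 := add_ne_zero_of_im_pos (s := Complex.I) (by simp) z
  have hl : ∀ z, (lowest (k := k)).fn z = 1 * ((z + Complex.I : ℂ) ^ k.natAbs)⁻¹ := by simp
  have h1 := deriv_of_fn_eq hl z
  rw [coe_lieS, lieAct_fn 1 lowS.2, Submodule.coe_sub, fn_sub, Submodule.coe_smul,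
    Submodule.coe_smul, fn_smul, fn_smul, lieAct_two_fn]
  simp only [lieL, lieGen, lowS]
  simp [h1]
  field_simp
  ring

end DiscSeries

theorem integral_exp_int_mul_I (m : ℤ) :
    ∫ θ in (0 : ℝ)..2 * Real.pi, Complex.exp (m * (θ * Complex.I))
      = if m = 0 then (2 * Real.pi : ℂ) else 0 := by
  split_ifs with h
  · simp [h]
  · have hc : (m * Complex.I : ℂ) ≠ 0 := mul_ne_zero (by exact_mod_cast h) Complex.I_ne_zero
    have h1 : ∀ θ : ℝ, (m * (θ * Complex.I) : ℂ) = m * Complex.I * θ := fun θ => by ring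
    simp only [h1]
    rw [integral_exp_mul_complex hc]
    have h2 : (m * Complex.I * ((2 * Real.pi : ℝ) : ℂ)) = m * (2 * Real.pi * Complex.I) := by
      push_cast; ring
    rw [h2, Complex.exp_int_mul_two_pi_mul_I]
    simp

theorem HasSum.congr_terms {E : Type*} [AddCommMonoid E] [TopologicalSpace E] {f g : ℕ → E} {a : E}
    (h : HasSum f a) (hfg : ∀ j, g j = f j) : HasSum g a :=
  (funext hfg : g = f) ▸ h

namespace DiscSeries

variable {k : ℤ} [hk : Fact (2 ≤ k)]

/-! ### Expansion in `K`-types -/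

/-- The function on the unit disc corresponding to a vector of `D_k`. -/
noncomputable def diskFn (v : DiscSeries k) (w : ℂ) : ℂ :=
  (2 * Complex.I / (1 - w)) ^ k.natAbs *
    (v.fn ∘ ofComplex) (Complex.I * (1 + w) / (1 - w))

/-- The Taylor coefficients on the disc, which are the coefficients in the basis `typeVec`. -/
noncomputable def typeCoeff (v : DiscSeries k) (j : ℕ) : ℂ :=
  (j.factorial : ℂ)⁻¹ * iteratedDeriv j (diskFn v) 0

theorem differentiableOn_diskFn (v : DiscSeries k) :
    DifferentiableOn ℂ (diskFn v) (Metric.ball 0 1) := by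
  have h1 : ∀ w ∈ Metric.ball (0 : ℂ) 1, 1 - w ≠ 0 := fun w hw h => by
    rw [mem_ball_zero_iff, ← sub_eq_zero.mp h, norm_one] at hw
    exact lt_irrefl _ hw
  have h2 : DifferentiableOn ℂ (fun w : ℂ => Complex.I * (1 + w) / (1 - w)) (Metric.ball 0 1) :=
    DifferentiableOn.div (by fun_prop) (by fun_prop) h1
  refine DifferentiableOn.mul (DifferentiableOn.pow
    (DifferentiableOn.div (by fun_prop) (by fun_prop) h1) _) (v.differentiableOn.comp h2 ?_)
  intro w hw
  have hw1 : Complex.normSq w < 1 := by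
    rw [Complex.normSq_eq_norm_sq]
    have := mem_ball_zero_iff.mp hw
    nlinarith [norm_nonneg w]
  have h3 := Complex.normSq_pos.mpr (h1 w hw)
  rw [Complex.normSq_apply] at hw1
  change 0 < (Complex.I * (1 + w) / (1 - w)).im
  rw [Complex.div_im, ← sub_div]
  refine div_pos ?_ h3
  simp
  nlinarith

/-- Taylor expansion on the disc in `w = (z - i) / (z + i)`; the factor `(z + i)^{-K}` turns `w^j`
into `typeVec j`. -/
theorem hasSum_typeCoeff_fn (v : DiscSeries k) (z : ℍ) :
    HasSum (fun j => typeCoeff v j * (typeVec (k := k) j : DiscSeries k).fn z) (v.fn z) := by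
  have h0 := add_ne_zero_of_im_pos (s := Complex.I) (by simp) z
  set w : ℂ := (z - Complex.I) / (z + Complex.I) with hw
  have hw1 : w ∈ Metric.ball (0 : ℂ) 1 := by
    rw [mem_ball_zero_iff, hw, norm_div, div_lt_one (norm_pos_iff.mpr h0)]
    rw [← sq_lt_sq₀ (norm_nonneg _) (norm_nonneg _), ← Complex.normSq_eq_norm_sq,
      ← Complex.normSq_eq_norm_sq, Complex.normSq_apply, Complex.normSq_apply]
    have := z.im_pos
    simp
    nlinarith
  have h2 : 1 - w = 2 * Complex.I / (z + Complex.I) := by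
    rw [hw]; field_simp; ring
  have h3 : 1 + w = 2 * z / (z + Complex.I) := by
    rw [hw]; field_simp; ring
  have h4 : diskFn v w = (z + Complex.I) ^ k.natAbs * v.fn z := by
    have h5 : 2 * Complex.I / (1 - w) = z + Complex.I := by
      rw [h2, div_div_cancel₀ (by simp)]
    have h6 : Complex.I * (1 + w) / (1 - w) = z := by
      rw [h2, h3]; field_simp
    rw [diskFn, h5, h6, Function.comp_apply, ofComplex_apply]
  have h5 := (Complex.hasSum_taylorSeries_on_ball (differentiableOn_diskFn v) hw1).mul_left
    (((z + Complex.I : ℂ) ^ k.natAbs)⁻¹)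
  rw [h4, ← mul_assoc, inv_mul_cancel₀ (pow_ne_zero _ h0), one_mul] at h5
  refine h5.congr_terms fun j => ?_
  rw [typeVec_fn, typeCoeff, smul_eq_mul, smul_eq_mul, sub_zero, hw, div_pow, pow_add]
  field_simp

theorem hasSum_typeCoeff_rotK_fn (v : DiscSeries k) (θ : ℝ) (z : ℍ) :
    HasSum (fun j => Complex.exp ((k.natAbs + 2 * j : ℕ) * (θ * Complex.I)) *
      (typeCoeff v j * (typeVec (k := k) j : DiscSeries k).fn z))
      ((discRep k (rotK θ) v).fn z) := by
  rw [discRep_fn']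
  refine ((hasSum_typeCoeff_fn v ((rotK θ)⁻¹ • z)).mul_left
    (autFactor k (rotK θ)⁻¹ z)⁻¹).congr_terms fun j => ?_
  rw [mul_left_comm _ (typeCoeff v j), mul_left_comm _ (typeCoeff v j), ← discRep_fn',
    discRep_rotK_typeVec, fn_smul]

theorem continuous_rotK_orbit (v : smoothVectors k) :
    Continuous fun θ => discRep k (rotK θ) (v : DiscSeries k) :=
  (strongCont_oneParam (k := k) 0).rep v v.2

/-- Averaging against a character of `K` keeps only the term with `K + 2j = l`. Leaving the answer
as a series treats at once the characters that occur and those that do not. -/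
theorem integral_rotK_fn (v : smoothVectors k) (l : ℤ) (z : ℍ) :
    HasSum (fun j : ℕ => (if (k.natAbs + 2 * j : ℤ) = l then (2 * Real.pi : ℂ) else 0) *
      (typeCoeff (v : DiscSeries k) j * (typeVec (k := k) j : DiscSeries k).fn z))
      ((∫ θ in (0 : ℝ)..2 * Real.pi,
        Complex.exp (-(l * (θ * Complex.I))) • discRep k (rotK θ) (v : DiscSeries k)).fn z) := by
  have hc : Continuous fun θ : ℝ => Complex.exp (-(l * (θ * Complex.I))) := by fun_prop
  have hi : IntervalIntegrable (fun θ : ℝ => Complex.exp (-(l * (θ * Complex.I))) •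
      discRep k (rotK θ) (v : DiscSeries k)) volume 0 (2 * Real.pi) :=
    (hc.smul (continuous_rotK_orbit v)).intervalIntegrable _ _
  rw [← evalL_apply, ← ContinuousLinearMap.intervalIntegral_comp_comm _ hi]
  simp only [map_smul, evalL_apply, smul_eq_mul]
  have hs : Summable fun j => ‖typeCoeff (v : DiscSeries k) j *
    (typeVec (k := k) j : DiscSeries k).fn z‖ := (hasSum_typeCoeff_fn _ z).summable.norm
  have h := intervalIntegral.hasSum_integral_of_dominated_convergence (a := 0) (b := 2 * Real.pi)
    (μ := volume)
    (F := fun (j : ℕ) (θ : ℝ) => Complex.exp (-(l * (θ * Complex.I))) *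
      (Complex.exp ((k.natAbs + 2 * j : ℕ) * (θ * Complex.I)) *
        (typeCoeff (v : DiscSeries k) j * (typeVec (k := k) j : DiscSeries k).fn z)))
    (f := fun θ => Complex.exp (-(l * (θ * Complex.I))) *
      (discRep k (rotK θ) (v : DiscSeries k)).fn z)
    (fun j _ => ‖typeCoeff (v : DiscSeries k) j * (typeVec (k := k) j : DiscSeries k).fn z‖)
    (fun j => by
      refine Continuous.aestronglyMeasurable ?_
      fun_prop)
    (fun j => Filter.Eventually.of_forall fun θ _ => by
      have e1 : ‖Complex.exp (-(l * (θ * Complex.I)))‖ = 1 := by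
        rw [← neg_mul, ← mul_assoc, Complex.norm_exp]; simp
      have e2 : ‖Complex.exp ((k.natAbs + 2 * j : ℕ) * (θ * Complex.I))‖ = 1 := by
        rw [← mul_assoc, Complex.norm_exp]; simp
      rw [norm_mul, norm_mul, e1, e2, one_mul, one_mul])
    (Filter.Eventually.of_forall fun θ _ => hs) (intervalIntegrable_const)
    (Filter.Eventually.of_forall fun θ _ => (hasSum_typeCoeff_rotK_fn _ θ z).mul_left _)
  refine h.congr_terms fun j => ?_
  have e : ∀ θ : ℝ, Complex.exp (-(l * (θ * Complex.I))) *
      (Complex.exp ((k.natAbs + 2 * j : ℕ) * (θ * Complex.I)) *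
        (typeCoeff (v : DiscSeries k) j * (typeVec (k := k) j : DiscSeries k).fn z))
      = Complex.exp (((k.natAbs + 2 * j - l : ℤ) : ℂ) * (θ * Complex.I)) *
        (typeCoeff (v : DiscSeries k) j * (typeVec (k := k) j : DiscSeries k).fn z) := fun θ => by
    rw [← mul_assoc, ← Complex.exp_add]
    congr 2
    rw [Int.cast_sub, Int.cast_add, Int.cast_mul, Int.cast_natCast, Int.cast_natCast,
      Nat.cast_add, Nat.cast_mul, Int.cast_ofNat, Nat.cast_ofNat]
    ring
  simp only [e]
  rw [intervalIntegral.integral_mul_const, integral_exp_int_mul_I]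
  simp only [sub_eq_zero]

theorem integral_rotK_eq (v : smoothVectors k) (j : ℕ) :
    ∫ θ in (0 : ℝ)..2 * Real.pi,
        Complex.exp (-(((k.natAbs + 2 * j : ℤ) : ℂ) * (θ * Complex.I))) •
          discRep k (rotK θ) (v : DiscSeries k)
      = (2 * Real.pi * typeCoeff (v : DiscSeries k) j : ℂ) • (typeVec (k := k) j : DiscSeries k) := by
  ext z
  refine (integral_rotK_fn v _ z).unique ?_
  let f : ℕ → ℂ := fun i =>
    (if (k.natAbs + 2 * i : ℤ) = k.natAbs + 2 * j then (2 * Real.pi : ℂ) else 0) *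
      (typeCoeff (v : DiscSeries k) i * (typeVec (k := k) i : DiscSeries k).fn z)
  have h : HasSum f (f j) := hasSum_single j fun i hi => by
    have : (k.natAbs + 2 * i : ℤ) ≠ k.natAbs + 2 * j := by omega
    simp only [f, if_neg this, zero_mul]
  have h2 : f j = 2 * Real.pi * typeCoeff (v : DiscSeries k) j *
      (typeVec (k := k) j : DiscSeries k).fn z := by
    simp only [f, if_true, mul_assoc]
  rw [fn_smul, ← h2]
  exact h

theorem integral_rotK_eq_zero (v : smoothVectors k) {l : ℤ}
    (hl : ∀ j : ℕ, (k.natAbs + 2 * j : ℤ) ≠ l) :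
    ∫ θ in (0 : ℝ)..2 * Real.pi, Complex.exp (-(l * (θ * Complex.I))) •
          discRep k (rotK θ) (v : DiscSeries k) = 0 := by
  ext z
  refine (integral_rotK_fn v _ z).unique ?_
  refine (hasSum_zero : HasSum (fun _ : ℕ => (0 : ℂ)) 0).congr_terms fun j => ?_
  rw [if_neg (hl j), zero_mul]

theorem IsDist.integral_rotK_eq {l : smoothVectors k →ₗ[ℂ] ℂ} (hl : IsDist l)
    (v : smoothVectors k) (j : ℕ) :
    ∫ θ in (0 : ℝ)..2 * Real.pi,
        Complex.exp (-(((k.natAbs + 2 * j : ℤ) : ℂ) * (θ * Complex.I))) * l (smoothRep k (rotK θ) v)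
      = 2 * Real.pi * typeCoeff (v : DiscSeries k) j * l (typeVec j) := by
  have h := hl.apply_eq_integral (U := fun θ => smoothRep k (rotK θ) v)
    (c := fun θ => Complex.exp (-(((k.natAbs + 2 * j : ℤ) : ℂ) * (θ * Complex.I))))
    (by fun_prop) (fun w => (strongCont_oneParam (k := k) 0).wordS w v)
    (a := 0) (b := 2 * Real.pi) (v := (2 * Real.pi * typeCoeff (v : DiscSeries k) j : ℂ) • typeVec j)
    (by simpa using (DiscSeries.integral_rotK_eq v j).symm)
  rw [← h, map_smul, smul_eq_mul]

theorem IsDist.integral_rotK_eq_zero {l : smoothVectors k →ₗ[ℂ] ℂ} (hl : IsDist l)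
    (v : smoothVectors k) {m : ℤ} (hm : ∀ j : ℕ, (k.natAbs + 2 * j : ℤ) ≠ m) :
    ∫ θ in (0 : ℝ)..2 * Real.pi,
        Complex.exp (-((m : ℂ) * (θ * Complex.I))) * l (smoothRep k (rotK θ) v) = 0 := by
  have h := hl.apply_eq_integral (U := fun θ => smoothRep k (rotK θ) v)
    (c := fun θ => Complex.exp (-((m : ℂ) * (θ * Complex.I))))
    (by fun_prop) (fun w => (strongCont_oneParam (k := k) 0).wordS w v)
    (a := 0) (b := 2 * Real.pi) (v := 0)
    (by simpa using (DiscSeries.integral_rotK_eq_zero v hm).symm)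
  rw [← h, map_zero]

theorem lieS_zero_smoothRep_rotK (θ : ℝ) (v : smoothVectors k) :
    lieS 0 (smoothRep k (rotK θ) v) = smoothRep k (rotK θ) (lieS 0 v) := by
  rw [lieS_smoothRep, Fin.sum_univ_three]
  have h0 : adCoeff (rotK θ) 0 0 = 1 := by
    simp [adCoeff_apply, rotK_coe]
  have h1 : adCoeff (rotK θ) 0 1 = 0 := by
    simp [adCoeff_apply, rotK_coe]; ring
  have h2 : adCoeff (rotK θ) 0 2 = 0 := by
    simp [adCoeff_apply, rotK_coe]
  simp [h0, h1, h2]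

theorem lieS_zero_typeVec (j : ℕ) :
    lieS 0 (typeVec j) = ((k.natAbs + 2 * j : ℕ) * Complex.I : ℂ) • typeVec (k := k) j := by
  refine Subtype.ext ?_
  have h1 := hasDerivAt_oneParam_zero 0 (typeVec (k := k) j).2
  have h2 : HasDerivAt (fun θ : ℝ => Complex.exp ((k.natAbs + 2 * j : ℕ) * (θ * Complex.I)))
      ((k.natAbs + 2 * j : ℕ) * Complex.I) 0 := by
    have := ((((hasDerivAt_id (0 : ℝ)).ofReal_comp.mul_const Complex.I).const_mul
      ((k.natAbs + 2 * j : ℕ) : ℂ))).cexp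
    simpa using this
  have h3 := h2.smul_const (typeVec (k := k) j : DiscSeries k)
  refine h1.unique (h3.congr_of_eventuallyEq (Filter.Eventually.of_forall fun θ => ?_))
  exact discRep_rotK_typeVec θ j

/-- The rotation generator commutes with `K`, hence with the projection to a K-type, where it is the
scalar `i (K + 2j)`. -/
theorem typeCoeff_lieS_zero (v : smoothVectors k) (j : ℕ) :
    typeCoeff (lieS 0 v : DiscSeries k) j
      = (k.natAbs + 2 * j : ℕ) * Complex.I * typeCoeff (v : DiscSeries k) j := by
  have h := coe_wordS_eq_integral (U := fun θ => smoothRep k (rotK θ) v)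
    (c := fun θ => Complex.exp (-(((k.natAbs + 2 * j : ℤ) : ℂ) * (θ * Complex.I))))
    (by fun_prop) (fun w => (strongCont_oneParam (k := k) 0).wordS w v)
    (a := 0) (b := 2 * Real.pi) (v := (2 * Real.pi * typeCoeff (v : DiscSeries k) j : ℂ) • typeVec j)
    (by simpa using (DiscSeries.integral_rotK_eq v j).symm) [0]
  simp only [wordS_cons, wordS_nil, LinearMap.id_coe, id, lieS_zero_smoothRep_rotK] at h
  rw [map_smul, lieS_zero_typeVec] at h
  have h2 := DiscSeries.integral_rotK_eq (lieS 0 v) j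
  simp only [coe_smoothRep] at h
  rw [h2, Submodule.coe_smul, Submodule.coe_smul, smul_smul, ← sub_eq_zero, ← sub_smul,
    smul_eq_zero, or_iff_left (typeVec_ne_zero j)] at h
  have hpi : (2 * Real.pi : ℂ) ≠ 0 := by simp [Real.pi_ne_zero]
  refine mul_left_cancel₀ hpi ?_
  linear_combination -h

theorem norm_exp_neg_int (l : ℤ) (θ : ℝ) : ‖Complex.exp (-((l : ℂ) * (θ * Complex.I)))‖ = 1 := by
  rw [← neg_mul, ← mul_assoc, Complex.norm_exp]; simp

/-- The projection is an average of isometries. -/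
theorem norm_typeCoeff_smul_le (v : smoothVectors k) (j : ℕ) :
    ‖typeCoeff (v : DiscSeries k) j • (typeVec (k := k) j : DiscSeries k)‖ ≤ ‖(v : DiscSeries k)‖ := by
  have h := DiscSeries.integral_rotK_eq v j
  rw [mul_smul] at h
  have h1 := intervalIntegral.norm_integral_le_of_norm_le_const (a := 0) (b := 2 * Real.pi)
    (f := fun θ : ℝ => Complex.exp (-(((k.natAbs + 2 * j : ℤ) : ℂ) * (θ * Complex.I))) •
          discRep k (rotK θ) (v : DiscSeries k)) (C := ‖(v : DiscSeries k)‖) fun θ _ => by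
    rw [norm_smul, norm_exp_neg_int, norm_discRep, one_mul]
  rw [h, norm_smul, sub_zero, abs_of_pos Real.two_pi_pos] at h1
  have h2 : ‖(2 * Real.pi : ℂ)‖ = 2 * Real.pi := by
    rw [norm_mul, Complex.norm_real]; simp [Real.pi_pos.le]
  rw [h2, mul_comm ‖_‖] at h1
  exact le_of_mul_le_mul_left h1 Real.two_pi_pos

theorem IsDist.exists_norm_typeCoeff_mul_le {l : smoothVectors k →ₗ[ℂ] ℂ} (hl : IsDist l)
    (v : smoothVectors k) :
    ∃ C, ∀ j, ‖typeCoeff (v : DiscSeries k) j * l (typeVec j)‖ ≤ C := by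
  have hc : Continuous fun θ => l (smoothRep k (rotK θ) v) :=
    hl.continuous_orbit (strongCont_oneParam (k := k) 0) v
  obtain ⟨C, hC⟩ := isCompact_Icc (a := (0 : ℝ)) (b := 2 * Real.pi)
    |>.exists_bound_of_continuousOn hc.continuousOn
  refine ⟨C, fun j => ?_⟩
  have h := hl.integral_rotK_eq v j
  rw [mul_assoc] at h
  have h1 := intervalIntegral.norm_integral_le_of_norm_le_const (a := 0) (b := 2 * Real.pi)
    (f := fun θ : ℝ => Complex.exp (-(((k.natAbs + 2 * j : ℤ) : ℂ) * (θ * Complex.I))) *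
          l (smoothRep k (rotK θ) v)) (C := C) fun θ hθ => by
    rw [norm_mul, norm_exp_neg_int, one_mul]
    rw [Set.uIoc_of_le Real.two_pi_pos.le] at hθ
    exact hC θ ⟨hθ.1.le, hθ.2⟩
  rw [h, norm_mul, sub_zero, abs_of_pos Real.two_pi_pos] at h1
  have h2 : ‖(2 * Real.pi : ℂ)‖ = 2 * Real.pi := by
    rw [norm_mul, Complex.norm_real]; simp [Real.pi_pos.le]
  rw [h2, mul_comm C] at h1
  exact le_of_mul_le_mul_left h1 Real.two_pi_pos

/-- Two derivatives along `K` buy a factor `(K + 2j)^{-2}`, enough for absolute convergence. -/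
theorem typeCoeff_eq_div (v : smoothVectors k) (j : ℕ) :
    typeCoeff (v : DiscSeries k) j
      = -typeCoeff (lieS 0 (lieS 0 v) : DiscSeries k) j / ((k.natAbs + 2 * j : ℕ) : ℂ) ^ 2 := by
  have h0 : ((k.natAbs + 2 * j : ℕ) : ℂ) ≠ 0 := by
    have := natAbs_ge (k := k)
    exact_mod_cast (by omega : k.natAbs + 2 * j ≠ 0)
  rw [typeCoeff_lieS_zero, typeCoeff_lieS_zero]
  field_simp
  rw [Complex.I_sq]
  ring

theorem summable_inv_type_sq : Summable fun j : ℕ => (1 / ((k.natAbs + 2 * j : ℕ) : ℝ) ^ 2) := by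
  have h := (summable_nat_add_iff 1).mpr (Real.summable_one_div_nat_pow.mpr one_lt_two)
  refine Summable.of_nonneg_of_le (fun j => by positivity) (fun j => ?_) h
  have h2 : j + 1 ≤ k.natAbs + 2 * j := by
    have := natAbs_ge (k := k)
    omega
  gcongr

/-- The decay gives convergence in norm; the limit is identified by point evaluations, where the
expansion is already known. -/
theorem hasSum_typeCoeff_smul (v : smoothVectors k) :
    HasSum (fun j => typeCoeff (v : DiscSeries k) j • (typeVec (k := k) j : DiscSeries k)) v := by
  have hs : Summable fun j => typeCoeff (v : DiscSeries k) j • (typeVec (k := k) j : DiscSeries k) := by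
    refine Summable.of_norm_bounded (g := fun j : ℕ => ‖(lieS 0 (lieS 0 v) : DiscSeries k)‖ *
      (1 / ((k.natAbs + 2 * j : ℕ) : ℝ) ^ 2)) (summable_inv_type_sq.mul_left _) fun j => ?_
    rw [typeCoeff_eq_div, norm_smul, norm_div, norm_neg, norm_pow, Complex.norm_natCast,
      div_mul_eq_mul_div, ← norm_smul, mul_one_div]
    gcongr
    exact norm_typeCoeff_smul_le _ j
  have h1 := hs.hasSum
  convert h1 using 1
  ext z
  have h2 := (evalL (k := k) z).hasSum h1
  refine (hasSum_typeCoeff_fn (v : DiscSeries k) z).unique ?_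
  exact h2

/-- Every continuous functional is determined by its values on the `K`-finite vectors. -/
theorem IsDist.hasSum_typeCoeff {l : smoothVectors k →ₗ[ℂ] ℂ} (hl : IsDist l)
    (v : smoothVectors k) :
    HasSum (fun j => typeCoeff (v : DiscSeries k) j * l (typeVec j)) (l v) := by
  have hT : Fact (0 < 2 * Real.pi) := ⟨Real.two_pi_pos⟩
  have hc : Continuous fun θ => l (smoothRep k (rotK θ) v) :=
    hl.continuous_orbit (strongCont_oneParam (k := k) 0) v
  have hper : Function.Periodic (fun θ => l (smoothRep k (rotK θ) v)) (2 * Real.pi) := fun θ => by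
    have : rotK (θ + 2 * Real.pi) = rotK θ := by
      refine Subtype.ext ?_
      rw [rotK_coe, rotK_coe, Real.cos_add_two_pi, Real.sin_add_two_pi]
    simp only [this]
  -- The Fourier coefficients of `θ ↦ l(k_θ v)` vanish off the frequencies `K + 2j` and are
  -- summable, so the Fourier series may be evaluated at `θ = 0`.
  let f : C(AddCircle (2 * Real.pi), ℂ) := ⟨hper.lift, continuous_coinduced_dom.mpr hc⟩
  have hf : ∀ θ : ℝ, f (θ : AddCircle (2 * Real.pi)) = l (smoothRep k (rotK θ) v) := fun θ => rfl
  have hcoeff : ∀ m : ℤ, fourierCoeff f m = (2 * Real.pi : ℂ)⁻¹ *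
      ∫ θ in (0 : ℝ)..2 * Real.pi,
        Complex.exp (-((m : ℂ) * (θ * Complex.I))) * l (smoothRep k (rotK θ) v) := by
    intro m
    rw [fourierCoeff_eq_intervalIntegral _ _ 0, zero_add, Complex.real_smul]
    push_cast
    rw [one_div]
    congr 1
    refine intervalIntegral.integral_congr fun θ _ => ?_
    simp only [hf, smul_eq_mul, fourier_coe_apply]
    congr 2
    have : (Real.pi : ℂ) ≠ 0 := by simp [Real.pi_ne_zero]
    push_cast
    field_simp
  have hpi : (2 * Real.pi : ℂ) ≠ 0 := by simp [Real.pi_ne_zero]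
  let e : ℕ → ℤ := fun j => (k.natAbs + 2 * j : ℤ)
  have he : Function.Injective e := fun i j h => by simpa [e] using h
  have h1 : ∀ j, fourierCoeff f (e j) = typeCoeff (v : DiscSeries k) j * l (typeVec j) := by
    intro j
    rw [hcoeff, hl.integral_rotK_eq]
    field_simp
  have h2 : ∀ m, m ∉ Set.range e → fourierCoeff f m = 0 := by
    intro m hm
    rw [hcoeff, hl.integral_rotK_eq_zero v fun j hj => hm ⟨j, hj⟩, mul_zero]
  have hs : Summable fun j => typeCoeff (v : DiscSeries k) j * l (typeVec j) := by
    obtain ⟨C, hC⟩ := hl.exists_norm_typeCoeff_mul_le (lieS 0 (lieS 0 v))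
    refine Summable.of_norm_bounded (g := fun j : ℕ => C *
      (1 / ((k.natAbs + 2 * j : ℕ) : ℝ) ^ 2)) (summable_inv_type_sq.mul_left _) fun j => ?_
    rw [typeCoeff_eq_div, norm_mul, norm_div, norm_neg, norm_pow, Complex.norm_natCast,
      div_mul_eq_mul_div, ← norm_mul, mul_one_div]
    gcongr
    exact hC j
  have hs' : Summable (fourierCoeff f) := by
    rw [← he.summable_iff h2]
    exact hs.congr fun j => (h1 j).symm
  have h3 := has_pointwise_sum_fourier_series_of_summable hs' (0 : ℝ)
  rw [hf] at h3
  have h4 : rotK 0 = 1 := oneParam_zero 0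
  rw [h4, smoothRep_one, ← he.hasSum_iff] at h3
  · refine h3.congr_terms fun j => ?_
    rw [Function.comp_apply, h1 j, QuotientAddGroup.mk_zero, fourier_eval_zero, smul_eq_mul, mul_one]
  · intro m hm
    rw [h2 m hm, zero_smul]

end DiscSeries

theorem integral_pow_mul_exp_neg_Ioi (n : ℕ) {r : ℝ} (hr : 0 < r) :
    IntegrableOn (fun x : ℝ => x ^ n * Real.exp (-(r * x))) (Set.Ioi 0) ∧
    ∫ x in Set.Ioi (0 : ℝ), x ^ n * Real.exp (-(r * x)) = n.factorial / r ^ (n + 1) := by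
  have h := Real.integral_rpow_mul_exp_neg_mul_Ioi (a := n + 1) (r := r) (by positivity) hr
  simp only [add_sub_cancel_right, Real.rpow_natCast] at h
  rw [Real.Gamma_nat_eq_factorial] at h
  have h2 : ((1 / r) ^ ((n : ℝ) + 1)) * n.factorial = n.factorial / r ^ (n + 1) := by
    rw [← Nat.cast_add_one, Real.rpow_natCast, one_div, inv_pow, inv_mul_eq_div]
  rw [h2] at h
  refine ⟨?_, h⟩
  -- The integral of a non-integrable function is `0` by convention, so a nonzero value proves
  -- integrability.
  refine Integrable.of_integral_ne_zero ?_
  rw [h]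
  positivity

namespace DiscSeries

variable {k : ℤ} [hk : Fact (2 ≤ k)]

/-! ### The isometry onto the Kirillov model -/

theorem polyVec_one : polyVec (k := k) 1 = lowS := by
  simp [polyVec]

theorem typePoly_zero : typePoly k 0 = 1 := by
  simp [typePoly]

theorem typeVec_zero : typeVec (k := k) 0 = lowS := by
  rw [typeVec, typePoly_zero, polyVec_one]

theorem typeCoeff_zero (v : DiscSeries k) :
    typeCoeff v 0 = (2 * Complex.I) ^ k.natAbs * v.fn UpperHalfPlane.I := by
  have : Complex.I = ((UpperHalfPlane.I : ℍ) : ℂ) := rfl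
  simp only [typeCoeff, diskFn, iteratedDeriv_zero, Nat.factorial_zero, Nat.cast_one, inv_one,
    one_mul, sub_zero, add_zero, mul_one, div_one, Function.comp_apply]
  conv_lhs => rw [this, ofComplex_apply]
  rfl

/-- Distinct characters of `K` are orthogonal; a nonzero product would force `e^{2ijθ} = 1` for all
`θ`, which fails at `θ = π / (2j)`. -/
theorem inner_typeVec_zero_typeVec {j : ℕ} (hj : j ≠ 0) :
    inner ℂ (typeVec (k := k) 0 : DiscSeries k) (typeVec (k := k) j : DiscSeries k) = 0 := by
  by_contra h0
  have h : ∀ θ : ℝ, Complex.exp ((2 * j : ℕ) * (θ * Complex.I)) = 1 := by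
    intro θ
    have h := inner_discRep (rotK θ) (typeVec (k := k) 0 : DiscSeries k) (typeVec j : smoothVectors k)
    rw [discRep_rotK_typeVec, discRep_rotK_typeVec, inner_smul_left, inner_smul_right, ← mul_assoc]
      at h
    have h2 := mul_right_cancel₀ h0 (h.trans (one_mul _).symm)
    rw [← h2, ← Complex.exp_conj, ← Complex.exp_add]
    congr 1
    simp
    ring
  have h1 := h (Real.pi / (2 * j))
  have h2 : (((2 * j : ℕ) : ℂ) * (((Real.pi / (2 * j) : ℝ) : ℂ) * Complex.I)) = Real.pi * Complex.I := by
    have : (j : ℂ) ≠ 0 := by exact_mod_cast hj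
    push_cast
    field_simp
  rw [h2, Complex.exp_pi_mul_I] at h1
  norm_num at h1

/-- The reproducing property at `i`: by orthogonality only the zeroth coefficient survives, and it
is the value at the centre of the disc. -/
theorem inner_lowS (u : smoothVectors k) :
    inner ℂ (lowS (k := k) : DiscSeries k) (u : DiscSeries k)
      = (2 * Complex.I) ^ k.natAbs * ‖(lowS (k := k) : DiscSeries k)‖ ^ 2 *
        (u : DiscSeries k).fn UpperHalfPlane.I := by
  have h := (isDist_comp_subtype (innerSL ℂ (lowS (k := k) : DiscSeries k))).hasSum_typeCoeff u
  have h1 : ∀ j ≠ 0, typeCoeff (u : DiscSeries k) j *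
      inner ℂ (lowS (k := k) : DiscSeries k) (typeVec (k := k) j : DiscSeries k) = 0 := fun j hj => by
    rw [← typeVec_zero, inner_typeVec_zero_typeVec hj, mul_zero]
  have h2 := (hasSum_single 0 h1).unique h
  have h3 : inner ℂ (lowS (k := k) : DiscSeries k) (u : DiscSeries k) =
      typeCoeff (u : DiscSeries k) 0 *
      inner ℂ (lowS (k := k) : DiscSeries k) (typeVec (k := k) 0 : DiscSeries k) := h2.symm
  rw [h3, typeVec_zero, inner_self_eq_norm_sq_to_K, typeCoeff_zero]
  simp only [Complex.coe_algebraMap]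
  ring

/-- Differentiate the constant function `s ↦ ⟨n_s u, n_s v⟩`. -/
theorem inner_lieS_two (u v : smoothVectors k) :
    inner ℂ (lieS 2 u : DiscSeries k) (v : DiscSeries k)
      = -inner ℂ (u : DiscSeries k) (lieS 2 v : DiscSeries k) := by
  have h1 := (hasDerivAt_oneParam_zero 2 u.2).inner ℂ (hasDerivAt_oneParam_zero 2 v.2)
  simp only [inner_discRep, oneParam_zero, discRep_one] at h1
  have h2 := h1.unique (hasDerivAt_const _ _)
  rw [coe_lieS, coe_lieS]
  linear_combination h2

theorem inner_lieS_two_pow (a : ℕ) (u v : smoothVectors k) :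
    inner ℂ ((lieS 2 ^ a) u : DiscSeries k) (v : DiscSeries k)
      = (-1) ^ a * inner ℂ (u : DiscSeries k) ((lieS 2 ^ a) v : DiscSeries k) := by
  induction a generalizing v with
  | zero => simp
  | succ a ih =>
    rw [pow_succ', Module.End.mul_apply, inner_lieS_two, ih, ← pow_succ' (lieS 2) a, pow_succ (lieS 2) a,
      Module.End.mul_apply]
    ring

/-- Skew-adjointness moves all powers to one side, and `inner_lowS` evaluates the result at `i`. -/
theorem inner_polyVec_X_pow (a b : ℕ) :
    inner ℂ (polyVec (k := k) (Polynomial.X ^ a) : DiscSeries k)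
        (polyVec (k := k) (Polynomial.X ^ b) : DiscSeries k)
      = ‖(lowS (k := k) : DiscSeries k)‖ ^ 2 * ((-1) ^ a * k.natAbs.ascFactorial (a + b) *
        ((2 * Complex.I) ^ (a + b))⁻¹) := by
  rw [polyVec_X_pow, polyVec_X_pow, inner_lieS_two_pow, ← Module.End.mul_apply, ← pow_add, inner_lowS,
    lieS_two_pow_lowS_fn]
  have : ((UpperHalfPlane.I : ℍ) : ℂ) + Complex.I = 2 * Complex.I := by
    rw [UpperHalfPlane.coe_I]; ring
  rw [this, pow_add (2 * Complex.I)]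
  field_simp

/-- The constant of the isometry. -/
noncomputable def isoConst (k : ℤ) [Fact (2 ≤ k)] : ℝ :=
  (k.natAbs - 1).factorial / ((4 * Real.pi) ^ k.natAbs * ‖(lowS (k := k) : DiscSeries k)‖ ^ 2)

theorem norm_lowS_pos : 0 < ‖(lowS (k := k) : DiscSeries k)‖ := by
  rw [norm_pos_iff, ← typeVec_zero]
  exact typeVec_ne_zero 0

theorem isoConst_pos : 0 < isoConst k := by
  have := norm_lowS_pos (k := k)
  unfold isoConst
  positivity

/-- The argument `-2πix` of the polynomials. -/
noncomputable def specVar (x : ℝ) : ℂ := -2 * Real.pi * Complex.I * x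

/-- Both sides are explicit: a Gamma integral on the left, `inner_polyVec_X_pow` on the right. The
weight `x^{K-1} e^{-4πx}` is the spectral density of the lowest weight vector for `N`, up to the
constant fixed by `a = b = 0`. -/
theorem integral_X_pow (a b : ℕ) :
    IntegrableOn (fun x : ℝ => ((x ^ (k.natAbs - 1) * Real.exp (-(4 * Real.pi * x)) : ℝ) : ℂ) *
      (conj (specVar x ^ a) * specVar x ^ b)) (Set.Ioi 0) ∧
    ∫ x in Set.Ioi (0 : ℝ), ((x ^ (k.natAbs - 1) * Real.exp (-(4 * Real.pi * x)) : ℝ) : ℂ) *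
      (conj (specVar x ^ a) * specVar x ^ b)
      = isoConst k * inner ℂ (polyVec (k := k) (Polynomial.X ^ a) : DiscSeries k)
        (polyVec (k := k) (Polynomial.X ^ b) : DiscSeries k) := by
  obtain ⟨m, hm⟩ := Nat.exists_eq_add_of_le' ((one_le_two).trans (natAbs_ge (k := k)))
  have hN := norm_lowS_pos (k := k)
  obtain ⟨h1, h2⟩ := integral_pow_mul_exp_neg_Ioi (m + (a + b)) (r := 4 * Real.pi) (by positivity)
  have h3 : ∀ x : ℝ, ((x ^ (k.natAbs - 1) * Real.exp (-(4 * Real.pi * x)) : ℝ) : ℂ) *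
      (conj (specVar x ^ a) * specVar x ^ b)
      = ((-1) ^ a * (-2 * Real.pi * Complex.I) ^ (a + b)) *
        ((x ^ (m + (a + b)) * Real.exp (-(4 * Real.pi * x)) : ℝ) : ℂ) := by
    intro x
    have : conj (specVar x) = (-1) * specVar x := by
      rw [specVar, map_mul, map_mul, map_mul, Complex.conj_I, Complex.conj_ofReal,
        Complex.conj_ofReal, map_neg, map_ofNat]
      ring
    rw [map_pow, this, mul_pow, hm, Nat.add_sub_cancel, specVar, mul_pow, mul_pow, pow_add, pow_add,
      pow_add]
    push_cast
    ring
  simp only [h3]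
  refine ⟨h1.ofReal.const_mul _, ?_⟩
  rw [integral_const_mul, integral_complex_ofReal, h2, inner_polyVec_X_pow, isoConst, hm,
    Nat.add_sub_cancel]
  have h4 : ((m + (a + b)).factorial : ℂ) = m.factorial * (m + 1).ascFactorial (a + b) := by
    rw [← Nat.factorial_mul_ascFactorial]; push_cast; ring
  have hpi : (Real.pi : ℂ) ≠ 0 := by simp [Real.pi_ne_zero]
  have hN' : (‖(lowS (k := k) : DiscSeries k)‖ : ℂ) ≠ 0 := by exact_mod_cast hN.ne'
  have h5 : (-2 * Real.pi * Complex.I : ℂ) ^ (a + b) * (2 * Complex.I) ^ (a + b)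
      = (4 * Real.pi) ^ (a + b) := by
    rw [← mul_pow]
    congr 1
    linear_combination (-4 * Real.pi : ℂ) * Complex.I_sq
  have h6 : (2 * Complex.I) ^ (a + b) ≠ 0 := pow_ne_zero _ (by simp)
  push_cast
  rw [h4]
  have h7 : (4 * Real.pi : ℂ) ^ (m + (a + b) + 1) = (4 * Real.pi) ^ (a + b) * (4 * Real.pi) ^ (m + 1) := by
    rw [← pow_add]; congr 1; ring
  rw [h7, ← h5]
  have h8 : (-2 * Real.pi * Complex.I : ℂ) ^ (a + b) ≠ 0 := pow_ne_zero _ (by simp [hpi])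
  field_simp

theorem integral_polynomial (p q : Polynomial ℂ) :
    IntegrableOn (fun x : ℝ => ((x ^ (k.natAbs - 1) * Real.exp (-(4 * Real.pi * x)) : ℝ) : ℂ) *
      (conj (p.eval (specVar x)) * q.eval (specVar x))) (Set.Ioi 0) ∧
    ∫ x in Set.Ioi (0 : ℝ), ((x ^ (k.natAbs - 1) * Real.exp (-(4 * Real.pi * x)) : ℝ) : ℂ) *
      (conj (p.eval (specVar x)) * q.eval (specVar x))
      = isoConst k * inner ℂ (polyVec (k := k) p : DiscSeries k) (polyVec (k := k) q : DiscSeries k) := by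
  induction p using Polynomial.induction_on' with
  | add p₁ p₂ h₁ h₂ =>
    obtain ⟨i₁, e₁⟩ := h₁
    obtain ⟨i₂, e₂⟩ := h₂
    simp only [Polynomial.eval_add, map_add, add_mul, mul_add, polyVec_add, Submodule.coe_add,
      inner_add_left]
    exact ⟨i₁.add i₂, by rw [integral_add i₁ i₂, e₁, e₂]⟩
  | monomial a c =>
    induction q using Polynomial.induction_on' with
    | add p₁ p₂ h₁ h₂ =>
      obtain ⟨i₁, e₁⟩ := h₁
      obtain ⟨i₂, e₂⟩ := h₂
      simp only [Polynomial.eval_add, mul_add, polyVec_add, Submodule.coe_add, inner_add_right]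
      exact ⟨i₁.add i₂, by rw [integral_add i₁ i₂, e₁, e₂]⟩
    | monomial b d =>
      obtain ⟨i, e⟩ := integral_X_pow (k := k) a b
      have h : ∀ x : ℝ, ((x ^ (k.natAbs - 1) * Real.exp (-(4 * Real.pi * x)) : ℝ) : ℂ) *
          (conj ((Polynomial.monomial a c).eval (specVar x)) *
            (Polynomial.monomial b d).eval (specVar x))
          = (conj c * d) * (((x ^ (k.natAbs - 1) * Real.exp (-(4 * Real.pi * x)) : ℝ) : ℂ) *
          (conj (specVar x ^ a) * specVar x ^ b)) := fun x => by
        rw [Polynomial.eval_monomial, Polynomial.eval_monomial, map_mul]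
        ring
      simp only [h]
      refine ⟨i.const_mul _, ?_⟩
      rw [integral_const_mul, e, ← Polynomial.C_mul_X_pow_eq_monomial,
        ← Polynomial.C_mul_X_pow_eq_monomial, polyVec_C_mul, polyVec_C_mul, Submodule.coe_smul,
        Submodule.coe_smul, inner_smul_left, inner_smul_right]
      ring

/-- The energy of a function on the half-line in the Kirillov model. -/
noncomputable def kirillovEnergy (k : ℤ) (Q : ℝ → ℂ) : ENNReal :=
  ∫⁻ x in Set.Ioi (0 : ℝ), ENNReal.ofReal (x ^ (k.natAbs - 1) * Real.exp (-(4 * Real.pi * x))) *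
    ‖Q x‖ₑ ^ 2

theorem kirillovEnergy_polynomial (q : Polynomial ℂ) :
    kirillovEnergy k (fun x => q.eval (specVar x))
      = ENNReal.ofReal (isoConst k * ‖(polyVec (k := k) q : DiscSeries k)‖ ^ 2) := by
  obtain ⟨i, e⟩ := integral_polynomial (k := k) q q
  have h : ∀ x : ℝ, ((x ^ (k.natAbs - 1) * Real.exp (-(4 * Real.pi * x)) : ℝ) : ℂ) *
      (conj (q.eval (specVar x)) * q.eval (specVar x))
      = ((x ^ (k.natAbs - 1) * Real.exp (-(4 * Real.pi * x)) * ‖q.eval (specVar x)‖ ^ 2 : ℝ) : ℂ) := by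
    intro x
    rw [Complex.conj_mul']
    push_cast
    ring
  simp only [h] at i e
  rw [integral_complex_ofReal, inner_self_eq_norm_sq_to_K] at e
  have e2 : ∫ x in Set.Ioi (0 : ℝ), x ^ (k.natAbs - 1) * Real.exp (-(4 * Real.pi * x)) *
      ‖q.eval (specVar x)‖ ^ 2 = isoConst k * ‖(polyVec (k := k) q : DiscSeries k)‖ ^ 2 := by
    simp only [Complex.coe_algebraMap] at e
    exact_mod_cast e
  rw [← e2, ofReal_integral_eq_lintegral_ofReal]
  · unfold kirillovEnergy
    refine setLIntegral_congr_fun measurableSet_Ioi fun x hx => ?_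
    have hx0 : (0 : ℝ) < x := hx
    change _ = ENNReal.ofReal (x ^ (k.natAbs - 1) * Real.exp (-(4 * Real.pi * x)) * _)
    rw [ENNReal.ofReal_mul (p := x ^ (k.natAbs - 1) * Real.exp (-(4 * Real.pi * x))) (by positivity),
      ENNReal.ofReal_pow (norm_nonneg _), ofReal_norm]
  · have := i.re
    simpa only [RCLike.re_to_complex, Complex.ofReal_re] using this
  · filter_upwards [ae_restrict_mem measurableSet_Ioi] with x hx
    have hx0 : (0 : ℝ) < x := hx
    change (0 : ℝ) ≤ _
    positivity

/-- The expansion of a vector in the Kirillov model. -/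
noncomputable def kirillov (u : smoothVectors k) (x : ℝ) : ℂ :=
  ∑' j, typeCoeff (u : DiscSeries k) j * (typePoly k j).eval (specVar x)

/-- The summability hypothesis keeps `tsum` from its default value `0`; it is supplied later by any
nonzero mode, through `IsWhittaker.summable_kirillov`. -/
theorem measurable_kirillov (u : smoothVectors k)
    (hs : ∀ x, 0 < x → Summable fun j => typeCoeff (u : DiscSeries k) j *
      (typePoly k j).eval (specVar x)) :
    Measurable (Set.indicator (Set.Ioi 0) (kirillov u)) := by
  refine measurable_of_tendsto_metrizable (f := fun N : ℕ => Set.indicator (Set.Ioi 0) fun x : ℝ =>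
    ∑ j ∈ Finset.range N, typeCoeff (u : DiscSeries k) j * (typePoly k j).eval (specVar x)) ?_ ?_
  · intro N
    refine Measurable.indicator (Continuous.measurable ?_) measurableSet_Ioi
    refine continuous_finsetSum _ fun j _ => continuous_const.mul ?_
    exact (Polynomial.continuous _).comp (by unfold specVar; fun_prop)
  · rw [tendsto_pi_nhds]
    intro x
    by_cases hx : x ∈ Set.Ioi (0 : ℝ)
    · simp only [Set.indicator_of_mem hx]
      exact (hs x hx).hasSum.tendsto_sum_nat
    · simp only [Set.indicator_of_notMem hx]
      exact tendsto_const_nhds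

/-- Fatou's lemma applied to the partial sums of the K-type expansion, for which equality holds.
Subtracting a free polynomial `q` makes this one inequality serve for both the norm bound and
injectivity. -/
theorem kirillovEnergy_sub_le (u : smoothVectors k)
    (hs : ∀ x, 0 < x → Summable fun j => typeCoeff (u : DiscSeries k) j *
      (typePoly k j).eval (specVar x)) (q : Polynomial ℂ) :
    kirillovEnergy k (fun x => kirillov u x - q.eval (specVar x))
      ≤ ENNReal.ofReal (isoConst k * ‖(u : DiscSeries k) - (polyVec (k := k) q : DiscSeries k)‖ ^ 2) := by
  let P : ℕ → Polynomial ℂ := fun N => ∑ j ∈ Finset.range N,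
    Polynomial.C (typeCoeff (u : DiscSeries k) j) * typePoly k j
  have hP : ∀ N, (polyVec (k := k) (P N) : DiscSeries k) = ∑ j ∈ Finset.range N,
      typeCoeff (u : DiscSeries k) j • (typeVec (k := k) j : DiscSeries k) := fun N => by
    simp only [P, polyVec_sum, polyVec_C_mul]
    rw [Submodule.coe_sum]
    rfl
  have h1 : ∀ x ∈ Set.Ioi (0 : ℝ), Filter.Tendsto (fun N =>
      ENNReal.ofReal (x ^ (k.natAbs - 1) * Real.exp (-(4 * Real.pi * x))) *
        ‖(P N - q).eval (specVar x)‖ₑ ^ 2) Filter.atTop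
      (nhds (ENNReal.ofReal (x ^ (k.natAbs - 1) * Real.exp (-(4 * Real.pi * x))) *
        ‖kirillov u x - q.eval (specVar x)‖ₑ ^ 2)) := by
    intro x hx
    refine ENNReal.Tendsto.const_mul ?_ (Or.inr ENNReal.ofReal_ne_top)
    refine (ENNReal.continuous_pow 2).continuousAt.tendsto.comp ((continuous_enorm.tendsto _).comp ?_)
    simp only [Polynomial.eval_sub]
    refine Filter.Tendsto.sub_const ?_ _
    have := (hs x hx).hasSum.tendsto_sum_nat
    simpa [P, Polynomial.eval_finsetSum, kirillov] using this
  have h2 : Filter.Tendsto (fun N => kirillovEnergy k fun x => (P N - q).eval (specVar x))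
      Filter.atTop (nhds (ENNReal.ofReal (isoConst k * ‖(u : DiscSeries k) - (polyVec (k := k) q : DiscSeries k)‖ ^ 2))) := by
    simp only [kirillovEnergy_polynomial, polyVec_sub, Submodule.coe_sub, hP]
    refine ENNReal.tendsto_ofReal (Filter.Tendsto.const_mul _ (Filter.Tendsto.pow ?_ _))
    exact ((hasSum_typeCoeff_smul u).tendsto_sum_nat.sub_const _).norm
  calc kirillovEnergy k (fun x => kirillov u x - q.eval (specVar x))
      = ∫⁻ x in Set.Ioi (0 : ℝ), Filter.liminf (fun N =>
        ENNReal.ofReal (x ^ (k.natAbs - 1) * Real.exp (-(4 * Real.pi * x))) *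
        ‖(P N - q).eval (specVar x)‖ₑ ^ 2) Filter.atTop :=
        setLIntegral_congr_fun measurableSet_Ioi fun x hx => (h1 x hx).liminf_eq.symm
    _ ≤ Filter.liminf (fun N => kirillovEnergy k fun x => (P N - q).eval (specVar x))
        Filter.atTop := by
        refine lintegral_liminf_le fun N => ?_
        refine Measurable.mul (by fun_prop) (Measurable.pow_const (Measurable.enorm ?_) _)
        refine Continuous.measurable ((Polynomial.continuous _).comp (by unfold specVar; fun_prop))
    _ = _ := h2.liminf_eq

theorem kirillovEnergy_le (u : smoothVectors k)
    (hs : ∀ x, 0 < x → Summable fun j => typeCoeff (u : DiscSeries k) j *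
      (typePoly k j).eval (specVar x)) :
    kirillovEnergy k (kirillov u) ≤ ENNReal.ofReal (isoConst k * ‖(u : DiscSeries k)‖ ^ 2) := by
  have h := kirillovEnergy_sub_le u hs 0
  have h0 : polyVec (k := k) 0 = 0 := by simp [polyVec]
  simpa [h0] using h

/-- If the Kirillov function vanishes, the preceding inequality reads `‖q‖ ≤ ‖u - q‖` for every
polynomial vector `q`. Letting `q` run through the partial sums converging to `u` gives `‖u‖ ≤ 0`.
-/
theorem eq_zero_of_kirillov_ae_eq_zero (u : smoothVectors k)
    (hs : ∀ x, 0 < x → Summable fun j => typeCoeff (u : DiscSeries k) j *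
      (typePoly k j).eval (specVar x))
    (h0 : ∀ᵐ x ∂volume.restrict (Set.Ioi (0 : ℝ)), kirillov u x = 0) : u = 0 := by
  have h1 : ∀ q : Polynomial ℂ, ‖(polyVec (k := k) q : DiscSeries k)‖
      ≤ ‖(u : DiscSeries k) - (polyVec (k := k) q : DiscSeries k)‖ := by
    intro q
    have h := kirillovEnergy_sub_le u hs q
    have h2 : kirillovEnergy k (fun x => kirillov u x - q.eval (specVar x))
        = kirillovEnergy k (fun x => q.eval (specVar x)) := by
      refine lintegral_congr_ae ?_
      filter_upwards [h0] with x hx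
      rw [hx, zero_sub, enorm_neg]
    rw [h2, kirillovEnergy_polynomial, ENNReal.ofReal_le_ofReal_iff
      (mul_nonneg isoConst_pos.le (sq_nonneg _))] at h
    exact (sq_le_sq₀ (norm_nonneg _) (norm_nonneg _)).mp (le_of_mul_le_mul_left h isoConst_pos)
  have h2 := (hasSum_typeCoeff_smul u).tendsto_sum_nat
  have h3 : Filter.Tendsto (fun N => (u : DiscSeries k) - ∑ j ∈ Finset.range N,
      typeCoeff (u : DiscSeries k) j • (typeVec (k := k) j : DiscSeries k)) Filter.atTop
      (nhds ((u : DiscSeries k) - u)) := h2.const_sub _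
  have h4 : ‖(u : DiscSeries k)‖ ≤ ‖(u : DiscSeries k) - u‖ := by
    refine le_of_tendsto_of_tendsto' h2.norm h3.norm fun N => ?_
    have h := h1 (∑ j ∈ Finset.range N,
      Polynomial.C (typeCoeff (u : DiscSeries k) j) * typePoly k j)
    simp only [polyVec_sum, polyVec_C_mul] at h
    rw [Submodule.coe_sum] at h
    exact h
  rw [sub_self, norm_zero, norm_le_zero_iff] at h4
  exact Subtype.ext h4

end DiscSeries

/-! ### Relations between `A` and `N`, and exponential against polynomial growth -/

theorem unipN_neg (s : ℝ) : unipN (-s) = (unipN s)⁻¹ := oneParam_neg 2 s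

theorem diagA_exp_neg (s : ℝ) : diagA (Real.exp (-s)) = (diagA (Real.exp s))⁻¹ := oneParam_neg 1 s

theorem diagA_inv_mul_unipN {a : ℝ} (ha : a ≠ 0) (s : ℝ) :
    (diagA a)⁻¹ * unipN s = unipN (s / a ^ 2) * (diagA a)⁻¹ := by
  refine Subtype.ext ?_
  rw [Matrix.SpecialLinearGroup.coe_mul, Matrix.SpecialLinearGroup.coe_mul, inv_coe, diagA_coe ha,
    unipN_coe, unipN_coe]
  ext i j
  fin_cases i <;> fin_cases j <;> simp [Matrix.mul_apply, Fin.sum_univ_two]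
  field_simp

/-- Exponential growth beats polynomial growth. -/
theorem eq_zero_of_exp_le_pow {c C b : ℝ} (hb : 0 < b) (hc : 0 ≤ c) (N : ℕ)
    (h : ∀ y : ℝ, 1 ≤ y → c * Real.exp (b * y) ≤ C * y ^ N) : c = 0 := by
  have h1 := (Real.tendsto_pow_mul_exp_neg_atTop_nhds_zero N).comp
    (Filter.tendsto_id.const_mul_atTop hb)
  have h2 := h1.const_mul (C * (b⁻¹) ^ N)
  rw [mul_zero] at h2
  refine le_antisymm (ge_of_tendsto h2 ?_) hc
  filter_upwards [Filter.eventually_ge_atTop 1] with y hy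
  have h3 := h y hy
  have h4 : c = c * Real.exp (b * y) * Real.exp (-(b * y)) := by
    rw [mul_assoc, ← Real.exp_add]; simp
  rw [h4]
  refine (mul_le_mul_of_nonneg_right h3 (Real.exp_pos _).le).trans_eq ?_
  simp only [Function.comp_apply, id]
  rw [mul_pow]
  have h5 : b⁻¹ ^ N * b ^ N = 1 := by rw [← mul_pow, inv_mul_cancel₀ hb.ne', one_pow]
  linear_combination (-(C * y ^ N * Real.exp (-(b * y)))) * h5

namespace DiscSeries

variable {k : ℤ} [hk : Fact (2 ≤ k)]

/-! ### Whittaker functionals -/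

/-- Continuous functionals transforming under `N` by the character of frequency `ξ`. -/
structure IsWhittaker (l : smoothVectors k →ₗ[ℂ] ℂ) (ξ : ℝ) : Prop where
  dist : IsDist l
  eq : ∀ s u, l (smoothRep k (unipN s) u) = Complex.exp (specVar ξ * s) * l u

variable {l : smoothVectors k →ₗ[ℂ] ℂ} {ξ : ℝ}

theorem IsWhittaker.lieS_two (h : IsWhittaker l ξ) (u : smoothVectors k) :
    l (lieS 2 u) = specVar ξ * l u := by
  have h1 := h.dist.hasDerivAt_orbit 2 u 0
  have h2 : HasDerivAt (fun s : ℝ => Complex.exp (specVar ξ * s) * l u) (specVar ξ * l u) 0 := by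
    have := (((hasDerivAt_id (0 : ℝ)).ofReal_comp.const_mul (specVar ξ)).cexp).mul_const (l u)
    simpa using this
  rw [oneParam_zero, smoothRep_one] at h1
  exact h1.unique (h2.congr_of_eventuallyEq (Filter.Eventually.of_forall fun s => h.eq s u))

theorem IsWhittaker.polyVec (h : IsWhittaker l ξ) (q : Polynomial ℂ) :
    l (polyVec q) = q.eval (specVar ξ) * l lowS := by
  have h1 : ∀ n : ℕ, l ((lieS 2 ^ n) lowS) = specVar ξ ^ n * l lowS := fun n => by
    induction n with
    | zero => simp
    | succ n ih => rw [pow_succ', Module.End.mul_apply, h.lieS_two, ih]; ring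
  induction q using Polynomial.induction_on' with
  | add p q hp hq => rw [polyVec_add, map_add, hp, hq, Polynomial.eval_add]; ring
  | monomial n c =>
    rw [← Polynomial.C_mul_X_pow_eq_monomial, polyVec_C_mul, polyVec_X_pow, map_smul, h1]
    simp
    ring

theorem IsWhittaker.hasSum (h : IsWhittaker l ξ) (u : smoothVectors k) :
    HasSum (fun j => l lowS * (typeCoeff (u : DiscSeries k) j * (typePoly k j).eval (specVar ξ)))
      (l u) := by
  refine (h.dist.hasSum_typeCoeff u).congr_terms fun j => ?_
  rw [typeVec, h.polyVec]
  ring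

/-- Uniqueness of Whittaker functionals: since K-types are polynomials in the generator of `N`
applied to `lowS`, only the scalar `l lowS` is free. -/
theorem IsWhittaker.apply_eq (h : IsWhittaker l ξ) (u : smoothVectors k) :
    l u = l lowS * kirillov u ξ := by
  rw [kirillov, ← tsum_mul_left]
  exact (h.hasSum u).tsum_eq.symm

theorem IsWhittaker.summable (h : IsWhittaker l ξ) (h0 : l lowS ≠ 0) (u : smoothVectors k) :
    Summable fun j => typeCoeff (u : DiscSeries k) j * (typePoly k j).eval (specVar ξ) :=
  (summable_mul_left_iff h0).mp (h.hasSum u).summable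

/-- `A` normalises `N`, so twisting by it rescales the frequency; all positive frequencies are
thereby linked. -/
theorem IsWhittaker.comp_diagA (h : IsWhittaker l ξ) {a : ℝ} (ha : a ≠ 0) :
    IsWhittaker (l ∘ₗ smoothRep k (diagA a)⁻¹) (ξ / a ^ 2) := by
  refine ⟨h.dist.comp_smoothRep _, fun s u => ?_⟩
  rw [LinearMap.comp_apply, ← smoothRep_mul, diagA_inv_mul_unipN ha, smoothRep_mul, h.eq,
    LinearMap.comp_apply]
  congr 2
  rw [specVar, specVar]
  push_cast
  ring

theorem IsWhittaker.comp_diagA_exp (h : IsWhittaker l ξ) (s : ℝ) :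
    IsWhittaker (l ∘ₗ smoothRep k (diagA (Real.exp s))) (ξ * Real.exp (2 * s)) := by
  have h1 := h.comp_diagA (Real.exp_pos (-s)).ne'
  have h2 : ξ / Real.exp (-s) ^ 2 = ξ * Real.exp (2 * s) := by
    rw [← Real.exp_nat_mul, div_eq_mul_inv, ← Real.exp_neg]
    congr 2
    push_cast
    ring
  rwa [h2, diagA_exp_neg, inv_inv] at h1

/-- Along `A` the value `g` satisfies `g' = (K - 4πξ e^{2s}) g`: use `lieS_one_lowS` and the
eigenvalue at the rescaled frequency. The integrating factor `e^{-E}` shows that `g e^{-E}` is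
constant. -/
theorem IsWhittaker.apply_diagA_exp_lowS (h : IsWhittaker l ξ) (s : ℝ) :
    l (smoothRep k (diagA (Real.exp s)) lowS) = l lowS *
      ((Real.exp (k.natAbs * s - 2 * Real.pi * ξ * (Real.exp (2 * s) - 1)) : ℝ) : ℂ) := by
  let g : ℝ → ℂ := fun s => l (smoothRep k (oneParam 1 s) lowS)
  let E : ℝ → ℝ := fun s => k.natAbs * s - 2 * Real.pi * ξ * (Real.exp (2 * s) - 1)
  have hg : ∀ s, HasDerivAt g (((k.natAbs - 4 * Real.pi * ξ * Real.exp (2 * s) : ℝ) : ℂ) * g s) s := by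
    intro s
    refine (h.dist.hasDerivAt_orbit 1 lowS s).congr_deriv ?_
    have h1 := (h.comp_diagA_exp s).lieS_two lowS
    rw [LinearMap.comp_apply, LinearMap.comp_apply] at h1
    have h2 : oneParam 1 s = diagA (Real.exp s) := rfl
    rw [lieS_one_lowS, map_sub, map_sub, map_smul, map_smul, map_smul, map_smul, h2, h1]
    simp only [g, h2, specVar, smul_eq_mul]
    push_cast
    linear_combination (4 * Real.pi * ξ * Complex.exp (2 * s) *
      l (smoothRep k (diagA (Real.exp s)) lowS)) * Complex.I_sq
  have hE : ∀ s, HasDerivAt E (k.natAbs - 4 * Real.pi * ξ * Real.exp (2 * s)) s := by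
    intro s
    have h1 : HasDerivAt (fun s : ℝ => Real.exp (2 * s)) (Real.exp (2 * s) * (2 * 1)) s :=
      ((hasDerivAt_id s).const_mul 2).exp
    have h2 := ((hasDerivAt_id s).const_mul (k.natAbs : ℝ)).sub
      ((h1.sub_const 1).const_mul (2 * Real.pi * ξ))
    refine h2.congr_deriv ?_
    ring
  have hF : ∀ s, HasDerivAt (fun s => g s * ((Real.exp (-E s) : ℝ) : ℂ)) 0 s := by
    intro s
    refine ((hg s).mul (hE s).neg.exp.ofReal_comp).congr_deriv ?_
    push_cast
    ring
  have hconst := is_const_of_deriv_eq_zero (fun s => (hF s).differentiableAt)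
    (fun s => (hF s).deriv) s 0
  have hE0 : E 0 = 0 := by simp [E]
  have hg0 : g 0 = l lowS := by simp [g]
  rw [hE0, hg0, neg_zero, Real.exp_zero, Complex.ofReal_one, mul_one] at hconst
  change g s = l lowS * ((Real.exp (E s) : ℝ) : ℂ)
  rw [← hconst, mul_assoc, ← Complex.ofReal_mul, ← Real.exp_add]
  simp

theorem IsWhittaker.norm_apply_sq (h : IsWhittaker l ξ) {a : ℝ} (ha : 0 < a) (u : smoothVectors k) :
    ‖l (smoothRep k (diagA a)⁻¹ u)‖ ^ 2
      = ‖l lowS‖ ^ 2 * Real.exp (4 * Real.pi * ξ) * ((1 / a ^ 2) ^ k.natAbs *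
        Real.exp (-(4 * Real.pi * (ξ / a ^ 2))) * ‖kirillov u (ξ / a ^ 2)‖ ^ 2) := by
  have h1 := (h.comp_diagA ha.ne').apply_eq u
  obtain ⟨s, rfl⟩ : ∃ s, a = Real.exp (-s) := ⟨-Real.log a, by rw [neg_neg, Real.exp_log ha]⟩
  rw [LinearMap.comp_apply, LinearMap.comp_apply] at h1
  rw [h1, norm_mul, mul_pow]
  rw [← diagA_exp_neg, neg_neg, h.apply_diagA_exp_lowS, norm_mul, Complex.norm_real, Real.norm_eq_abs,
    Real.abs_exp, mul_pow]
  have h2 : 1 / Real.exp (-s) ^ 2 = Real.exp (2 * s) := by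
    rw [← Real.exp_nat_mul, one_div, ← Real.exp_neg]
    congr 1
    push_cast
    ring
  rw [div_eq_mul_one_div ξ, h2, ← Real.exp_nat_mul, ← Real.exp_nat_mul]
  have h3 : Real.exp ((2 : ℕ) * (k.natAbs * s - 2 * Real.pi * ξ * (Real.exp (2 * s) - 1)))
      = Real.exp (4 * Real.pi * ξ) * (Real.exp (k.natAbs * (2 * s)) *
        Real.exp (-(4 * Real.pi * (ξ * Real.exp (2 * s))))) := by
    rw [← Real.exp_add, ← Real.exp_add]
    congr 1
    push_cast
    ring
  rw [h3]
  ring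

theorem abs_adCoeff_diagA_exp_le {s : ℝ} (hs : 0 ≤ s) (i j : Fin 3) :
    |adCoeff (diagA (Real.exp s)) i j| ≤ 2 * Real.exp (2 * s) := by
  have h1 : (1 : ℝ) ≤ Real.exp (2 * s) := Real.one_le_exp (by positivity)
  have h2 : Real.exp s ^ 2 = Real.exp (2 * s) := by
    rw [← Real.exp_nat_mul]; push_cast; rfl
  have h3 : (Real.exp s)⁻¹ ^ 2 ≤ 1 := by
    rw [inv_pow, h2]; exact inv_le_one_of_one_le₀ h1
  have h4 : 0 ≤ (Real.exp s)⁻¹ ^ 2 := by positivity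
  have h5 : Real.exp s * (Real.exp s)⁻¹ = 1 := mul_inv_cancel₀ (Real.exp_pos s).ne'
  rw [adCoeff_apply, diagA_coe (Real.exp_pos s).ne']
  fin_cases i <;> fin_cases j <;> simp [-inv_pow, h2] <;>
    first
    | linarith
    | (rw [abs_le]; constructor <;> linarith)

/-- For `ξ < 0` the value on `a · lowS` grows like an exponential of `y = e^{2s}`, while moderate
growth allows only a power of `y`. So `l lowS = 0`, and this scalar determines `l`. -/
theorem IsWhittaker.eq_zero_of_neg (h : IsWhittaker l ξ) (hξ : ξ < 0) : l = 0 := by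
  obtain ⟨S, C, N, hC, hgr⟩ := h.dist.exists_growth
  have h0 : l lowS = 0 := by
    rw [← norm_eq_zero]
    have hc : ‖l lowS‖ * Real.exp (2 * Real.pi * ξ) = 0 := by
      refine eq_zero_of_exp_le_pow (b := -(2 * Real.pi * ξ))
        (C := C * 2 ^ N * ∑ w ∈ S, ‖(wordS w (lowS (k := k)) : DiscSeries k)‖)
        (by nlinarith [Real.pi_pos]) (by positivity) N fun y hy => ?_
      have hs : 0 ≤ Real.log y / 2 := div_nonneg (Real.log_nonneg hy) two_pos.le
      have hy' : Real.exp (2 * (Real.log y / 2)) = y := by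
        rw [mul_div_cancel₀ _ two_ne_zero, Real.exp_log (by linarith)]
      have h1 := hgr (diagA (Real.exp (Real.log y / 2))) lowS (2 * y) (by linarith) (by
        simpa only [hy'] using abs_adCoeff_diagA_exp_le hs)
      rw [h.apply_diagA_exp_lowS, norm_mul, Complex.norm_real, Real.norm_eq_abs, Real.abs_exp,
        hy'] at h1
      calc ‖l lowS‖ * Real.exp (2 * Real.pi * ξ) * Real.exp (-(2 * Real.pi * ξ) * y)
          = ‖l lowS‖ * Real.exp (-(2 * Real.pi * ξ * (y - 1))) := by
            rw [mul_assoc, ← Real.exp_add]; congr 2; ring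
        _ ≤ ‖l lowS‖ * Real.exp (k.natAbs * (Real.log y / 2) - 2 * Real.pi * ξ * (y - 1)) := by
            gcongr
            have : 0 ≤ (k.natAbs : ℝ) * (Real.log y / 2) := by positivity
            linarith
        _ ≤ _ := h1
        _ = _ := by rw [mul_pow]; ring
    exact (mul_eq_zero.mp hc).resolve_right (Real.exp_pos _).ne'
  refine LinearMap.ext fun u => ?_
  rw [h.apply_eq, h0, zero_mul, LinearMap.zero_apply]

/-! ### Fourier modes of a periodic functional -/

theorem IsDist.continuous_unipN_orbit (hl : IsDist l) (u : smoothVectors k) :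
    Continuous fun t => l (smoothRep k (unipN (-t)) u) :=
  hl.continuous_orbit ((strongCont_oneParam (k := k) 2).comp continuous_neg) u

/-- The Fourier coefficient of order `m` along `N`. -/
noncomputable def fourierMode (hl : IsDist l) (p : ℝ) (m : ℤ) : smoothVectors k →ₗ[ℂ] ℂ where
  toFun u := (p : ℂ)⁻¹ * ∫ t in (0 : ℝ)..p,
    Complex.exp (specVar (m / p) * t) * l (smoothRep k (unipN (-t)) u)
  map_add' u v := by
    have hi : ∀ u, IntervalIntegrable (fun t : ℝ => Complex.exp (specVar (m / p) * t) *
        l (smoothRep k (unipN (-t)) u)) volume 0 p := fun u =>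
      (Continuous.mul (by fun_prop) (hl.continuous_unipN_orbit u)).intervalIntegrable _ _
    simp only [map_add, mul_add]
    rw [intervalIntegral.integral_add (hi u) (hi v), mul_add]
  map_smul' c u := by
    simp only [map_smul, smul_eq_mul, RingHom.id_apply, mul_left_comm _ c]
    rw [intervalIntegral.integral_const_mul]
    ring

/-- The adjoint coefficients are bounded over one period, so the growth bound holds uniformly under
the integral. -/
theorem isDist_fourierMode (hl : IsDist l) {p : ℝ} (hp : 0 < p) (m : ℤ) :
    IsDist (fourierMode hl p m) := by
  obtain ⟨S, C, N, hC, hgr⟩ := hl.exists_growth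
  have hb : ∀ i j, ∃ M, ∀ t ∈ Set.Icc (0 : ℝ) p, ‖adCoeff (unipN (-t)) i j‖ ≤ M := fun i j =>
    isCompact_Icc.exists_bound_of_continuousOn
      (((strongCont_oneParam (k := k) 2).comp continuous_neg).adCoeff i j).continuousOn
  choose M hM using hb
  let M₀ : ℝ := 1 + ∑ i, ∑ j, |M i j|
  have hM₀ : ∀ t ∈ Set.Icc (0 : ℝ) p, ∀ i j, |adCoeff (unipN (-t)) i j| ≤ M₀ := by
    intro t ht i j
    have h1 : |M i j| ≤ ∑ j, |M i j| :=
      Finset.single_le_sum (f := fun j => |M i j|) (fun _ _ => abs_nonneg _) (Finset.mem_univ j)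
    have h2 : ∑ j, |M i j| ≤ ∑ i, ∑ j, |M i j| :=
      Finset.single_le_sum (f := fun i => ∑ j, |M i j|)
        (fun _ _ => Finset.sum_nonneg fun _ _ => abs_nonneg _) (Finset.mem_univ i)
    have h3 := (hM i j t ht).trans (le_abs_self _)
    rw [Real.norm_eq_abs] at h3
    simp only [M₀]
    linarith
  refine ⟨S, C * M₀ ^ N, fun u => ?_⟩
  have h1 := intervalIntegral.norm_integral_le_of_norm_le_const (a := 0) (b := p)
    (f := fun t : ℝ => Complex.exp (specVar (m / p) * t) * l (smoothRep k (unipN (-t)) u))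
    (C := C * M₀ ^ N * ∑ w ∈ S, ‖(wordS w u : DiscSeries k)‖) fun t ht => by
      rw [Set.uIoc_of_le hp.le] at ht
      have e1 : ‖Complex.exp (specVar (m / p) * t)‖ = 1 := by
        rw [Complex.norm_exp, specVar]; simp
      rw [norm_mul, e1, one_mul]
      refine hgr _ u M₀ ?_ (hM₀ t ⟨ht.1.le, ht.2⟩)
      exact le_add_of_nonneg_right (Finset.sum_nonneg fun _ _ => Finset.sum_nonneg fun _ _ =>
        abs_nonneg _)
  rw [sub_zero, abs_of_pos hp] at h1
  change ‖(p : ℂ)⁻¹ * _‖ ≤ _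
  rw [norm_mul, norm_inv, Complex.norm_real, Real.norm_of_nonneg hp.le, inv_mul_le_iff₀ hp, mul_comm p]
  exact h1

/-- Translate the integration variable; frequency `m / p` makes the integrand `p`-periodic, so the
shifted interval gives the same integral. -/
theorem isWhittaker_fourierMode (hl : IsDist l) {p : ℝ} (hp : 0 < p)
    (hper : ∀ u, l (smoothRep k (unipN (-p)) u) = l u) (m : ℤ) :
    IsWhittaker (fourierMode hl p m) (m / p) := by
  refine ⟨isDist_fourierMode hl hp m, fun s u => ?_⟩
  change (p : ℂ)⁻¹ * _ = _ * ((p : ℂ)⁻¹ * _)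
  rw [mul_left_comm]
  congr 1
  let F : ℝ → ℂ := fun t => Complex.exp (specVar (m / p) * t) * l (smoothRep k (unipN (-t)) u)
  have hF : Function.Periodic F p := fun t => by
    have e1 : unipN (-(t + p)) = unipN (-p) * unipN (-t) := by
      rw [← unipN_add]; congr 1; ring
    simp only [F]
    rw [e1, smoothRep_mul, hper]
    congr 1
    have e2 : specVar (m / p) * ((t + p : ℝ) : ℂ) = specVar (m / p) * t + ((-m : ℤ) : ℂ) *
        (2 * Real.pi * Complex.I) := by
      have : (p : ℂ) ≠ 0 := by exact_mod_cast hp.ne'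
      rw [specVar]
      push_cast
      field_simp
      ring
    rw [e2, Complex.exp_add, Complex.exp_int_mul_two_pi_mul_I, mul_one]
  have h1 : ∀ t : ℝ, Complex.exp (specVar (m / p) * t) *
      l (smoothRep k (unipN (-t)) (smoothRep k (unipN s) u))
      = Complex.exp (specVar (m / p) * s) * F (t - s) := fun t => by
    simp only [F]
    rw [← smoothRep_mul, ← unipN_add, ← mul_assoc, ← Complex.exp_add]
    congr 2
    · push_cast; ring
    · rw [show -t + s = -(t - s) by ring]
  simp only [h1]
  rw [intervalIntegral.integral_const_mul, intervalIntegral.integral_comp_sub_right]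
  congr 1
  have h2 := hF.intervalIntegral_add_eq (0 - s) 0
  rw [zero_add, show 0 - s + p = p - s by ring] at h2
  exact h2

/-- Parseval's identity on one period. -/
theorem lintegral_unipN_orbit (hl : IsDist l) {p : ℝ} (hp : 0 < p) (u : smoothVectors k) :
    ∫⁻ t in Set.Ioc 0 p, ‖l (smoothRep k (unipN (-t)) u)‖ₑ ^ 2
      = ENNReal.ofReal p * ∑' m : ℤ, ‖fourierMode hl p m u‖ₑ ^ 2 := by
  have hc := hl.continuous_unipN_orbit u
  have hL : MemLp (fun t => l (smoothRep k (unipN (-t)) u)) 2 (volume.restrict (Set.Ioc 0 p)) := by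
    obtain ⟨C, hC⟩ := (isCompact_Icc (a := (0 : ℝ)) (b := p)).exists_bound_of_continuousOn
      hc.continuousOn
    refine MemLp.of_bound hc.aestronglyMeasurable C ?_
    filter_upwards [ae_restrict_mem measurableSet_Ioc] with t ht
    exact hC t ⟨ht.1.le, ht.2⟩
  have h := hasSum_sq_fourierCoeffOn hp hL
  have h1 : ∀ m : ℤ, fourierCoeffOn hp (fun t => l (smoothRep k (unipN (-t)) u)) m
      = fourierMode hl p m u := fun m => by
    rw [fourierCoeffOn_eq_integral]
    change _ = (p : ℂ)⁻¹ * _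
    rw [sub_zero, Complex.real_smul]
    push_cast
    rw [one_div]
    congr 1
    refine intervalIntegral.integral_congr fun t _ => ?_
    simp only [smul_eq_mul, fourier_coe_apply, specVar]
    congr 2
    push_cast
    field_simp
  simp only [h1, sub_zero, smul_eq_mul] at h
  have h2 : ∫⁻ t in Set.Ioc 0 p, ‖l (smoothRep k (unipN (-t)) u)‖ₑ ^ 2
      = ENNReal.ofReal (∫ t in (0 : ℝ)..p, ‖l (smoothRep k (unipN (-t)) u)‖ ^ 2) := by
    rw [intervalIntegral.integral_of_le hp.le, ofReal_integral_eq_lintegral_ofReal]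
    · refine lintegral_congr fun t => ?_
      rw [ENNReal.ofReal_pow (norm_nonneg _), ofReal_norm]
    · have := (hc.norm.pow 2).intervalIntegrable (μ := volume) 0 p
      rwa [intervalIntegrable_iff_integrableOn_Ioc_of_le hp.le] at this
    · exact Filter.Eventually.of_forall fun t => sq_nonneg _
  have h3 : ∫ t in (0 : ℝ)..p, ‖l (smoothRep k (unipN (-t)) u)‖ ^ 2
      = p * ∑' m : ℤ, ‖fourierMode hl p m u‖ ^ 2 := by
    rw [h.tsum_eq]; field_simp
  rw [h2, h3, ENNReal.ofReal_mul hp.le, ENNReal.ofReal_tsum_of_nonneg (fun _ => sq_nonneg _) h.summable]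
  congr 2
  funext m
  rw [ENNReal.ofReal_pow (norm_nonneg _), ofReal_norm]

end DiscSeries

/-! ### Summation by integration against a power -/

theorem lintegral_rpow_div_self {ε : ℝ} (hε : 0 < ε) {a₁ : ℝ} (ha : 0 < a₁) :
    ∫⁻ a in Set.Ioc 0 a₁, ENNReal.ofReal (a ^ ε / a) = ENNReal.ofReal (a₁ ^ ε / ε) := by
  have h1 : ∫ a in (0 : ℝ)..a₁, a ^ (ε - 1) = a₁ ^ ε / ε := by
    rw [integral_rpow (Or.inl (by linarith)), sub_add_cancel, Real.zero_rpow hε.ne', sub_zero]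
  have h2 : IntervalIntegrable (fun a : ℝ => a ^ (ε - 1)) volume 0 a₁ :=
    intervalIntegral.intervalIntegrable_rpow' (by linarith)
  rw [intervalIntegrable_iff_integrableOn_Ioc_of_le ha.le] at h2
  rw [intervalIntegral.integral_of_le ha.le] at h1
  rw [← h1, ofReal_integral_eq_lintegral_ofReal h2]
  · refine setLIntegral_congr_fun measurableSet_Ioc fun a ha => ?_
    rw [Real.rpow_sub_one ha.1.ne']
  · filter_upwards [ae_restrict_mem measurableSet_Ioc] with a ha
    exact Real.rpow_nonneg ha.1.le _

theorem image_div_sq_Ioc {ξ a₁ : ℝ} (hξ : 0 < ξ) (ha : 0 < a₁) :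
    (fun a : ℝ => ξ / a ^ 2) '' Set.Ioc 0 a₁ = Set.Ici (ξ / a₁ ^ 2) := by
  ext x
  constructor
  · rintro ⟨a, ⟨h0, h1⟩, rfl⟩
    change ξ / a₁ ^ 2 ≤ ξ / a ^ 2
    gcongr
  · intro hx
    have hx0 : 0 < x := lt_of_lt_of_le (by positivity) hx
    refine ⟨Real.sqrt (ξ / x), ⟨by positivity, ?_⟩, ?_⟩
    · rw [Real.sqrt_le_left ha.le, div_le_iff₀ hx0]
      have : ξ / a₁ ^ 2 ≤ x := hx
      rwa [div_le_iff₀ (by positivity), mul_comm] at this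
    · simp only
      rw [Real.sq_sqrt (by positivity)]
      field_simp

theorem injOn_div_sq {ξ a₁ : ℝ} (hξ : 0 < ξ) :
    Set.InjOn (fun a : ℝ => ξ / a ^ 2) (Set.Ioc 0 a₁) := by
  intro a ha b hb h
  have h0 := ha.1
  have h1 := hb.1
  have h2 : a ^ 2 = b ^ 2 := by
    simp only at h
    rw [div_eq_div_iff (by positivity) (by positivity)] at h
    exact (mul_left_cancel₀ hξ.ne' h).symm
  exact (pow_left_inj₀ h0.le h1.le two_ne_zero).mp h2

/-- Under `x = ξ / a²` one has `2 a^ε da/a = ξ^{ε/2} x^{-ε/2} dx/x`, up to orientation. The factor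
`2` stays on the left to avoid dividing in `ENNReal`. -/
theorem lintegral_comp_div_sq (H : ℝ → ENNReal) {ξ a₁ ε : ℝ} (hξ : 0 < ξ) (ha : 0 < a₁) :
    2 * ∫⁻ a in Set.Ioc 0 a₁, H (ξ / a ^ 2) * ENNReal.ofReal (a ^ ε / a)
      = ∫⁻ x in Set.Ici (ξ / a₁ ^ 2), H x * ENNReal.ofReal (ξ ^ (ε / 2) * x ^ (-(ε / 2) - 1)) := by
  rw [← image_div_sq_Ioc hξ ha, lintegral_image_eq_lintegral_abs_deriv_mul
    (f' := fun a => -2 * ξ / a ^ 3) measurableSet_Ioc _ (injOn_div_sq hξ),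
    ← lintegral_const_mul' _ _ ENNReal.ofNat_ne_top]
  · refine setLIntegral_congr_fun measurableSet_Ioc fun a ha => ?_
    have h0 : 0 < a := ha.1
    rw [mul_left_comm, mul_left_comm _ (H _)]
    congr 1
    have h2 : (2 : ENNReal) = ENNReal.ofReal 2 := by simp
    rw [h2, ← ENNReal.ofReal_mul two_pos.le, ← ENNReal.ofReal_mul (abs_nonneg _)]
    congr 1
    have h3 : |(-2 * ξ / a ^ 3)| = 2 * ξ / a ^ 3 := by
      rw [neg_mul, neg_div, abs_neg, abs_of_pos (by positivity)]
    have h4 : ξ ^ (ε / 2) * (ξ / a ^ 2) ^ (-(ε / 2) - 1) = a ^ ε * a ^ 2 / ξ := by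
      rw [Real.rpow_sub_one (by positivity), Real.rpow_neg (by positivity),
        Real.div_rpow hξ.le (by positivity), ← Real.rpow_natCast, ← Real.rpow_mul h0.le]
      have h5 : ((2 : ℕ) : ℝ) * (ε / 2) = ε := by push_cast; ring
      rw [h5]
      have := Real.rpow_pos_of_pos hξ (ε / 2)
      have := Real.rpow_pos_of_pos h0 ε
      simp only [Real.rpow_natCast]
      field_simp
    rw [h3, h4]
    field_simp
  · intro a ha
    have h0 : a ≠ 0 := ha.1.ne'
    refine HasDerivAt.hasDerivWithinAt ?_
    refine (((hasDerivAt_pow 2 a).inv (pow_ne_zero 2 h0)).const_mul ξ).congr_deriv ?_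
    field_simp
    push_cast
    ring

/-- Otherwise `H` vanishes almost everywhere on each `[1/(n+1), ∞)`, hence on their union `(0, ∞)`.
-/
theorem exists_lintegral_Ici_ne_zero {H : ℝ → ENNReal} (hH : Measurable H)
    (h0 : ¬ ∀ᵐ x ∂volume.restrict (Set.Ioi (0 : ℝ)), H x = 0) (e : ℝ) :
    ∃ r : ℝ, 0 < r ∧ ∫⁻ x in Set.Ici r, H x * ENNReal.ofReal (x ^ e) ≠ 0 := by
  by_contra! hc
  refine h0 ?_
  have h1 : ∀ n : ℕ, ∀ᵐ x : ℝ, x ∈ Set.Ici (1 / (n + 1 : ℝ)) → H x = 0 := by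
    intro n
    have hn : (0 : ℝ) < 1 / (n + 1) := by positivity
    have h2 := hc _ hn
    rw [lintegral_eq_zero_iff (f := fun x => H x * ENNReal.ofReal (x ^ e)) (by fun_prop), Filter.EventuallyEq,
      ae_restrict_iff' measurableSet_Ici] at h2
    filter_upwards [h2] with x hx hxn
    have hx0 : 0 < x := hn.trans_le hxn
    have h3 := hx hxn
    simp only [Pi.zero_apply, mul_eq_zero] at h3
    refine h3.resolve_right ?_
    rw [ENNReal.ofReal_eq_zero, not_le]
    positivity
  rw [ae_restrict_iff' measurableSet_Ioi]
  filter_upwards [ae_all_iff.mpr h1] with x hx hx0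
  obtain ⟨n, hn⟩ := exists_nat_one_div_lt (show (0 : ℝ) < x from hx0)
  exact hx n hn.le

/-- A uniform bound for `∑ wᵢ H(ξᵢ b)` bounds the partial sums of `wᵢ`. -/
theorem exists_tsum_rpow_le {ι : Type*} [Countable ι] {w : ι → ENNReal} {ξ : ι → ℝ}
    (hξ : ∀ i, 0 < ξ i) {H : ℝ → ENNReal} (hH : Measurable H)
    (h0 : ¬ ∀ᵐ x ∂volume.restrict (Set.Ioi (0 : ℝ)), H x = 0) {M : ENNReal} (hM : M ≠ ⊤)
    (hb : ∀ a, 0 < a → ∑' i, w i * H (ξ i / a ^ 2) ≤ M) {ε : ℝ} (hε : 0 < ε) :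
    ∃ C : ENNReal, C ≠ ⊤ ∧ ∀ Y : ℝ, 0 < Y →
      ∑' i, (if ξ i ≤ Y then w i * ENNReal.ofReal (ξ i ^ (ε / 2)) else 0)
        ≤ C * ENNReal.ofReal (Y ^ (ε / 2)) := by
  obtain ⟨r, hr, hI⟩ := exists_lintegral_Ici_ne_zero hH h0 (-(ε / 2) - 1)
  set I := ∫⁻ x in Set.Ici r, H x * ENNReal.ofReal (x ^ (-(ε / 2) - 1)) with hIdef
  -- `I` may be infinite; truncation gives a nonzero finite quantity to divide by.
  set J := min I 1 with hJ
  have hJ0 : J ≠ 0 := by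
    rw [hJ]; exact (lt_min (pos_iff_ne_zero.mpr hI) one_pos).ne'
  have hJt : J ≠ ⊤ := ne_top_of_le_ne_top ENNReal.one_ne_top (min_le_right _ _)
  refine ⟨2 * M * ENNReal.ofReal (r⁻¹ ^ (ε / 2) / ε) / J, ?_, fun Y hY => ?_⟩
  · exact ENNReal.div_ne_top (ENNReal.mul_ne_top (ENNReal.mul_ne_top ENNReal.ofNat_ne_top hM)
      ENNReal.ofReal_ne_top) hJ0
  -- With this choice `ξ i / a₁² = r ξ i / Y ≤ r` whenever `ξ i ≤ Y`, so the `i`-th integral covers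
  -- all of `[r, ∞)`.
  set a₁ := Real.sqrt (Y / r) with ha₁
  have ha : 0 < a₁ := by positivity
  have hsq : a₁ ^ 2 = Y / r := Real.sq_sqrt (by positivity)
  have h1 : 2 * ∫⁻ a in Set.Ioc 0 a₁, (∑' i, w i * H (ξ i / a ^ 2)) * ENNReal.ofReal (a ^ ε / a)
      ≤ 2 * M * ENNReal.ofReal (a₁ ^ ε / ε) := by
    rw [mul_assoc, ← lintegral_rpow_div_self hε ha, ← lintegral_const_mul' _ _ hM]
    gcongr 2 * ?_
    refine setLIntegral_mono' measurableSet_Ioc fun a ha => ?_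
    gcongr
    exact hb a ha.1
  have h2 : 2 * ∫⁻ a in Set.Ioc 0 a₁, (∑' i, w i * H (ξ i / a ^ 2)) * ENNReal.ofReal (a ^ ε / a)
      = ∑' i, w i * ∫⁻ x in Set.Ici (ξ i / a₁ ^ 2),
        H x * ENNReal.ofReal (ξ i ^ (ε / 2) * x ^ (-(ε / 2) - 1)) := by
    simp only [← ENNReal.tsum_mul_right]
    rw [lintegral_tsum fun i => Measurable.aemeasurable (by fun_prop), ← ENNReal.tsum_mul_left]
    refine tsum_congr fun i => ?_
    simp only [mul_assoc]
    rw [lintegral_const_mul _ (by fun_prop), mul_left_comm, lintegral_comp_div_sq H (hξ i) ha]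
  have h3 : ∀ i, (if ξ i ≤ Y then w i * ENNReal.ofReal (ξ i ^ (ε / 2)) else 0) * J
      ≤ w i * ∫⁻ x in Set.Ici (ξ i / a₁ ^ 2),
        H x * ENNReal.ofReal (ξ i ^ (ε / 2) * x ^ (-(ε / 2) - 1)) := by
    intro i
    split_ifs with hi
    · rw [mul_assoc]
      gcongr w i * ?_
      refine (mul_le_mul_right (min_le_left _ _) _).trans ?_
      rw [hIdef, ← lintegral_const_mul' _ _ ENNReal.ofReal_ne_top]
      refine (setLIntegral_mono' measurableSet_Ici fun x hx => ?_).trans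
        (lintegral_mono_set (Set.Ici_subset_Ici.mpr ?_))
      · rw [mul_left_comm, ENNReal.ofReal_mul (Real.rpow_nonneg (hξ i).le _)]
      · rw [hsq, div_div_eq_mul_div, div_le_iff₀ hY, mul_comm]
        gcongr
    · rw [zero_mul]; exact zero_le
  have h4 : ENNReal.ofReal (a₁ ^ ε / ε)
      = ENNReal.ofReal (r⁻¹ ^ (ε / 2) / ε) * ENNReal.ofReal (Y ^ (ε / 2)) := by
    rw [← ENNReal.ofReal_mul (by positivity)]
    congr 1
    rw [ha₁, Real.sqrt_eq_rpow, ← Real.rpow_mul (by positivity), div_eq_mul_inv Y r,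
      Real.mul_rpow hY.le (by positivity)]
    have : 1 / 2 * ε = ε / 2 := by ring
    rw [this]
    ring
  rw [ENNReal.mul_comm_div, ← mul_div_assoc, ENNReal.le_div_iff_mul_le (Or.inl hJ0) (Or.inl hJt),
    ← ENNReal.tsum_mul_right]
  refine (ENNReal.tsum_le_tsum h3).trans ((h2 ▸ h1).trans_eq ?_)
  rw [h4]
  ring

/-- After the substitution and Tonelli, the inner sum is `∑_{ξ_i ≤ a₁² x} w_i ξ_i^{ε/2} ≤ C (a₁²
x)^{ε/2}`. The powers of `x` cancel down to `dx/x`, and `C` depends neither on `F` nor on `a₁`. -/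
theorem exists_lintegral_tsum_le {ι : Type*} [Countable ι] {w : ι → ENNReal} {ξ : ι → ℝ}
    (hξ : ∀ i, 0 < ξ i) {H : ℝ → ENNReal} (hH : Measurable H)
    (h0 : ¬ ∀ᵐ x ∂volume.restrict (Set.Ioi (0 : ℝ)), H x = 0) {M : ENNReal} (hM : M ≠ ⊤)
    (hb : ∀ a, 0 < a → ∑' i, w i * H (ξ i / a ^ 2) ≤ M) {ε : ℝ} (hε : 0 < ε) :
    ∃ C : ENNReal, C ≠ ⊤ ∧ ∀ F : ℝ → ENNReal, Measurable F → ∀ a₁ : ℝ, 0 < a₁ →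
      ∫⁻ a in Set.Ioc 0 a₁, (∑' i, w i * F (ξ i / a ^ 2)) * ENNReal.ofReal (a ^ ε / a)
        ≤ C * ENNReal.ofReal (a₁ ^ ε) * ∫⁻ x in Set.Ioi (0 : ℝ), F x * ENNReal.ofReal x⁻¹ := by
  obtain ⟨C, hC, h⟩ := exists_tsum_rpow_le hξ hH h0 hM hb hε
  refine ⟨C, hC, fun F hF a₁ ha => ?_⟩
  have h2 : 2 * ∫⁻ a in Set.Ioc 0 a₁, (∑' i, w i * F (ξ i / a ^ 2)) * ENNReal.ofReal (a ^ ε / a)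
      = ∑' i, w i * ∫⁻ x in Set.Ici (ξ i / a₁ ^ 2),
        F x * ENNReal.ofReal (ξ i ^ (ε / 2) * x ^ (-(ε / 2) - 1)) := by
    simp only [← ENNReal.tsum_mul_right]
    rw [lintegral_tsum fun i => Measurable.aemeasurable (by fun_prop), ← ENNReal.tsum_mul_left]
    refine tsum_congr fun i => ?_
    simp only [mul_assoc]
    rw [lintegral_const_mul _ (by fun_prop), mul_left_comm, lintegral_comp_div_sq F (hξ i) ha]
  have h3 : ∀ i, w i * ∫⁻ x in Set.Ici (ξ i / a₁ ^ 2),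
        F x * ENNReal.ofReal (ξ i ^ (ε / 2) * x ^ (-(ε / 2) - 1))
      = ∫⁻ x in Set.Ioi (0 : ℝ), (F x * ENNReal.ofReal (x ^ (-(ε / 2) - 1))) *
        (if ξ i ≤ a₁ ^ 2 * x then w i * ENNReal.ofReal (ξ i ^ (ε / 2)) else 0) := by
    intro i
    have hm : MeasurableSet {x : ℝ | ξ i ≤ a₁ ^ 2 * x} :=
      measurableSet_le measurable_const (by fun_prop)
    have hset : Set.Ici (ξ i / a₁ ^ 2) ⊆ Set.Ioi (0 : ℝ) := fun x hx =>
      lt_of_lt_of_le (div_pos (hξ i) (by positivity)) hx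
    rw [← lintegral_const_mul _ (by fun_prop), ← lintegral_indicator measurableSet_Ici,
      ← lintegral_indicator measurableSet_Ioi]
    refine lintegral_congr fun x => ?_
    by_cases hx : x ∈ Set.Ici (ξ i / a₁ ^ 2)
    · have hx1 : ξ i ≤ a₁ ^ 2 * x := by
        have : ξ i / a₁ ^ 2 ≤ x := hx
        rwa [div_le_iff₀ (by positivity), mul_comm] at this
      rw [Set.indicator_of_mem hx, Set.indicator_of_mem (hset hx), if_pos hx1,
        ENNReal.ofReal_mul (Real.rpow_nonneg (hξ i).le _)]
      ring
    · have hx1 : ¬ ξ i ≤ a₁ ^ 2 * x := by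
        have : ¬ ξ i / a₁ ^ 2 ≤ x := hx
        rwa [div_le_iff₀ (by positivity), mul_comm] at this
      rw [Set.indicator_of_notMem hx]
      by_cases hx2 : x ∈ Set.Ioi (0 : ℝ)
      · rw [Set.indicator_of_mem hx2, if_neg hx1, mul_zero]
      · rw [Set.indicator_of_notMem hx2]
  have h4 : 2 * ∫⁻ a in Set.Ioc 0 a₁, (∑' i, w i * F (ξ i / a ^ 2)) * ENNReal.ofReal (a ^ ε / a)
      ≤ C * ENNReal.ofReal (a₁ ^ ε) * ∫⁻ x in Set.Ioi (0 : ℝ), F x * ENNReal.ofReal x⁻¹ := by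
    rw [h2, tsum_congr h3, ← lintegral_tsum fun i => Measurable.aemeasurable (by
      refine Measurable.mul (by fun_prop) (Measurable.ite ?_ measurable_const measurable_const)
      exact measurableSet_le measurable_const (by fun_prop)),
      ← lintegral_const_mul' _ _ (ENNReal.mul_ne_top hC ENNReal.ofReal_ne_top)]
    refine setLIntegral_mono' measurableSet_Ioi fun x hx => ?_
    have hx0 : 0 < x := hx
    rw [ENNReal.tsum_mul_left]
    refine (mul_le_mul_right (h (a₁ ^ 2 * x) (by positivity)) _).trans_eq ?_
    have h5 : ENNReal.ofReal (x ^ (-(ε / 2) - 1)) * ENNReal.ofReal ((a₁ ^ 2 * x) ^ (ε / 2))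
        = ENNReal.ofReal (a₁ ^ ε) * ENNReal.ofReal x⁻¹ := by
      rw [← ENNReal.ofReal_mul (by positivity), ← ENNReal.ofReal_mul (by positivity)]
      congr 1
      rw [Real.mul_rpow (by positivity) hx0.le, Real.rpow_sub_one hx0.ne', Real.rpow_neg hx0.le,
        ← Real.rpow_natCast a₁, ← Real.rpow_mul ha.le]
      have h6 : ((2 : ℕ) : ℝ) * (ε / 2) = ε := by push_cast; ring
      rw [h6]
      have := Real.rpow_pos_of_pos hx0 (ε / 2)
      field_simp
    calc F x * ENNReal.ofReal (x ^ (-(ε / 2) - 1)) * (C * ENNReal.ofReal ((a₁ ^ 2 * x) ^ (ε / 2)))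
        = F x * C * (ENNReal.ofReal (x ^ (-(ε / 2) - 1)) *
          ENNReal.ofReal ((a₁ ^ 2 * x) ^ (ε / 2))) := by ring
      _ = _ := by rw [h5]; ring
  refine le_trans ?_ h4
  rw [two_mul]
  exact le_self_add

namespace DiscSeries

variable {k : ℤ} [hk : Fact (2 ≤ k)]

/-! ### The Siegel-domain estimate -/

/-- The square of the Kirillov function with its weight. -/
noncomputable def kirillovSq (u : smoothVectors k) (x : ℝ) : ENNReal :=
  ENNReal.ofReal (x ^ k.natAbs * Real.exp (-(4 * Real.pi * x))) *
    ‖Set.indicator (Set.Ioi 0) (kirillov u) x‖ₑ ^ 2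

theorem measurable_kirillovSq (u : smoothVectors k)
    (hs : ∀ x, 0 < x → Summable fun j => typeCoeff (u : DiscSeries k) j *
      (typePoly k j).eval (specVar x)) : Measurable (kirillovSq u) :=
  Measurable.mul (by fun_prop) ((measurable_kirillov u hs).enorm.pow_const _)

theorem lintegral_kirillovSq_le (u : smoothVectors k)
    (hs : ∀ x, 0 < x → Summable fun j => typeCoeff (u : DiscSeries k) j *
      (typePoly k j).eval (specVar x)) :
    ∫⁻ x in Set.Ioi (0 : ℝ), kirillovSq u x * ENNReal.ofReal x⁻¹
      ≤ ENNReal.ofReal (isoConst k * ‖(u : DiscSeries k)‖ ^ 2) := by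
  refine le_trans (le_of_eq ?_) (kirillovEnergy_le u hs)
  refine setLIntegral_congr_fun measurableSet_Ioi fun x hx => ?_
  have hx0 : (0 : ℝ) < x := hx
  rw [kirillovSq, Set.indicator_of_mem hx, mul_right_comm, ← ENNReal.ofReal_mul (by positivity)]
  congr 2
  obtain ⟨m, hm⟩ := Nat.exists_eq_add_of_le' ((one_le_two).trans (natAbs_ge (k := k)))
  rw [hm, Nat.add_sub_cancel, pow_succ]
  field_simp

theorem eq_zero_of_kirillovSq_ae_eq_zero (u : smoothVectors k)
    (hs : ∀ x, 0 < x → Summable fun j => typeCoeff (u : DiscSeries k) j *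
      (typePoly k j).eval (specVar x))
    (h0 : ∀ᵐ x ∂volume.restrict (Set.Ioi (0 : ℝ)), kirillovSq u x = 0) : u = 0 := by
  refine eq_zero_of_kirillov_ae_eq_zero u hs ?_
  filter_upwards [h0, ae_restrict_mem measurableSet_Ioi] with x hx hx1
  have hx0 : (0 : ℝ) < x := hx1
  rw [kirillovSq, Set.indicator_of_mem hx1, mul_eq_zero] at hx
  have h1 : ENNReal.ofReal (x ^ k.natAbs * Real.exp (-(4 * Real.pi * x))) ≠ 0 := by
    rw [Ne, ENNReal.ofReal_eq_zero, not_le]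
    positivity
  simpa using hx.resolve_left h1

variable {l : smoothVectors k →ₗ[ℂ] ℂ}

/-- The weight of a Whittaker functional. -/
noncomputable def whittakerWeight (l : smoothVectors k →ₗ[ℂ] ℂ) (ξ : ℝ) : ENNReal :=
  ENNReal.ofReal (‖l lowS‖ ^ 2 * Real.exp (4 * Real.pi * ξ) / ξ ^ k.natAbs)

theorem IsWhittaker.enorm_apply_sq {ξ : ℝ} (h : IsWhittaker l ξ) (hξ : 0 < ξ) {a : ℝ} (ha : 0 < a)
    (u : smoothVectors k) :
    ‖l (smoothRep k (diagA a)⁻¹ u)‖ₑ ^ 2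
      = whittakerWeight l ξ * kirillovSq u (ξ / a ^ 2) := by
  have hx : ξ / a ^ 2 ∈ Set.Ioi (0 : ℝ) := div_pos hξ (by positivity)
  have hx0 : (0 : ℝ) < ξ / a ^ 2 := hx
  rw [kirillovSq, Set.indicator_of_mem hx, whittakerWeight, ← ofReal_norm, ← ofReal_norm,
    ← ENNReal.ofReal_pow (norm_nonneg _), ← ENNReal.ofReal_pow (norm_nonneg _),
    ← ENNReal.ofReal_mul (by positivity), ← ENNReal.ofReal_mul (by positivity),
    h.norm_apply_sq ha, div_pow ξ, div_pow 1]
  congr 1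
  field_simp
  ring

/-- Twisting by the `a` with `ξ / a² = x` gives a Whittaker functional of frequency `x`. It cannot
vanish at `lowS`, since then it, and with it `l`, would be zero. -/
theorem IsWhittaker.summable_kirillov {ξ : ℝ} (h : IsWhittaker l ξ) (hξ : 0 < ξ) (h0 : l ≠ 0)
    (u : smoothVectors k) (x : ℝ) (hx : 0 < x) :
    Summable fun j => typeCoeff (u : DiscSeries k) j * (typePoly k j).eval (specVar x) := by
  set a := Real.sqrt (ξ / x) with hadef
  have ha : 0 < a := by positivity
  have h1 := h.comp_diagA ha.ne'
  have h2 : ξ / a ^ 2 = x := by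
    rw [Real.sq_sqrt (by positivity)]
    field_simp
  rw [h2] at h1
  refine h1.summable (fun h3 => h0 (LinearMap.ext fun v => ?_)) u
  have h4 := h1.apply_eq (smoothRep k (diagA a) v)
  rw [h3, zero_mul, LinearMap.comp_apply, ← smoothRep_mul, inv_mul_cancel, smoothRep_one] at h4
  exact h4

theorem tsum_int_eq_tsum_nat_succ {f : ℤ → ENNReal} (hf : ∀ m ≤ 0, f m = 0) :
    ∑' m, f m = ∑' n : ℕ, f (n + 1) := by
  have hinj : Function.Injective fun n : ℕ => (n + 1 : ℤ) := fun a b h => by simpa using h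
  refine (hinj.tsum_eq fun m hm => ?_).symm
  have hm0 : 0 < m := by
    by_contra hc
    exact hm (hf m (not_lt.mp hc))
  exact ⟨(m - 1).toNat, by simp only; omega⟩

theorem exists_siegel_bound (hl : IsDist l) {p : ℝ} (hp : 0 < p)
    (hper : ∀ u, l (smoothRep k (unipN (-p)) u) = l u)
    (hconst : ∀ u, ∫ t in (0 : ℝ)..p, l (smoothRep k (unipN (-t)) u) = 0)
    {φ : smoothVectors k} (hφ : φ ≠ 0) {B : ℝ}
    (hB : ∀ a t : ℝ, 0 < a → ‖l (smoothRep k (diagA a * unipN t)⁻¹ φ)‖ ≤ B)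
    {ε : ℝ} (hε : 0 < ε) :
    ∃ C : ℝ, 0 < C ∧ ∀ a₁ : ℝ, 0 < a₁ → ∀ u : smoothVectors k,
      ∫⁻ a in Set.Ioc 0 a₁, (∫⁻ t in Set.Ioc 0 p,
          ‖l (smoothRep k (diagA a * unipN t)⁻¹ u)‖ₑ ^ 2) * ENNReal.ofReal (a ^ ε / a)
        ≤ ENNReal.ofReal (C * a₁ ^ ε * ‖(u : DiscSeries k)‖ ^ 2) := by
  have hW := isWhittaker_fourierMode hl hp hper
  -- Negative modes vanish by growth, the zeroth by the absence of a constant term.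
  have hzero : ∀ m : ℤ, m ≤ 0 → fourierMode hl p m = 0 := by
    intro m hm
    rcases hm.lt_or_eq with hm | rfl
    · exact (hW m).eq_zero_of_neg (div_neg_of_neg_of_pos (by exact_mod_cast hm) hp)
    · refine LinearMap.ext fun u => ?_
      change (p : ℂ)⁻¹ * _ = 0
      simp [specVar, hconst u]
  have hfac : ∀ a t (u : smoothVectors k), l (smoothRep k (diagA a * unipN t)⁻¹ u)
      = l (smoothRep k (unipN (-t)) (smoothRep k (diagA a)⁻¹ u)) := fun a t u => by
    rw [mul_inv_rev, ← unipN_neg, smoothRep_mul]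
  let ξ : ℕ → ℝ := fun n => ((n + 1 : ℤ) : ℝ) / p
  have hξ : ∀ n, 0 < ξ n := fun n => div_pos (by exact_mod_cast n.succ_pos) hp
  let w : ℕ → ENNReal := fun n => whittakerWeight (fourierMode hl p (n + 1)) (ξ n)
  have hinner : ∀ a, 0 < a → ∀ u : smoothVectors k,
      ∫⁻ t in Set.Ioc 0 p, ‖l (smoothRep k (diagA a * unipN t)⁻¹ u)‖ₑ ^ 2
        = ENNReal.ofReal p * ∑' n, w n * kirillovSq u (ξ n / a ^ 2) := by
    intro a ha u
    simp only [hfac]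
    rw [lintegral_unipN_orbit hl hp, tsum_int_eq_tsum_nat_succ fun m hm => by rw [hzero m hm]; simp]
    congr 2
    funext n
    exact (hW (n + 1)).enorm_apply_sq (hξ n) ha u
  -- A nonzero mode is what guarantees convergence of the Kirillov series; without one, the left
  -- side is zero.
  by_cases hall : ∀ n : ℕ, fourierMode hl p (n + 1) = 0
  · refine ⟨1, one_pos, fun a₁ ha₁ u => ?_⟩
    have h1 : ∫⁻ a in Set.Ioc 0 a₁, (∫⁻ t in Set.Ioc 0 p,
          ‖l (smoothRep k (diagA a * unipN t)⁻¹ u)‖ₑ ^ 2) * ENNReal.ofReal (a ^ ε / a) = 0 := by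
      rw [setLIntegral_congr_fun (g := fun _ => 0) measurableSet_Ioc fun a ha => by
        rw [hinner a ha.1 u]; simp [w, hall, whittakerWeight]]
      simp
    rw [h1]
    exact zero_le
  push Not at hall
  obtain ⟨n₀, hn₀⟩ := hall
  have hs : ∀ (u : smoothVectors k) (x : ℝ), 0 < x → Summable fun j =>
      typeCoeff (u : DiscSeries k) j * (typePoly k j).eval (specVar x) := fun u =>
    (hW (n₀ + 1)).summable_kirillov (hξ n₀) hn₀ u
  have hB0 : 0 ≤ B := (norm_nonneg _).trans (hB 1 0 one_pos)
  have hbound : ∀ a, 0 < a → ∑' n, w n * kirillovSq φ (ξ n / a ^ 2) ≤ ENNReal.ofReal (B ^ 2) := by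
    intro a ha
    have hp' : ENNReal.ofReal p ≠ 0 := by rw [Ne, ENNReal.ofReal_eq_zero, not_le]; exact hp
    have h1 : ENNReal.ofReal p * ∑' n, w n * kirillovSq φ (ξ n / a ^ 2)
        ≤ ENNReal.ofReal p * ENNReal.ofReal (B ^ 2) := by
      rw [← hinner a ha]
      calc ∫⁻ t in Set.Ioc 0 p, ‖l (smoothRep k (diagA a * unipN t)⁻¹ φ)‖ₑ ^ 2
          ≤ ∫⁻ _ in Set.Ioc 0 p, ENNReal.ofReal (B ^ 2) := by
            refine lintegral_mono fun t => ?_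
            rw [← ofReal_norm, ← ENNReal.ofReal_pow (norm_nonneg _)]
            exact ENNReal.ofReal_le_ofReal (pow_le_pow_left₀ (norm_nonneg _) (hB a t ha) 2)
        _ = _ := by simp [mul_comm]
    exact (ENNReal.mul_le_mul_iff_right hp' ENNReal.ofReal_ne_top).mp h1
  obtain ⟨C, hC, h⟩ := exists_lintegral_tsum_le hξ (measurable_kirillovSq φ (hs φ))
    (fun h0 => hφ (eq_zero_of_kirillovSq_ae_eq_zero φ (hs φ) h0)) ENNReal.ofReal_ne_top hbound hε
  have hiso := isoConst_pos (k := k)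
  -- The `+ 1` makes the constant positive even if `C` is zero.
  refine ⟨p * C.toReal * isoConst k + 1, by positivity, fun a₁ ha₁ u => ?_⟩
  calc ∫⁻ a in Set.Ioc 0 a₁, (∫⁻ t in Set.Ioc 0 p,
          ‖l (smoothRep k (diagA a * unipN t)⁻¹ u)‖ₑ ^ 2) * ENNReal.ofReal (a ^ ε / a)
      = ENNReal.ofReal p * ∫⁻ a in Set.Ioc 0 a₁,
          (∑' n, w n * kirillovSq u (ξ n / a ^ 2)) * ENNReal.ofReal (a ^ ε / a) := by
        rw [← lintegral_const_mul' _ _ ENNReal.ofReal_ne_top]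
        refine setLIntegral_congr_fun measurableSet_Ioc fun a ha => ?_
        rw [hinner a ha.1, mul_assoc]
    _ ≤ ENNReal.ofReal p * (C * ENNReal.ofReal (a₁ ^ ε) *
          ENNReal.ofReal (isoConst k * ‖(u : DiscSeries k)‖ ^ 2)) := by
        gcongr ENNReal.ofReal p * ?_
        refine (h _ (measurable_kirillovSq u (hs u)) a₁ ha₁).trans ?_
        gcongr
        exact lintegral_kirillovSq_le u (hs u)
    _ = ENNReal.ofReal (p * C.toReal * isoConst k * a₁ ^ ε * ‖(u : DiscSeries k)‖ ^ 2) := by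
        rw [← ENNReal.ofReal_toReal hC, ← ENNReal.ofReal_mul (by positivity),
          ← ENNReal.ofReal_mul (by positivity), ← ENNReal.ofReal_mul hp.le,
          ENNReal.toReal_ofReal (by positivity)]
        congr 1
        ring
    _ ≤ _ := by
        refine ENNReal.ofReal_le_ofReal ?_
        gcongr
        linarith

end DiscSeries

/-! ### Extension of bounded operators from a subspace -/

/-- Density of the range of `e` is not needed: extend by continuity to its closure, then precompose
with the orthogonal projection, which has norm at most one. -/
theorem exists_bounded_extension {V H F : Type*} [AddCommGroup V] [Module ℂ V]
    [NormedAddCommGroup H] [InnerProductSpace ℂ H] [CompleteSpace H] [NormedAddCommGroup F]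
    [NormedSpace ℂ F] [CompleteSpace F] (e : V →ₗ[ℂ] H) (f : V →ₗ[ℂ] F) {C : ℝ} (hC : 0 ≤ C)
    (h : ∀ x, ‖f x‖ ≤ C * ‖e x‖) :
    ∃ T : H →L[ℂ] F, (∀ x, T (e x) = f x) ∧ ∀ y, ‖T y‖ ≤ C * ‖y‖ := by
  let S : Submodule ℂ H := (LinearMap.range e).topologicalClosure
  have hS : CompleteSpace S := (Submodule.isClosed_topologicalClosure _).completeSpace_coe
  have hmem : ∀ x, e x ∈ S := fun x =>
    Submodule.le_topologicalClosure _ (LinearMap.mem_range_self e x)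
  let e' : V →ₗ[ℂ] S := e.codRestrict S hmem
  have hd : DenseRange e' := by
    intro y
    rw [closure_subtype]
    have h1 : Subtype.val '' Set.range e' = (LinearMap.range e : Set H) := by
      ext z
      constructor
      · rintro ⟨_, ⟨x, rfl⟩, rfl⟩
        exact ⟨x, rfl⟩
      · rintro ⟨x, rfl⟩
        exact ⟨e' x, ⟨x, rfl⟩, rfl⟩
    rw [h1]
    exact y.2
  have h' : ∀ x, ‖f x‖ ≤ C * ‖e' x‖ := h
  refine ⟨(f.extendOfNorm e').comp S.orthogonalProjectionOnto, fun x => ?_, fun y => ?_⟩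
  · have h2 : S.orthogonalProjectionOnto (e x) = e' x :=
      Submodule.orthogonalProjectionOnto_mem_subspace_eq_self (e' x)
    rw [ContinuousLinearMap.comp_apply, h2]
    exact f.extendOfNorm_eq hd ⟨C, h'⟩ x
  · rw [ContinuousLinearMap.comp_apply]
    refine (f.norm_extendOfNorm_apply_le hd C h' _).trans ?_
    gcongr
    exact S.norm_orthogonalProjectionOnto_apply_le y

theorem eLpNorm_two_sq {X : Type*} [MeasurableSpace X] {μ : Measure X} (f : X → ℂ) :
    eLpNorm f 2 μ ^ 2 = ∫⁻ x, ‖f x‖ₑ ^ 2 ∂μ := by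
  rw [eLpNorm_eq_lintegral_rpow_enorm_toReal (by simp) (by simp)]
  simp only [ENNReal.toReal_ofNat, ENNReal.rpow_two]
  rw [← ENNReal.rpow_natCast, ← ENNReal.rpow_mul]
  simp

namespace DiscSeries

variable {k : ℤ}

/-- The extension starts from the image in `L²`, a Hilbert space for every `k`, so no completeness
of `DiscSeries k` is required. -/
theorem exists_operator {X : Type*} [MeasurableSpace X] {μ : Measure X}
    (L : X → smoothVectors k →ₗ[ℂ] ℂ) {C : ℝ} (hC : 0 ≤ C)
    (hm : ∀ v, AEStronglyMeasurable (fun x => L x v) μ)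
    (hb : ∀ v, ∫⁻ x, ‖L x v‖ₑ ^ 2 ∂μ ≤ ENNReal.ofReal (C * ‖(v : DiscSeries k)‖ ^ 2)) :
    ∃ T : DiscSeries k →L[ℂ] Lp ℂ 2 μ, (∀ v : smoothVectors k, T v =ᵐ[μ] fun x => L x v) ∧
      ∀ v, ‖T v‖ ^ 2 ≤ C * ‖v‖ ^ 2 := by
  have hL : ∀ v, MemLp (fun x => L x v) 2 μ := by
    refine fun v => ⟨hm v, ?_⟩
    by_contra hc
    have h := hb v
    rw [← eLpNorm_two_sq, not_lt_top_iff.mp hc] at h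
    simp at h
  let f : smoothVectors k →ₗ[ℂ] Lp ℂ 2 μ :=
    { toFun := fun v => (hL v).toLp _
      map_add' := fun u v => by
        rw [← MemLp.toLp_add]
        refine MemLp.toLp_congr _ _ (Filter.Eventually.of_forall fun x => ?_)
        exact map_add _ _ _
      map_smul' := fun c v => by
        rw [RingHom.id_apply, ← MemLp.toLp_const_smul]
        refine MemLp.toLp_congr _ _ (Filter.Eventually.of_forall fun x => ?_)
        exact map_smul _ _ _ }
  have hf : ∀ v, ‖f v‖ ≤ Real.sqrt C * ‖(v : DiscSeries k)‖ := by
    intro v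
    have h1 : ENNReal.ofReal (‖f v‖ ^ 2) ≤ ENNReal.ofReal (C * ‖(v : DiscSeries k)‖ ^ 2) := by
      refine le_trans (le_of_eq ?_) (hb v)
      rw [← eLpNorm_two_sq, ENNReal.ofReal_pow (norm_nonneg _), ofReal_norm, Lp.enorm_def]
      congr 1
      exact eLpNorm_congr_ae (hL v).coeFn_toLp
    rw [ENNReal.ofReal_le_ofReal_iff (by positivity)] at h1
    rw [← sq_le_sq₀ (norm_nonneg _) (by positivity), mul_pow, Real.sq_sqrt hC]
    exact h1
  obtain ⟨T, hT, hTb⟩ := exists_bounded_extension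
    ((toL2 (k := k)) ∘ₗ (smoothVectors k).subtype) f (Real.sqrt_nonneg C) hf
  refine ⟨T.comp (toL2ᵢ (k := k)).toContinuousLinearMap, fun v => ?_, fun v => ?_⟩
  · have h1 : T.comp (toL2ᵢ (k := k)).toContinuousLinearMap v = f v := hT v
    rw [h1]
    exact (hL v).coeFn_toLp
  · have h1 : ‖T (toL2 v)‖ ≤ Real.sqrt C * ‖v‖ := hTb _
    have h2 := pow_le_pow_left₀ (norm_nonneg _) h1 2
    rw [mul_pow, Real.sq_sqrt hC] at h2
    exact h2

end DiscSeries

/-! ### The estimates for matrix coefficients -/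

theorem measurable_rpow_div_self (ε : ℝ) :
    Measurable fun a : ℝ => ENNReal.ofReal (a ^ ε / a) := by fun_prop

theorem lintegral_siegelMeasure {ε a₁ p : ℝ} {F : ℝ × ℝ → ENNReal}
    (hF : AEMeasurable F (siegelMeasure ε a₁ p)) :
    ∫⁻ x, F x ∂siegelMeasure ε a₁ p
      = ∫⁻ a in Set.Ioc 0 a₁, (∫⁻ t in Set.Ioc 0 p, F (a, t)) * ENNReal.ofReal (a ^ ε / a) := by
  rw [siegelMeasure] at hF ⊢
  rw [lintegral_prod _ hF, lintegral_withDensity_eq_lintegral_mul_non_measurable _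
    (measurable_rpow_div_self ε) (Filter.Eventually.of_forall fun _ => ENNReal.ofReal_lt_top)]
  refine lintegral_congr fun a => ?_
  rw [Pi.mul_apply, mul_comm]

theorem ae_siegelMeasure_pos (ε a₁ p : ℝ) : ∀ᵐ x ∂siegelMeasure ε a₁ p, 0 < x.1 := by
  have h1 : ∀ᵐ a ∂((volume.restrict (Set.Ioc 0 a₁)).withDensity
      fun a => ENNReal.ofReal (a ^ ε / a)), 0 < a := by
    refine (withDensity_absolutelyContinuous _ _).ae_le ?_
    filter_upwards [ae_restrict_mem measurableSet_Ioc] with a ha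
    exact ha.1
  exact Measure.quasiMeasurePreserving_fst.ae h1

theorem ae_siegelMeasureK_pos (ε a₁ p : ℝ) : ∀ᵐ x ∂siegelMeasureK ε a₁ p, 0 < x.2.1 := by
  have : SFinite (siegelMeasure ε a₁ p) := by unfold siegelMeasure; infer_instance
  exact Measure.quasiMeasurePreserving_snd.ae (ae_siegelMeasure_pos ε a₁ p)

section

variable {n : ℤ} (τ : DistVectors n)

theorem matCoeff_mul (v : smoothVectors (-n)) (g h : SL(2, ℝ)) :
    matCoeff τ v (g * h) = matCoeff τ (smoothRep (-n) g⁻¹ v) h := by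
  have : smoothRep (-n) (g * h)⁻¹ v = smoothRep (-n) h⁻¹ (smoothRep (-n) g⁻¹ v) := by
    rw [mul_inv_rev]
    exact Subtype.ext (DiscSeries.discRep_mul _ _ _)
  rw [matCoeff, matCoeff, this]

/-- The conclusion from the estimate on smooth vectors and continuity in Iwasawa coordinates. -/
theorem siegel_operators_of_bound {p ε : ℝ}
    (hcont : ∀ v, Continuous fun x : ℝ × ℝ × ℝ => matCoeff τ v (iwasawa x))
    (hbound : ∃ C : ℝ, 0 < C ∧ ∀ a₁ : ℝ, 0 < a₁ → ∀ v : smoothVectors (-n),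
      ∫⁻ a in Set.Ioc 0 a₁, (∫⁻ t in Set.Ioc 0 p,
          ‖matCoeff τ v (diagA a * unipN t)‖ₑ ^ 2) * ENNReal.ofReal (a ^ ε / a)
        ≤ ENNReal.ofReal (C * a₁ ^ ε * ‖(v : DiscSeries (-n))‖ ^ 2)) :
    ∃ C : ℝ, 0 < C ∧ ∀ a₁ : ℝ, 0 < a₁ →
      (∀ v : smoothVectors (-n),
        ∫⁻ a in Set.Ioc 0 a₁, (∫⁻ t in Set.Ioc 0 p,
            ‖matCoeff τ v (diagA a * unipN t)‖ₑ ^ 2) * ENNReal.ofReal (a ^ ε / a)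
          ≤ ENNReal.ofReal (C * a₁ ^ ε * ‖(v : DiscSeries (-n))‖ ^ 2)) ∧
      (∀ v : smoothVectors (-n),
        ∫⁻ θ in Set.Ico 0 (2 * Real.pi), ∫⁻ a in Set.Ioc 0 a₁, (∫⁻ t in Set.Ioc 0 p,
            ‖matCoeff τ v (rotK θ * diagA a * unipN t)‖ₑ ^ 2) * ENNReal.ofReal (a ^ ε / a)
          ≤ ENNReal.ofReal (C * a₁ ^ ε * ‖(v : DiscSeries (-n))‖ ^ 2)) ∧
      (∃ T : DiscSeries (-n) →L[ℂ] Lp ℂ 2 (siegelMeasure ε a₁ p),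
        (∀ v : smoothVectors (-n), T v =ᵐ[siegelMeasure ε a₁ p]
          fun x => matCoeff τ v (diagA x.1 * unipN x.2)) ∧
        ∀ v : DiscSeries (-n), ‖T v‖ ^ 2 ≤ C * a₁ ^ ε * ‖v‖ ^ 2) ∧
      (∃ T : DiscSeries (-n) →L[ℂ] Lp ℂ 2 (siegelMeasureK ε a₁ p),
        (∀ v : smoothVectors (-n), T v =ᵐ[siegelMeasureK ε a₁ p]
          fun x => matCoeff τ v (rotK x.1 * diagA x.2.1 * unipN x.2.2)) ∧
        ∀ v : DiscSeries (-n), ‖T v‖ ^ 2 ≤ C * a₁ ^ ε * ‖v‖ ^ 2) := by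
  obtain ⟨C, hC, h⟩ := hbound
  -- One constant must serve both estimates; integrating over `θ` costs the factor `2π`.
  have hCle : C ≤ (1 + 2 * Real.pi) * C := by nlinarith [Real.pi_pos]
  have h1 : ∀ a₁ : ℝ, 0 < a₁ → ∀ v : smoothVectors (-n),
      ∫⁻ a in Set.Ioc 0 a₁, (∫⁻ t in Set.Ioc 0 p,
          ‖matCoeff τ v (diagA a * unipN t)‖ₑ ^ 2) * ENNReal.ofReal (a ^ ε / a)
        ≤ ENNReal.ofReal ((1 + 2 * Real.pi) * C * a₁ ^ ε * ‖(v : DiscSeries (-n))‖ ^ 2) :=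
    fun a₁ ha₁ v => (h a₁ ha₁ v).trans (ENNReal.ofReal_le_ofReal (by gcongr))
  have h2 : ∀ a₁ : ℝ, 0 < a₁ → ∀ v : smoothVectors (-n),
      ∫⁻ θ in Set.Ico 0 (2 * Real.pi), ∫⁻ a in Set.Ioc 0 a₁, (∫⁻ t in Set.Ioc 0 p,
          ‖matCoeff τ v (rotK θ * diagA a * unipN t)‖ₑ ^ 2) * ENNReal.ofReal (a ^ ε / a)
        ≤ ENNReal.ofReal ((1 + 2 * Real.pi) * C * a₁ ^ ε * ‖(v : DiscSeries (-n))‖ ^ 2) := by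
    intro a₁ ha₁ v
    have hθ : ∀ θ : ℝ, ∫⁻ a in Set.Ioc 0 a₁, (∫⁻ t in Set.Ioc 0 p,
          ‖matCoeff τ v (rotK θ * diagA a * unipN t)‖ₑ ^ 2) * ENNReal.ofReal (a ^ ε / a)
        ≤ ENNReal.ofReal (C * a₁ ^ ε * ‖(v : DiscSeries (-n))‖ ^ 2) := by
      intro θ
      -- For fixed `θ` the second estimate is the first one at `k_θ⁻¹ v`, which has the same norm as
      -- `v`.
      have h3 := h a₁ ha₁ (smoothRep (-n) (rotK θ)⁻¹ v)
      have h4 : ‖(smoothRep (-n) (rotK θ)⁻¹ v : DiscSeries (-n))‖ = ‖(v : DiscSeries (-n))‖ :=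
        DiscSeries.norm_discRep _ _
      rw [h4] at h3
      simpa only [mul_assoc (rotK θ), matCoeff_mul τ v (rotK θ)] using h3
    refine (lintegral_mono hθ).trans ?_
    rw [lintegral_const, Measure.restrict_apply_univ, Real.volume_Ico, sub_zero,
      ← ENNReal.ofReal_mul (by positivity)]
    refine ENNReal.ofReal_le_ofReal ?_
    have : 0 ≤ C * a₁ ^ ε * ‖(v : DiscSeries (-n))‖ ^ 2 := by positivity
    nlinarith [Real.pi_pos]
  have hiw : ∀ (θ a t : ℝ), 0 < a →
      iwasawa (θ, Real.log a, t) = rotK θ * diagA a * unipN t := fun θ a t ha => by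
    rw [iwasawa, Real.exp_log ha]
  have h0 : rotK 0 = 1 := oneParam_zero 0
  have hm : ∀ (a₁ : ℝ) (v : smoothVectors (-n)), AEStronglyMeasurable
      (fun x : ℝ × ℝ => matCoeff τ v (diagA x.1 * unipN x.2)) (siegelMeasure ε a₁ p) := by
    intro a₁ v
    -- `diagA` is defined by cases, so measurability is read off in Iwasawa coordinates with `s =
    -- log a`; the two functions agree where `a > 0`.
    refine AEStronglyMeasurable.congr (f := fun x : ℝ × ℝ =>
      matCoeff τ v (iwasawa (0, Real.log x.1, x.2))) ?_ ?_
    · exact ((hcont v).measurable.comp (by fun_prop)).aestronglyMeasurable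
    · filter_upwards [ae_siegelMeasure_pos ε a₁ p] with x hx
      rw [hiw _ _ _ hx, h0, one_mul]
  have hmK : ∀ (a₁ : ℝ) (v : smoothVectors (-n)), AEStronglyMeasurable
      (fun x : ℝ × ℝ × ℝ => matCoeff τ v (rotK x.1 * diagA x.2.1 * unipN x.2.2))
      (siegelMeasureK ε a₁ p) := by
    intro a₁ v
    refine AEStronglyMeasurable.congr (f := fun x : ℝ × ℝ × ℝ =>
      matCoeff τ v (iwasawa (x.1, Real.log x.2.1, x.2.2))) ?_ ?_
    · exact ((hcont v).measurable.comp (by fun_prop)).aestronglyMeasurable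
    · filter_upwards [ae_siegelMeasureK_pos ε a₁ p] with x hx
      rw [hiw _ _ _ hx]
  have hS : ∀ (a₁ : ℝ) (v : smoothVectors (-n)),
      AEMeasurable (fun x : ℝ × ℝ × ℝ =>
        ‖matCoeff τ v (rotK x.1 * diagA x.2.1 * unipN x.2.2)‖ₑ ^ 2) (siegelMeasureK ε a₁ p) :=
    fun a₁ v => (hmK a₁ v).enorm.pow_const 2
  refine ⟨(1 + 2 * Real.pi) * C, by positivity, fun a₁ ha₁ => ⟨h1 a₁ ha₁, h2 a₁ ha₁, ?_, ?_⟩⟩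
  · refine DiscSeries.exists_operator
      (fun x : ℝ × ℝ => τ.1 ∘ₗ smoothRep (-n) (diagA x.1 * unipN x.2)⁻¹)
      (C := (1 + 2 * Real.pi) * C * a₁ ^ ε) (by positivity) (hm a₁) fun v => ?_
    exact (lintegral_siegelMeasure ((hm a₁ v).enorm.pow_const 2)).trans_le (h1 a₁ ha₁ v)
  · have hfin : SFinite (siegelMeasure ε a₁ p) := by unfold siegelMeasure; infer_instance
    refine DiscSeries.exists_operator
      (fun x : ℝ × ℝ × ℝ => τ.1 ∘ₗ smoothRep (-n) (rotK x.1 * diagA x.2.1 * unipN x.2.2)⁻¹)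
      (C := (1 + 2 * Real.pi) * C * a₁ ^ ε) (by positivity) (hmK a₁) fun v => ?_
    refine le_trans (le_of_eq ?_) (h2 a₁ ha₁ v)
    refine (lintegral_prod _ (hS a₁ v)).trans ?_
    refine lintegral_congr fun θ => ?_
    refine lintegral_siegelMeasure ?_
    have h3 := (hm a₁ (smoothRep (-n) (rotK θ)⁻¹ v)).enorm.pow_const 2
    simp only [← matCoeff_mul, ← mul_assoc] at h3
    exact h3

end

namespace DiscSeries

/-! ### Complex conjugation between `D_k` and `D_{-k}` -/

variable {k k' : ℤ}

theorem bergmanMeasure_neg (k : ℤ) : bergmanMeasure (-k) = bergmanMeasure k := by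
  simp only [bergmanMeasure, Int.natAbs_neg]

theorem isHol_conj (h : k' = -k) (h0 : k ≠ 0) {F : ℍ → ℂ} (hF : IsHol k F) :
    IsHol k' fun z => conj (F z) := by
  subst h
  unfold IsHol at *
  split_ifs at * with h1 h2
  · omega
  · exact hF
  · simpa using hF
  · omega

theorem autFactor_conj (h : k' = -k) (h0 : k ≠ 0) (g : SL(2, ℝ)) (z : ℍ) :
    autFactor k' g z = conj (autFactor k g z) := by
  subst h
  unfold autFactor
  rw [Int.natAbs_neg]
  split_ifs with h1 h2
  · omega
  · simp
  · simp
  · omega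

/-- Complex conjugation of functions. -/
noncomputable def conjV (h : k' = -k) (h0 : k ≠ 0) (v : DiscSeries k) : DiscSeries k' :=
  ⟨fun z => conj (v.fn z), isHol_conj h h0 v.2.1, by
    subst h
    rw [bergmanMeasure_neg]
    exact v.2.2.star⟩

variable (h : k' = -k) (h0 : k ≠ 0)

theorem conjV_fn (v : DiscSeries k) (z : ℍ) : (conjV h h0 v).fn z = conj (v.fn z) := rfl

theorem conjV_conjV (h' : k = -k') (h0' : k' ≠ 0) (v : DiscSeries k) :
    conjV h' h0' (conjV h h0 v) = v := by
  ext z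
  rw [conjV_fn, conjV_fn, Complex.conj_conj]

theorem norm_conjV (v : DiscSeries k) : ‖conjV h h0 v‖ = ‖v‖ := by
  have h1 : ENNReal.ofReal (‖conjV h h0 v‖ ^ 2) = ENNReal.ofReal (‖v‖ ^ 2) := by
    subst h
    rw [ofReal_norm_sq, ofReal_norm_sq, bergmanMeasure_neg]
    refine lintegral_congr fun z => ?_
    rw [conjV_fn, ← ofReal_norm, ← ofReal_norm, RCLike.norm_conj]
  rw [ENNReal.ofReal_eq_ofReal_iff (by positivity) (by positivity)] at h1
  exact (pow_left_inj₀ (norm_nonneg _) (norm_nonneg _) two_ne_zero).mp h1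

/-- Complex conjugation as a real-linear isometry. -/
noncomputable def conjL : DiscSeries k →ₗᵢ[ℝ] DiscSeries k' where
  toFun := conjV h h0
  map_add' u v := by ext z; simp [conjV_fn]
  map_smul' c v := by
    ext z
    change conj ((c : ℂ) * v.fn z) = (c : ℂ) * conj (v.fn z)
    rw [map_mul, Complex.conj_ofReal]
  norm_map' := norm_conjV h h0

theorem discRep_conjV (g : SL(2, ℝ)) (v : DiscSeries k) :
    discRep k' g (conjV h h0 v) = conjV h h0 (discRep k g v) := by
  ext z
  change (autFactor k' g⁻¹ z)⁻¹ * conj (v.fn (g⁻¹ • z))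
    = conj ((autFactor k g⁻¹ z)⁻¹ * v.fn (g⁻¹ • z))
  rw [autFactor_conj h h0, map_mul, map_inv₀]

theorem conjV_mem {v : DiscSeries k} (hv : v ∈ smoothVectors k) :
    conjV h h0 v ∈ smoothVectors k' := fun g => by
  have h1 := (conjL h h0).toContinuousLinearMap.contDiff.comp (hv g)
  have h2 : (fun x => discRep k' (iwasawa x * g) (conjV h h0 v))
      = (conjL h h0).toContinuousLinearMap ∘ fun x => discRep k (iwasawa x * g) v :=
    funext fun x => discRep_conjV h h0 _ v
  rw [h2]
  exact h1

/-- Complex conjugation on smooth vectors. -/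
noncomputable def conjS (v : smoothVectors k) : smoothVectors k' :=
  ⟨conjV h h0 v, conjV_mem h h0 v.2⟩

theorem smoothRep_conjS (g : SL(2, ℝ)) (v : smoothVectors k) :
    smoothRep k' g (conjS h h0 v) = conjS h h0 (smoothRep k g v) :=
  Subtype.ext (discRep_conjV h h0 g v)

theorem conjS_conjS (h' : k = -k') (h0' : k' ≠ 0) (v : smoothVectors k) :
    conjS h' h0' (conjS h h0 v) = v :=
  Subtype.ext (conjV_conjV h h0 h' h0' v)

/-- Conjugation is a real-linear isometry intertwining the two actions, so it commutes with
derivatives along one-parameter subgroups. -/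
theorem lieWord_conjV [Fact (2 ≤ k)] (w : List (Fin 3)) (v : smoothVectors k) :
    lieWord k' w (conjV h h0 v) = conjV h h0 (wordS w v : smoothVectors k) := by
  induction w with
  | nil => rfl
  | cons i w ih =>
    change lieAct k' i (lieWord k' w _) = _
    rw [ih]
    have h1 := (conjL h h0).toContinuousLinearMap.hasFDerivAt.comp_hasDerivAt (0 : ℝ)
      (hasDerivAt_oneParam_zero i (wordS w v : smoothVectors k).2)
    refine HasDerivAt.deriv (h1.congr_of_eventuallyEq (Filter.Eventually.of_forall fun s => ?_))
    exact discRep_conjV h h0 _ _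

/-- The conjugate of a functional, on the conjugate representation. -/
noncomputable def conjFunctional (l : smoothVectors k' →ₗ[ℂ] ℂ) : smoothVectors k →ₗ[ℂ] ℂ where
  toFun u := conj (l (conjS h h0 u))
  map_add' u v := by
    have : conjS h h0 (u + v) = conjS h h0 u + conjS h h0 v :=
      Subtype.ext ((conjL h h0).map_add _ _)
    rw [this, map_add, map_add]
  map_smul' c v := by
    have : conjS h h0 (c • v) = conj c • conjS h h0 v := by
      refine Subtype.ext (DiscSeries.ext fun z => ?_)
      exact map_mul _ _ _
    rw [this, map_smul, smul_eq_mul, map_mul, Complex.conj_conj]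
    rfl

theorem conjFunctional_apply (l : smoothVectors k' →ₗ[ℂ] ℂ) (u : smoothVectors k) :
    conjFunctional h h0 l u = conj (l (conjS h h0 u)) := rfl

theorem isDist_conjFunctional [Fact (2 ≤ k)] {l : smoothVectors k' →ₗ[ℂ] ℂ}
    (hl : ∃ (S : Finset (List (Fin 3))) (C : ℝ),
      ∀ v : smoothVectors k', ‖l v‖ ≤ C * ∑ w ∈ S, ‖lieWord k' w v‖) :
    IsDist (conjFunctional h h0 l) := by
  obtain ⟨S, C, hS⟩ := hl
  refine ⟨S, C, fun u => ?_⟩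
  have h1 : ∀ w, ‖lieWord k' w (conjS h h0 u : DiscSeries k')‖ = ‖(wordS w u : DiscSeries k)‖ :=
    fun w => (congrArg norm (lieWord_conjV h h0 w u)).trans (norm_conjV h h0 _)
  have h2 := hS (conjS h h0 u)
  simp only [h1] at h2
  rwa [conjFunctional_apply, RCLike.norm_conj]

/-! ### Continuity of matrix coefficients -/

/-- The inverse factors into one-parameter subgroups in reverse order, each strongly continuous. -/
theorem IsDist.continuous_iwasawa [Fact (2 ≤ k)] {l : smoothVectors k →ₗ[ℂ] ℂ} (hl : IsDist l)
    (v : smoothVectors k) : Continuous fun x => l (smoothRep k (iwasawa x)⁻¹ v) := by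
  have h1 : StrongCont k fun x : ℝ × ℝ × ℝ =>
      oneParam 2 (-x.2.2) * (oneParam 1 (-x.2.1) * oneParam 0 (-x.1)) :=
    ((strongCont_oneParam 2).comp (by fun_prop)).mul
      (((strongCont_oneParam 1).comp (by fun_prop)).mul ((strongCont_oneParam 0).comp (by fun_prop)))
  have h2 : ∀ x, (iwasawa x)⁻¹
      = oneParam 2 (-x.2.2) * (oneParam 1 (-x.2.1) * oneParam 0 (-x.1)) := fun x => by
    rw [oneParam_neg, oneParam_neg, oneParam_neg, iwasawa, mul_inv_rev, mul_inv_rev]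
    rfl
  simp only [h2]
  exact hl.continuous_orbit h1 v

end DiscSeries

open DiscSeries

theorem mainTheorem4 (n : ℤ) (hn : 2 ≤ |n|) (p : ℕ) (hp : 0 < p) (τ : DistVectors n)
    (hper : IsPeriodic p τ) (hconst : NoConstantTerm p τ)
    (hbdd : ∃ φ : smoothVectors (-n), φ ≠ 0 ∧
      ∃ B : ℝ, ∀ a t : ℝ, 0 < a → ‖matCoeff τ φ (diagA a * unipN t)‖ ≤ B)
    (ε : ℝ) (hε : 0 < ε) :
    ∃ C : ℝ, 0 < C ∧ ∀ a₁ : ℝ, 0 < a₁ →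
      (∀ v : smoothVectors (-n),
        ∫⁻ a in Set.Ioc 0 a₁, (∫⁻ t in Set.Ioc 0 (p : ℝ),
            ‖matCoeff τ v (diagA a * unipN t)‖ₑ ^ 2) * ENNReal.ofReal (a ^ ε / a)
          ≤ ENNReal.ofReal (C * a₁ ^ ε * ‖(v : DiscSeries (-n))‖ ^ 2)) ∧
      (∀ v : smoothVectors (-n),
        ∫⁻ θ in Set.Ico 0 (2 * Real.pi), ∫⁻ a in Set.Ioc 0 a₁, (∫⁻ t in Set.Ioc 0 (p : ℝ),
            ‖matCoeff τ v (rotK θ * diagA a * unipN t)‖ₑ ^ 2) * ENNReal.ofReal (a ^ ε / a)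
          ≤ ENNReal.ofReal (C * a₁ ^ ε * ‖(v : DiscSeries (-n))‖ ^ 2)) ∧
      (∃ T : DiscSeries (-n) →L[ℂ] Lp ℂ 2 (siegelMeasure ε a₁ p),
        (∀ v : smoothVectors (-n), T v =ᵐ[siegelMeasure ε a₁ p]
          fun x => matCoeff τ v (diagA x.1 * unipN x.2)) ∧
        ∀ v : DiscSeries (-n), ‖T v‖ ^ 2 ≤ C * a₁ ^ ε * ‖v‖ ^ 2) ∧
      (∃ T : DiscSeries (-n) →L[ℂ] Lp ℂ 2 (siegelMeasureK ε a₁ p),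
        (∀ v : smoothVectors (-n), T v =ᵐ[siegelMeasureK ε a₁ p]
          fun x => matCoeff τ v (rotK x.1 * diagA x.2.1 * unipN x.2.2)) ∧
        ∀ v : DiscSeries (-n), ‖T v‖ ^ 2 ≤ C * a₁ ^ ε * ‖v‖ ^ 2) := by
  have hp' : (0 : ℝ) < p := by exact_mod_cast hp
  obtain ⟨φ, hφ, B, hB⟩ := hbdd
  -- For `n ≥ 2` the test vectors lie in the antiholomorphic `D_{-n}`, and `τ` is first carried to
  -- the holomorphic `D_n` by conjugation. For `n ≤ -2` they are already holomorphic.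
  rcases le_abs.mp hn with hn | hn
  · have hk : Fact (2 ≤ n) := ⟨hn⟩
    have h0 : n ≠ 0 := by omega
    have h0' : -n ≠ 0 := by omega
    let l : smoothVectors n →ₗ[ℂ] ℂ := conjFunctional (k' := -n) rfl h0 τ.1
    have hcoeff : ∀ (u : smoothVectors n) (g : SL(2, ℝ)),
        matCoeff τ (conjS rfl h0 u) g = conj (l (smoothRep n g⁻¹ u)) := fun u g => by
      rw [conjFunctional_apply, Complex.conj_conj, matCoeff, smoothRep_conjS]
    let c : smoothVectors (-n) → smoothVectors n := conjS (by simp) h0'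
    have hc : ∀ v, conjS rfl h0 (c v) = v := fun v => conjS_conjS _ _ _ _ v
    have hcoeff' : ∀ (v : smoothVectors (-n)) (g : SL(2, ℝ)),
        matCoeff τ v g = conj (l (smoothRep n g⁻¹ (c v))) := fun v g => by
      rw [← hcoeff, hc]
    have hnorm : ∀ v : smoothVectors (-n), ‖(c v : DiscSeries n)‖ = ‖(v : DiscSeries (-n))‖ :=
      fun v => norm_conjV (by simp) h0' _
    have hl : IsDist l := by
      exact isDist_conjFunctional _ _ τ.2
    refine siegel_operators_of_bound τ (fun v => ?_) ?_
    · simp only [hcoeff']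
      exact Complex.continuous_conj.comp (hl.continuous_iwasawa (c v))
    · have hper' : ∀ u, l (smoothRep n (unipN (-p)) u) = l u := fun u => by
        have h1 := hper (conjS rfl h0 u)
        rw [hcoeff, ← unipN_neg] at h1
        have h2 := congrArg conj h1
        rwa [Complex.conj_conj] at h2
      have hconst' : ∀ u, ∫ t in (0 : ℝ)..p, l (smoothRep n (unipN (-t)) u) = 0 := fun u => by
        have h1 := hconst (conjS rfl h0 u)
        simp only [hcoeff, ← unipN_neg] at h1
        rw [intervalIntegral.integral_of_le hp'.le] at h1 ⊢
        rwa [integral_conj, map_eq_zero] at h1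
      have hφ' : c φ ≠ 0 := fun h1 => hφ <| by
        rw [← hc φ, h1]
        refine Subtype.ext (DiscSeries.ext fun z => ?_)
        exact map_zero _
      have hB' : ∀ a t : ℝ, 0 < a → ‖l (smoothRep n (diagA a * unipN t)⁻¹ (c φ))‖ ≤ B :=
        fun a t ha => by
          have h1 := hB a t ha
          rwa [hcoeff', RCLike.norm_conj] at h1
      obtain ⟨C, hC, h⟩ := exists_siegel_bound hl hp' hper' hconst' hφ' hB' hε
      refine ⟨C, hC, fun a₁ ha₁ v => ?_⟩
      have h1 := h a₁ ha₁ (c v)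
      rw [hnorm] at h1
      refine le_trans (le_of_eq ?_) h1
      refine lintegral_congr fun a => ?_
      congr 1
      refine lintegral_congr fun t => ?_
      rw [hcoeff', ← ofReal_norm, ← ofReal_norm, RCLike.norm_conj]
  · have hk : Fact (2 ≤ -n) := ⟨hn⟩
    have hl : IsDist τ.1 := by
      obtain ⟨S, C, h⟩ := τ.2
      refine ⟨S, C, fun v => ?_⟩
      simpa only [coe_wordS] using h v
    refine siegel_operators_of_bound τ (fun v => hl.continuous_iwasawa v) ?_
    refine exists_siegel_bound hl hp' (fun u => ?_) (fun u => ?_) hφ hB hε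
    · rw [unipN_neg]; exact hper u
    · simp only [unipN_neg]; exact hconst u
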